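/- Conventions. $\mathbb T^3=\mathbb R^3/\mathbb Z^3$; $(-\Delta)^\gamma$ is the Fourier multiplier $|2\pi k|^{2\gamma}$, $k\in\mathbb Z^3$. For $m\in\mathbb N$ and $0<\alpha<1$ the spatial Hölder norms are $[f]_m=\max_{|\theta|=m}\sup|D^\theta f|$, $\|f\|_m=\sum_{j\le m}[f]_j$, $\|f\|_{m+\alpha}=\|f\|_m+\max_{|\theta|=m}\sup_{x\ne y}|D^\theta f(x)-D^\theta f(y)|/|x-y|^\alpha$. Fix a kernel $\psi\in C_c^\infty(\mathbb R^3)$ with $\psi\ge0$, $\int\psi=1$, and put $\psi_\ell(x)=\ell^{-3}\psi(x/\ell)$. Parameters. Let $0<\beta<\frac13$, $0<\gamma<\frac13$, $1<b<\min\{\frac{1-\beta}{2\beta},\frac43\}$, $\alpha>0$, $a>1$, $M>0$, $0<\nu<1$, $T>0$. For $q\in\mathbb N$ let $$\lambda_q=2\pi\lceil a^{(b^q)}\rceil,\quad \delta_q=\lambda_q^{-2\beta},\quad \ell=\frac{\delta_{q+1}^{1/2}}{\delta_q^{1/2}\lambda_q^{1+3\alpha/2}},\quad \tau_q=\frac{\ell^{2\alpha}}{\delta_q^{1/2}\lambda_q},\quad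 t_i=i\tau_q\ (i\in\mathbb N).$$ Approximate solution. Let $(v_q,p_q,\mathring R_q)$ be smooth on $\mathbb T^3\times[0,T]$, with $\operatorname{tr}\mathring R_q=0$, $\int_{\mathbb T^3}p_q\,dx=0$, $$\partial_tv_q+\operatorname{div}(v_q\otimes v_q)+\nabla p_q+\nu(-\Delta)^\gamma v_q=\operatorname{div}\mathring R_q,\qquad \operatorname{div}v_q=0,$$ and, at every time in $[0,T]$, $\|\mathring R_q\|_0\le\delta_{q+1}\lambda_q^{-3\alpha}$, $\|v_q\|_1\le M\delta_q^{1/2}\lambda_q$, $\|v_q\|_0\le1-\delta_q^{1/2}$. Let $v_\ell=v_q*\psi_\ell$ (convolution in space) and $p_\ell=p_q*\psi_\ell+\frac13\big(|v_q|^2*\psi_\ell-|v_\ell|^2\big)$, which is the pressure for which $(v_\ell,p_\ell,\mathring R_\ell)$ solves the same system, where $\mathring R_\ell=\mathring R_q*\psi_\ell-(v_q\mathring\otimes v_q)*\psi_\ell+v_\ell\mathring\otimes v_\ell$ and $\mathring\otimes$ is the trace-free part of $\otimes$. Exact solutions. Let $t_i<S\le\min\{T,t_i+2\tau_q\}$ and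 let $(v_i,p_i)$ be any smooth solution on $\mathbb T^3\times[t_i,S]$ of $$\partial_tv_i+\operatorname{div}(v_i\otimes v_i)+\nabla p_i+\nu(-\Delta)^\gamma v_i=0,\qquad \operatorname{div}v_i=0,\qquad v_i(\cdot,t_i)=v_\ell(\cdot,t_i).$$ Write $D_{t,\ell}=\partial_t+v_\ell\cdot\nabla$ and $L_{t,\ell,\gamma}=D_{t,\ell}+\nu(-\Delta)^\gamma$. Proposition 4.4. There are a threshold $\alpha_0>0$ depending only on $\beta,b$, a threshold $a_0$ depending only on $\beta,b,\alpha,M,\psi$, and constants $C_N$ depending only on $N,\alpha,\beta,\gamma,M,\psi$ (in particular not on $a$, $b$, $q$, $\nu$, $T$, $i$, $S$) such that, if $0<\alpha<\alpha_0$ and $a\ge a_0$, then for all $N\ge0$ and all $t\in[t_i,S]$ (so that $0\le t-t_i\le2\tau_q$), at time $t$, $$\|v_i-v_\ell\|_{N+\alpha}\le C_N\,\tau_q\delta_{q+1}\ell^{-N-1+\alpha},$$ $$\|\nabla(p_\ell-p_i)\|_{N+\alpha}\le C_N\,\delta_{q+1}\ell^{-N-1+\alpha},$$ $$\|L_{t,\ell,\gamma}(v_i-v_\ell)\|_{N+\alpha}\le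 C_N\,\delta_{q+1}\ell^{-N-1+\alpha},$$ $$\|D_{t,\ell}(v_i-v_\ell)\|_{N+\alpha}\le C_N\,\delta_{q+1}\ell^{-N-1+\alpha}.$$ -/

import Mathlib

open MeasureTheory Set
open scoped ENNReal ContDiff Convolution

noncomputable section

namespace FracNS

/-- Physical space. Functions on the torus `ℝ³/ℤ³` are represented by `ℤ³`-periodic functions
on `ℝ³`, with the Euclidean norm. -/
abbrev E3 : Type := EuclideanSpace ℝ (Fin 3)

/-- 3 × 3 matrix values. The norm is the largest absolute value of an entry. -/
abbrev Mat3 : Type := Fin 3 → Fin 3 → ℝ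

/-- The `i`-th standard basis vector. -/
def e (i : Fin 3) : E3 := EuclideanSpace.single i (1 : ℝ)

/-- Periodicity with respect to `ℤ³`. -/
def IsPeriodic {F : Type*} (f : E3 → F) : Prop := ∀ (x : E3) (i : Fin 3), f (x + e i) = f x

/-- The fundamental cell `[0,1)³` of the torus. -/
def unitCube : Set E3 := {x | ∀ i, x i ∈ Ico (0 : ℝ) 1}

/-! ### Spatial Hölder norms (with values in `[0,∞]`) -/

section Holder

variable {F : Type*} [NormedAddCommGroup F] [NormedSpace ℝ F]

/-- The iterated partial derivative `∂_{θ 0} ⋯ ∂_{θ (m-1)} f (x)` of order `m`. -/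
def partialD (m : ℕ) (θ : Fin m → Fin 3) (f : E3 → F) (x : E3) : F :=
  iteratedFDeriv ℝ m f x (fun j => e (θ j))

/-- `[f]_m`, the maximum over all partial derivatives of order `m` of the supremum norm. -/
def cSemi (m : ℕ) (f : E3 → F) : ℝ≥0∞ :=
  ⨆ (θ : Fin m → Fin 3) (x : E3), ‖partialD m θ f x‖ₑ

/-- `‖f‖_m = ∑_{j ≤ m} [f]_j`. -/
def cNorm (m : ℕ) (f : E3 → F) : ℝ≥0∞ := ∑ j ∈ Finset.range (m + 1), cSemi j f

/-- `[f]_{m+α}`, the maximum over all partial derivatives of order `m` of the `α`-Hölder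
seminorm. -/
def holderSemi (m : ℕ) (α : ℝ) (f : E3 → F) : ℝ≥0∞ :=
  ⨆ (θ : Fin m → Fin 3) (x : E3) (y : E3) (_ : x ≠ y),
    ‖partialD m θ f x - partialD m θ f y‖ₑ / ‖x - y‖ₑ ^ α

/-- `‖f‖_{m+α} = ‖f‖_m + [f]_{m+α}`. -/
def holderNorm (m : ℕ) (α : ℝ) (f : E3 → F) : ℝ≥0∞ := cNorm m f + holderSemi m α f

end Holder

/-! ### Differential operators and the fractional Laplacian -/

/-- `div u = ∑ᵢ ∂ᵢ uᵢ`. -/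
def divVec (u : E3 → E3) (x : E3) : ℝ := ∑ i, fderiv ℝ (fun y => u y i) x (e i)

/-- `(div A)ᵢ = ∑ⱼ ∂ⱼ Aᵢⱼ`. -/
def divMat (A : E3 → Mat3) (x : E3) : E3 :=
  WithLp.toLp 2 fun i => ∑ j, fderiv ℝ (fun y => A y i j) x (e j)

/-- `(u ⊗ w)ᵢⱼ = uᵢ wⱼ`. -/
def tensor (u w : E3) : Mat3 := fun i j => u i * w j

/-- The character `exp (2π i k·x)` of the torus. -/
def character (k : Fin 3 → ℤ) (x : E3) : ℂ :=
  Complex.exp (2 * Real.pi * Complex.I * ((∑ i, (k i : ℝ) * x i : ℝ) : ℂ))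

/-- The Fourier coefficient `∫_{𝕋³} f(x) exp (-2π i k·x) dx`. -/
def fourierCoef (f : E3 → ℝ) (k : Fin 3 → ℤ) : ℂ :=
  ∫ x in unitCube, (f x : ℂ) * character (-k) x

/-- `(-Δ)^γ` on (smooth periodic) scalar functions: the Fourier multiplier `|2πk|^{2γ}`. The series
converges absolutely for smooth periodic `f`, and its sum is real for real `f`. -/
def fracLapScalar (γ : ℝ) (f : E3 → ℝ) (x : E3) : ℝ :=
  (∑' k : Fin 3 → ℤ,
    (((2 * Real.pi * Real.sqrt (∑ i, (k i : ℝ) ^ 2)) ^ (2 * γ) : ℝ) : ℂ)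
      * fourierCoef f k * character k x).re

/-- `(-Δ)^γ` on vector fields, component by component. -/
def fracLap (γ : ℝ) (u : E3 → E3) (x : E3) : E3 :=
  WithLp.toLp 2 fun i => fracLapScalar γ (fun y => u y i) x

/-! ### The fractional Navier–Stokes–Reynolds system -/

/-- Smoothness on `[t₀,t₁] × ℝ³`, up to the end times. -/
def SmoothOn {F : Type*} [NormedAddCommGroup F] [NormedSpace ℝ F] (t₀ t₁ : ℝ)
    (f : ℝ → E3 → F) : Prop :=
  ContDiffOn ℝ ∞ (fun z : ℝ × E3 => f z.1 z.2) (Icc t₀ t₁ ×ˢ univ)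

/-- `(v, p, R)` is a smooth periodic solution on `[t₀,t₁]` of
`∂ₜ v + div (v ⊗ v) + ∇p + ν (-Δ)^γ v = div R`, `div v = 0`. -/
structure IsReynoldsSolution (ν γ t₀ t₁ : ℝ) (v : ℝ → E3 → E3) (p : ℝ → E3 → ℝ)
    (R : ℝ → E3 → Mat3) : Prop where
  smooth_v : SmoothOn t₀ t₁ v
  smooth_p : SmoothOn t₀ t₁ p
  smooth_R : SmoothOn t₀ t₁ R
  periodic_v : ∀ t ∈ Icc t₀ t₁, IsPeriodic (v t)
  periodic_p : ∀ t ∈ Icc t₀ t₁, IsPeriodic (p t)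
  periodic_R : ∀ t ∈ Icc t₀ t₁, IsPeriodic (R t)
  momentum : ∀ t ∈ Icc t₀ t₁, ∀ x,
    derivWithin (fun s => v s x) (Icc t₀ t₁) t + divMat (fun y => tensor (v t y) (v t y)) x
      + gradient (p t) x + ν • fracLap γ (v t) x = divMat (R t) x
  incompressible : ∀ t ∈ Icc t₀ t₁, ∀ x, divVec (v t) x = 0

/-- `(v, p)` is a smooth periodic solution on `[t₀,t₁]` of the fractional Navier–Stokes
equations. -/
def IsSolution (ν γ t₀ t₁ : ℝ) (v : ℝ → E3 → E3) (p : ℝ → E3 → ℝ) : Prop :=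
  IsReynoldsSolution ν γ t₀ t₁ v p (fun _ _ => 0)

/-! ### Parameters -/

/-- The frequency `λ_q = 2π ⌈a^(b^q)⌉`. -/
def lam (a b : ℝ) (q : ℕ) : ℝ := 2 * Real.pi * (⌈a ^ (b ^ q)⌉₊ : ℝ)

/-- The amplitude `δ_q = λ_q^(-2β)`. -/
def del (β a b : ℝ) (q : ℕ) : ℝ := lam a b q ^ (-2 * β)

/-- The mollification scale `ℓ = δ_{q+1}^{1/2} / (δ_q^{1/2} λ_q^{1+3α/2})`. -/
def ell (β α a b : ℝ) (q : ℕ) : ℝ :=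
  Real.sqrt (del β a b (q + 1)) / (Real.sqrt (del β a b q) * lam a b q ^ (1 + 3 * α / 2))

/-- The time scale `τ_q = ℓ^{2α} / (δ_q^{1/2} λ_q)`. -/
def tau (β α a b : ℝ) (q : ℕ) : ℝ :=
  ell β α a b q ^ (2 * α) / (Real.sqrt (del β a b q) * lam a b q)

/-- The range `0 < β < 1/3`, `1 < b < min {(1-β)/(2β), 4/3}` of the parameters. -/
def Admissible (β b : ℝ) : Prop :=
  0 < β ∧ β < 1 / 3 ∧ 1 < b ∧ b < min ((1 - β) / (2 * β)) (4 / 3)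

/-! ### Mollification -/

/-- Mollification kernels; radial symmetry is not required. -/
structure IsMollifier (ψ : E3 → ℝ) : Prop where
  smooth : ContDiff ℝ ∞ ψ
  compact : HasCompactSupport ψ
  nonneg : ∀ x, 0 ≤ ψ x
  integral_eq_one : ∫ x, ψ x = 1

/-- `ψ_ℓ (x) = ℓ^{-3} ψ (x / ℓ)`. -/
def rescale (ψ : E3 → ℝ) (l : ℝ) (x : E3) : ℝ := (l ^ 3)⁻¹ * ψ (l⁻¹ • x)

/-- The spatial mollification `f * ψ_ℓ`. -/
def mollify {F : Type*} [NormedAddCommGroup F] [NormedSpace ℝ F] (ψ : E3 → ℝ) (l : ℝ)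
    (f : E3 → F) : E3 → F :=
  rescale ψ l ⋆[ContinuousLinearMap.lsmul ℝ ℝ, volume] f

/-- `v_ℓ = v * ψ_ℓ`, at every time. -/
def mollVel (ψ : E3 → ℝ) (l : ℝ) (v : ℝ → E3 → E3) : ℝ → E3 → E3 := fun t => mollify ψ l (v t)

/-- The pressure of the mollified system: if `(v, p, R)` solves the Reynolds system, then, with
`A° = A - (1/3) tr(A) Id` and `v_ℓ = v * ψ_ℓ`, the triple consisting of `v_ℓ`, of
`p_ℓ = p * ψ_ℓ + (1/3) (|v|² * ψ_ℓ - |v_ℓ|²)`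
and of `R_ℓ = R * ψ_ℓ - (v ⊗ v)° * ψ_ℓ + (v_ℓ ⊗ v_ℓ)°` solves it too. This determines `p_ℓ` up
to a function of time, so it determines the gradient of `p_ℓ`. -/
def mollPres (ψ : E3 → ℝ) (l : ℝ) (v : ℝ → E3 → E3) (p : ℝ → E3 → ℝ) : ℝ → E3 → ℝ :=
  fun t x => mollify ψ l (p t) x
    + (1 / 3) * (mollify ψ l (fun y => ‖v t y‖ ^ 2) x - ‖mollVel ψ l v t x‖ ^ 2)

/-- The material derivative `D_t w = ∂ₜ w + (u · ∇) w` along `u` of a field `w` on the time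
interval `[t₀,t₁]`. -/
def materialD (t₀ t₁ : ℝ) (u w : ℝ → E3 → E3) (t : ℝ) (x : E3) : E3 :=
  derivWithin (fun s => w s x) (Icc t₀ t₁) t + fderiv ℝ (w t) x (u t x)

/-- The operator `D_t + ν (-Δ)^γ`. -/
def dissipativeD (ν γ t₀ t₁ : ℝ) (u w : ℝ → E3 → E3) (t : ℝ) (x : E3) : E3 :=
  materialD t₀ t₁ u w t x + ν • fracLap γ (w t) x

/-- The assumptions on the approximate solution at stage `q`: a smooth solution of the Reynolds
system on `[0,T]` with trace-free stress and mean-free pressure, which obeys the size bounds in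
terms of `λ_q` and `δ_q`. -/
structure IsApproxSolution (M β γ α a b ν T : ℝ) (q : ℕ) (v : ℝ → E3 → E3) (p : ℝ → E3 → ℝ)
    (R : ℝ → E3 → Mat3) : Prop where
  solution : IsReynoldsSolution ν γ 0 T v p R
  trace_free : ∀ t ∈ Icc 0 T, ∀ x, ∑ i, R t x i i = 0
  mean_free : ∀ t ∈ Icc 0 T, ∫ x in unitCube, p t x = 0
  stress_bound : ∀ t ∈ Icc 0 T,
    cNorm 0 (R t) ≤ ENNReal.ofReal (del β a b (q + 1) * lam a b q ^ (-3 * α))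
  vel_bound_one : ∀ t ∈ Icc 0 T,
    cNorm 1 (v t) ≤ ENNReal.ofReal (M * Real.sqrt (del β a b q) * lam a b q)
  vel_bound_zero : ∀ t ∈ Icc 0 T,
    cNorm 0 (v t) ≤ ENNReal.ofReal (1 - Real.sqrt (del β a b q))

end FracNS

end

open FracNS

/-!
# Stability of the mollified fractional Navier-Stokes system

Write `u = v_ℓ` for the mollified velocity, `v` for the exact solution which agrees with `u` at the
initial time, `w = v - u`, and `π` for the pressure of `u` minus the pressure of `v`. Mollification
gives a force `r = div R_ℓ`, and
`∂ₜw + v·∇w + ν(-Δ)^γ w = ∇π - r - w·∇u`, `div w = 0`, `w = 0` at the initial time.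
This is a transport equation for `w` with a right-hand side which is linear in `w` up to `r`. On a
time interval of length `τ` such an equation gives `w ≲ τ r` provided `τ ‖∇v‖` is bounded, and `∇π`
is no worse than the other terms by elliptic regularity. Four points make this precise.

*Transport with dissipation.* The estimates may not depend on `ν` and `γ`. The fractional Laplacian
is a positive superposition of the operators `1 - e^{sΔ}` (`fracLapScalar_eq`), hence has a sign at
a maximum, and also at a pair of points at which the difference of two translates of a function is
maximal (`fracLapScalar_le_of_touching`). Therefore the maximum principle applies to the function
and to its Hölder quotients in the presence of a Lipschitz drift (`holder_bound_of_transport`,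
`HB.of_transport`); the price is a factor `e^{κ(t-t₀)}` with `κ` comparable to the Lipschitz
constant of the drift.

*Pressure.* The operator `∇Δ⁻¹div` is bounded on `C^α` (`schauder`), which is proved with the
smoothing estimates of the heat semigroup. Since all the fields are divergence free, `Δπ` is the
divergence of `w·∇(v + u) + r`, and also a sum of products of first derivatives plus `div r`
(`Perturbation.lap_π`). The first form bounds `∇π` without derivatives of `w`; the second bounds the
derivatives of order `N ≥ 1` of `∇π` without derivatives of `w` of order `N + 1`.

*The gradient of `v`.* Only `∇u` is controlled by hypothesis. A continuity argument shows that the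
`C^α` norm of `∇v` at most quadruples as long as the product of the time and its initial value is
small (`hb_gradient`). The product is of order `τ_q δ_q^{1/2} λ_q ℓ^{-α} = ℓ^α`, which is small when
`a` is large; this is the only smallness used, and it involves neither the order of differentiation
nor `γ`.

*Higher derivatives.* By induction on the order `N`, a derivative of order `N` of `w` solves a
transport equation whose right-hand side is bounded by `C (Λ Z + E ℓ^{-N})`, where `Z` bounds all the
derivatives of order `N`, `Λ` is the size of `∇u` and `E` that of `r`. Working with the weight
`e^{κ(t-t₀)}` for large `κ` absorbs the term `C Λ Z`, and `κ τ` stays bounded because `τ Λ ≤ 1`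
(`Perturbation.closing`, `Perturbation.main_bound`).

The bounds for `u` and `r` come from the scaling of the kernel and the commutator estimate of
Constantin, E and Titi (`abs_Dw_commut_le`), and enter through `perturbation_of_approx`. The material
derivative without dissipation needs in addition that `(-Δ)^γ` costs `ℓ^{-2γ}` on functions which
live at the scale `ℓ` (`HB.fracLapScalar`), and that `τ_q ℓ^{-2γ}` is bounded (`params`); it is
here that `γ < 1/3` and the threshold for `α` matter.
-/

noncomputable section

namespace FracNS

section

open scoped Pointwise

/-! ### Periodic functions -/

section Periodic

variable {F : Type*}

/-- Every point can be moved by a lattice vector into the ball of radius `2`, which makes suprema of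
periodic functions suprema over compact sets. -/
theorem exists_lattice_shift (x : E3) : ∃ d : E3, ‖x + d‖ ≤ 2 ∧
    ∀ {F : Type} (f : E3 → F), IsPeriodic f → ∀ y, f (y + d) = f y := by
  refine ⟨(-⌊x 0⌋) • e 0 + (-⌊x 1⌋) • e 1 + (-⌊x 2⌋) • e 2, ?_, ?_⟩
  · have h : ‖x + ((-⌊x 0⌋) • e 0 + (-⌊x 1⌋) • e 1 + (-⌊x 2⌋) • e 2)‖ ^ 2 ≤ 2 ^ 2 := by
      rw [EuclideanSpace.norm_sq_eq]
      have h0 : ∀ i : Fin 3, (x + ((-⌊x 0⌋) • e 0 + (-⌊x 1⌋) • e 1 + (-⌊x 2⌋) • e 2)) i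
          = Int.fract (x i) := by
        intro i
        rw [← Int.self_sub_floor]
        fin_cases i <;> simp [e, -Int.self_sub_floor] <;> ring
      simp only [h0, Fin.sum_univ_three, Real.norm_eq_abs, sq_abs]
      have h1 : ∀ i, Int.fract (x i) ^ 2 ≤ 1 := fun i => by
        have := Int.fract_nonneg (x i)
        have := (Int.fract_lt_one (x i)).le
        nlinarith
      linarith [h1 0, h1 1, h1 2]
    exact le_of_sq_le_sq h (by norm_num)
  · intro F f hf
    have h : ∀ i, Function.Periodic f (e i) := fun i x => hf x i
    exact (((h 0).zsmul _).add_period ((h 1).zsmul _)).add_period ((h 2).zsmul _)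

end Periodic

/-! ### Smooth periodic space-time functions -/

section SpaceTime

variable {F : Type} [NormedAddCommGroup F] [NormedSpace ℝ F]

/-- The space-time slab `[t₀,t₁] × ℝ³`. -/
def slab (t₀ t₁ : ℝ) : Set (ℝ × E3) := Icc t₀ t₁ ×ˢ univ

theorem mem_slab {t₀ t₁ t : ℝ} {x : E3} : (t, x) ∈ slab t₀ t₁ ↔ t ∈ Icc t₀ t₁ := by
  simp [slab]

theorem uniqueDiffOn_slab {t₀ t₁ : ℝ} (h : t₀ < t₁) : UniqueDiffOn ℝ (slab t₀ t₁) :=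
  (uniqueDiffOn_Icc h).prod uniqueDiffOn_univ

theorem convex_slab (t₀ t₁ : ℝ) : Convex ℝ (slab t₀ t₁) := (convex_Icc t₀ t₁).prod convex_univ

/-- Smooth on the slab and periodic in space. -/
structure SmoothPer (t₀ t₁ : ℝ) (f : ℝ × E3 → F) : Prop where
  smooth : ContDiffOn ℝ ∞ f (slab t₀ t₁)
  per : ∀ t ∈ Icc t₀ t₁, IsPeriodic fun x => f (t, x)

theorem SmoothPer.bounded {t₀ t₁ : ℝ} {f : ℝ × E3 → F} (hf : SmoothPer t₀ t₁ f) :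
    ∃ K, 0 ≤ K ∧ ∀ z ∈ slab t₀ t₁, ‖f z‖ ≤ K := by
  have hc : IsCompact (Icc t₀ t₁ ×ˢ Metric.closedBall (0 : E3) 2) :=
    isCompact_Icc.prod (isCompact_closedBall _ _)
  obtain ⟨K, hK⟩ := hc.exists_bound_of_continuousOn
    (hf.smooth.continuousOn.mono (prod_mono le_rfl (subset_univ _)))
  refine ⟨max K 0, le_max_right _ _, ?_⟩
  rintro ⟨t, x⟩ hz
  obtain ⟨d, hd, hper⟩ := exists_lattice_shift x
  have h1 := hper _ (hf.per t (mem_slab.1 hz)) x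
  have h2 := hK (t, x + d) ⟨mem_slab.1 hz, by simpa using hd⟩
  rw [h1] at h2
  exact h2.trans (le_max_left _ _)

theorem SmoothPer.fderivWithin {t₀ t₁ : ℝ} (h : t₀ < t₁) {f : ℝ × E3 → F}
    (hf : SmoothPer t₀ t₁ f) : SmoothPer t₀ t₁ (fderivWithin ℝ f (slab t₀ t₁)) := by
  refine ⟨hf.smooth.fderivWithin (uniqueDiffOn_slab h) (by simp), fun t ht x i => ?_⟩
  have h1 : ((0 : ℝ), e i) +ᵥ slab t₀ t₁ = slab t₀ t₁ := by
    ext ⟨s, y⟩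
    simp [mem_vadd_set_iff_neg_vadd_mem, slab]
  have h2 := fderivWithin_comp_add_right (𝕜 := ℝ) (f := f) (x := (t, x)) (s := slab t₀ t₁)
    ((0 : ℝ), e i)
  rw [h1] at h2
  have h3 : (t, x) + ((0 : ℝ), e i) = (t, x + e i) := by simp
  rw [h3] at h2
  simp only
  rw [← h2]
  refine fderivWithin_congr ?_ ?_
  · rintro ⟨s, y⟩ hs
    simpa using hf.per s (mem_slab.1 hs) y i
  · simpa using hf.per t ht x i

/-- A smooth periodic function is Lipschitz on the slab. -/
theorem SmoothPer.lipschitz {t₀ t₁ : ℝ} (h : t₀ < t₁) {f : ℝ × E3 → F}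
    (hf : SmoothPer t₀ t₁ f) :
    ∃ L, 0 ≤ L ∧ ∀ z ∈ slab t₀ t₁, ∀ z' ∈ slab t₀ t₁, ‖f z' - f z‖ ≤ L * ‖z' - z‖ := by
  obtain ⟨L, hL0, hL⟩ := (hf.fderivWithin h).bounded
  exact ⟨L, hL0, fun z hz z' hz' => (convex_slab t₀ t₁).norm_image_sub_le_of_norm_fderivWithin_le
    (hf.smooth.differentiableOn (by simp)) hL hz hz'⟩

/-- First order Taylor expansion with a uniform quadratic remainder. -/
theorem SmoothPer.taylor {t₀ t₁ : ℝ} (h : t₀ < t₁) {f : ℝ × E3 → F}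
    (hf : SmoothPer t₀ t₁ f) :
    ∃ L, 0 ≤ L ∧ ∀ z ∈ slab t₀ t₁, ∀ z' ∈ slab t₀ t₁,
      ‖f z' - f z - _root_.fderivWithin ℝ f (slab t₀ t₁) z (z' - z)‖ ≤ L * ‖z' - z‖ ^ 2 := by
  obtain ⟨L, hL0, hL⟩ := (hf.fderivWithin h).lipschitz h
  refine ⟨L, hL0, fun z hz z' hz' => ?_⟩
  have hconv : Convex ℝ (slab t₀ t₁ ∩ Metric.closedBall z ‖z' - z‖) :=
    (convex_slab t₀ t₁).inter (convex_closedBall _ _)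
  have := hconv.norm_image_sub_le_of_norm_hasFDerivWithin_le' (𝕜 := ℝ)
    (f := f) (f' := _root_.fderivWithin ℝ f (slab t₀ t₁))
    (φ := _root_.fderivWithin ℝ f (slab t₀ t₁) z) (C := L * ‖z' - z‖) (x := z) (y := z')
    (fun y hy => ((hf.smooth.differentiableOn (by simp) y hy.1).hasFDerivWithinAt).mono
      inter_subset_left)
    (fun y hy => (hL z hz y hy.1).trans (mul_le_mul_of_nonneg_left
      (by simpa [dist_eq_norm] using hy.2) hL0))
    ⟨hz, by simp⟩ ⟨hz', by simp [dist_eq_norm]⟩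
  calc _ ≤ L * ‖z' - z‖ * ‖z' - z‖ := this
    _ = _ := by ring

/-- The average `∫ k(y) f(t, x + c y) dy` of a space-time function over its spatial translates. -/
def avgT (k : E3 → ℝ) (c : ℝ) (f : ℝ × E3 → F) (z : ℝ × E3) : F :=
  ∫ y, k y • f (z.1, z.2 + c • y)

theorem SmoothPer.integrable_avg {t₀ t₁ : ℝ} {f : ℝ × E3 → F} (hf : SmoothPer t₀ t₁ f)
    {k : E3 → ℝ} (hk : Integrable k) (c : ℝ) {z : ℝ × E3} (hz : z ∈ slab t₀ t₁) :
    Integrable fun y => k y • f (z.1, z.2 + c • y) := by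
  obtain ⟨K, -, hK⟩ := hf.bounded
  have hmem : ∀ y, (z.1, z.2 + c • y) ∈ slab t₀ t₁ := fun y => mem_slab.2 (mem_slab.1 hz)
  have hcont : Continuous fun y : E3 => f (z.1, z.2 + c • y) :=
    hf.smooth.continuousOn.comp_continuous (by fun_prop) hmem
  exact hk.smul_bdd K hcont.aestronglyMeasurable (Filter.Eventually.of_forall fun y => hK _ (hmem y))

theorem SmoothPer.hasFDerivWithinAt_avgT {t₀ t₁ : ℝ} (h : t₀ < t₁) {f : ℝ × E3 → F}
    (hf : SmoothPer t₀ t₁ f) {k : E3 → ℝ} (hk : Integrable k) (c : ℝ) {z : ℝ × E3}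
    (hz : z ∈ slab t₀ t₁) :
    HasFDerivWithinAt (avgT k c f) (avgT k c (_root_.fderivWithin ℝ f (slab t₀ t₁)) z)
      (slab t₀ t₁) z := by
  obtain ⟨L, hL0, hL⟩ := hf.taylor h
  have hbound : ∀ z' ∈ slab t₀ t₁, ‖avgT k c f z' - avgT k c f z -
      avgT k c (_root_.fderivWithin ℝ f (slab t₀ t₁)) z (z' - z)‖
        ≤ ((∫ y, |k y|) * L) * ‖z' - z‖ ^ 2 := by
    intro z' hz'
    have i1 := hf.integrable_avg hk c hz'
    have i2 := hf.integrable_avg hk c hz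
    have i3 := (hf.fderivWithin h).integrable_avg hk c hz
    have e3 : avgT k c (_root_.fderivWithin ℝ f (slab t₀ t₁)) z (z' - z)
        = ∫ y, (k y • _root_.fderivWithin ℝ f (slab t₀ t₁) (z.1, z.2 + c • y)) (z' - z) :=
      ContinuousLinearMap.integral_apply i3 _
    have i4 := i3.apply_continuousLinearMap (z' - z)
    have e5 := integral_sub (i1.sub i2) i4
    simp only [Pi.sub_apply] at e5
    rw [e3, avgT, avgT, ← integral_sub i1 i2, ← e5, ← integral_mul_const, ← integral_mul_const]
    refine norm_integral_le_of_norm_le ((hk.abs.mul_const _).mul_const _)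
      (Filter.Eventually.of_forall fun y => ?_)
    have := hL (z.1, z.2 + c • y) (mem_slab.2 (mem_slab.1 hz)) (z'.1, z'.2 + c • y)
      (mem_slab.2 (mem_slab.1 hz'))
    have e4 : (z'.1, z'.2 + c • y) - (z.1, z.2 + c • y) = z' - z := by
      ext <;> simp
    rw [e4] at this
    rw [smul_apply, ← smul_sub, ← smul_sub, norm_smul, mul_assoc,
      Real.norm_eq_abs]
    exact mul_le_mul_of_nonneg_left this (abs_nonneg _)
  refine HasFDerivWithinAt.of_isLittleO ?_
  have hO : (fun z' => avgT k c f z' - avgT k c f z -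
      avgT k c (_root_.fderivWithin ℝ f (slab t₀ t₁)) z (z' - z))
        =O[nhdsWithin z (slab t₀ t₁)] fun z' => ‖z' - z‖ ^ 2 := by
    refine Asymptotics.IsBigO.of_bound ((∫ y, |k y|) * L) ?_
    filter_upwards [self_mem_nhdsWithin] with z' hz'
    simpa using hbound z' hz'
  refine hO.trans_isLittleO ?_
  have h2 : (fun z' : ℝ × E3 => ‖z' - z‖ ^ 2) =o[nhds z] fun z' => z' - z :=
    (Asymptotics.isLittleO_norm_pow_id one_lt_two).comp_tendsto
      (tendsto_sub_nhds_zero_iff.2 Filter.tendsto_id)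
  exact h2.mono nhdsWithin_le_nhds

theorem SmoothPer.fderivWithin_avgT {t₀ t₁ : ℝ} (h : t₀ < t₁) {f : ℝ × E3 → F}
    (hf : SmoothPer t₀ t₁ f) {k : E3 → ℝ} (hk : Integrable k) (c : ℝ) {z : ℝ × E3}
    (hz : z ∈ slab t₀ t₁) :
    _root_.fderivWithin ℝ (avgT k c f) (slab t₀ t₁) z =
      avgT k c (_root_.fderivWithin ℝ f (slab t₀ t₁)) z :=
  (hf.hasFDerivWithinAt_avgT h hk c hz).fderivWithin (uniqueDiffOn_slab h z hz)

theorem contDiffOn_avgT_nat {t₀ t₁ : ℝ} (h : t₀ < t₁) {k : E3 → ℝ} (hk : Integrable k) (c : ℝ)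
    (n : ℕ) : ∀ {F : Type} [NormedAddCommGroup F] [NormedSpace ℝ F]
      {f : ℝ × E3 → F}, SmoothPer t₀ t₁ f → ContDiffOn ℝ n (avgT k c f) (slab t₀ t₁) := by
  induction n with
  | zero =>
    intro F _ _ f hf
    rw [Nat.cast_zero, contDiffOn_zero]
    exact fun z hz => (hf.hasFDerivWithinAt_avgT h hk c hz).continuousWithinAt
  | succ n ih =>
    intro F _ _ f hf
    rw [Nat.cast_succ, contDiffOn_succ_iff_fderivWithin (uniqueDiffOn_slab h)]
    refine ⟨fun z hz => (hf.hasFDerivWithinAt_avgT h hk c hz).differentiableWithinAt,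
      fun hn => absurd hn (by simp), ?_⟩
    exact (ih (hf.fderivWithin h)).congr fun z hz => hf.fderivWithin_avgT h hk c hz

theorem SmoothPer.avgT {t₀ t₁ : ℝ} (h : t₀ < t₁) {f : ℝ × E3 → F}
    (hf : SmoothPer t₀ t₁ f) {k : E3 → ℝ} (hk : Integrable k) (c : ℝ) :
    SmoothPer t₀ t₁ (avgT k c f) := by
  refine ⟨contDiffOn_infty.2 fun n => contDiffOn_avgT_nat h hk c n hf, fun t ht x i => ?_⟩
  simp only [FracNS.avgT]
  congr 1 with y
  have := hf.per t ht (x + c • y) i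
  simp only at this
  rw [← this]
  congr 3
  abel

end SpaceTime

end

/-! ### Partial derivatives of smooth periodic scalar functions -/

/-- The partial derivative `∂ᵢ f`. -/
def D (i : Fin 3) (f : E3 → ℝ) (x : E3) : ℝ := fderiv ℝ f x (e i)

/-- The iterated partial derivative `∂_{θ₀} ∂_{θ₁} ⋯ f` along a word `θ`. -/
def Dw : List (Fin 3) → (E3 → ℝ) → E3 → ℝ
  | [], f => f
  | i :: θ, f => D i (Dw θ f)

/-- Smooth periodic scalar functions, that is, smooth functions on the torus. -/
structure SP (f : E3 → ℝ) : Prop where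
  smooth : ContDiff ℝ ∞ f
  per : IsPeriodic f

/-- Scalar functions on space-time, smooth on `[t₀,t₁] × ℝ³` and periodic in space. -/
abbrev STP (t₀ t₁ : ℝ) (f : ℝ → E3 → ℝ) : Prop := SmoothPer t₀ t₁ fun z : ℝ × E3 => f z.1 z.2

/-- The time derivative on `[t₀,t₁]`, one-sided at the end points. -/
def dt (t₀ t₁ : ℝ) (f : ℝ → E3 → ℝ) (t : ℝ) (x : E3) : ℝ :=
  derivWithin (fun s => f s x) (Icc t₀ t₁) t

/-- The average `∫ k(y) f(x + c y) dy` of the translates of `f`. -/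
def avg {F : Type*} [NormedAddCommGroup F] [NormedSpace ℝ F] (k : E3 → ℝ) (c : ℝ) (f : E3 → F)
    (x : E3) : F :=
  ∫ y, k y • f (x + c • y)

namespace SP

variable {f g : E3 → ℝ}

theorem differentiable (hf : SP f) : Differentiable ℝ f := hf.smooth.differentiable (by simp)

theorem continuous (hf : SP f) : Continuous f := hf.smooth.continuous

theorem const (c : ℝ) : SP fun _ => c := ⟨contDiff_const, fun _ _ => rfl⟩

theorem add (hf : SP f) (hg : SP g) : SP fun x => f x + g x :=
  ⟨hf.smooth.add hg.smooth, fun x i => by simp only [hf.per x i, hg.per x i]⟩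

theorem sub (hf : SP f) (hg : SP g) : SP fun x => f x - g x :=
  ⟨hf.smooth.sub hg.smooth, fun x i => by simp only [hf.per x i, hg.per x i]⟩

theorem neg (hf : SP f) : SP fun x => -f x :=
  ⟨hf.smooth.neg, fun x i => by simp only [hf.per x i]⟩

theorem mul (hf : SP f) (hg : SP g) : SP fun x => f x * g x :=
  ⟨hf.smooth.mul hg.smooth, fun x i => by simp only [hf.per x i, hg.per x i]⟩

theorem const_mul (c : ℝ) (hf : SP f) : SP fun x => c * f x := (const c).mul hf

theorem sum {ι : Type*} (s : Finset ι) {f : ι → E3 → ℝ} (hf : ∀ i ∈ s, SP (f i)) :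
    SP fun x => ∑ i ∈ s, f i x :=
  ⟨ContDiff.sum fun i hi => (hf i hi).smooth,
    fun x j => Finset.sum_congr rfl fun i hi => (hf i hi).per x j⟩

theorem translate (hf : SP f) (a : E3) : SP fun x => f (x + a) :=
  ⟨hf.smooth.comp (contDiff_id.add contDiff_const), fun x i => by
    have := hf.per (x + a) i
    rw [← this]; congr 1; abel⟩

/-- A smooth periodic function, viewed as a time-independent function. -/
theorem stp (hf : SP f) (t₀ t₁ : ℝ) : STP t₀ t₁ fun _ => f :=
  ⟨(hf.smooth.comp contDiff_snd).contDiffOn, fun _ _ => hf.per⟩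

theorem bounded (hf : SP f) : ∃ K, 0 ≤ K ∧ ∀ x, |f x| ≤ K := by
  obtain ⟨K, h0, hK⟩ := (hf.stp 0 1).bounded
  exact ⟨K, h0, fun x => hK (0, x) (mem_slab.2 (by simp))⟩

end SP

theorem SP.D {f : E3 → ℝ} (hf : SP f) (i : Fin 3) : SP (D i f) := by
  refine ⟨(hf.smooth.fderiv_right (m := ∞) (by simp)).clm_apply contDiff_const, fun x j => ?_⟩
  have : fderiv ℝ (fun y => f (y + e j)) x = fderiv ℝ f (x + e j) := fderiv_comp_add_right _
  simp only [FracNS.D]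
  rw [← this]
  congr 2
  ext y
  exact hf.per y j

theorem SP.Dw {f : E3 → ℝ} (hf : SP f) (θ : List (Fin 3)) : SP (Dw θ f) := by
  induction θ with
  | nil => exact hf
  | cons i θ ih => exact ih.D i

section Algebra

variable {f g : E3 → ℝ}

theorem D_add (hf : SP f) (hg : SP g) (i : Fin 3) :
    D i (fun x => f x + g x) = fun x => D i f x + D i g x := by
  ext x
  simp only [D]
  rw [fderiv_fun_add (hf.differentiable x) (hg.differentiable x)]
  rfl

theorem D_neg (f : E3 → ℝ) (i : Fin 3) : D i (fun x => -f x) = fun x => -D i f x := by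
  ext x
  simp [D, fderiv_fun_neg]

theorem D_sub (hf : SP f) (hg : SP g) (i : Fin 3) :
    D i (fun x => f x - g x) = fun x => D i f x - D i g x := by
  ext x
  simp only [D]
  rw [fderiv_fun_sub (hf.differentiable x) (hg.differentiable x)]
  rfl

theorem D_mul (hf : SP f) (hg : SP g) (i : Fin 3) :
    D i (fun x => f x * g x) = fun x => D i f x * g x + f x * D i g x := by
  ext x
  simp only [D]
  rw [fderiv_fun_mul (hf.differentiable x) (hg.differentiable x)]
  simp
  ring

theorem D_const (c : ℝ) (i : Fin 3) : D i (fun _ => c) = fun _ => 0 := by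
  ext x
  simp [D]

theorem D_const_mul (c : ℝ) (hf : SP f) (i : Fin 3) :
    D i (fun x => c * f x) = fun x => c * D i f x := by
  rw [D_mul (SP.const c) hf, D_const]
  simp

theorem D_sum {ι : Type*} (s : Finset ι) {f : ι → E3 → ℝ} (hf : ∀ i ∈ s, SP (f i)) (j : Fin 3) :
    D j (fun x => ∑ i ∈ s, f i x) = fun x => ∑ i ∈ s, D j (f i) x := by
  ext x
  simp only [D]
  rw [fderiv_fun_sum fun i hi => (hf i hi).differentiable x]
  simp

theorem D_comm (hf : SP f) (i j : Fin 3) : D i (D j f) = D j (D i f) := by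
  ext x
  have hd : DifferentiableAt ℝ (fderiv ℝ f) x :=
    (hf.smooth.fderiv_right (m := ∞) (by simp)).differentiable (by simp) x
  have h1 : ∀ i j : Fin 3, D i (D j f) x = fderiv ℝ (fderiv ℝ f) x (e i) (e j) := fun i j => by
    unfold D
    rw [fderiv_clm_apply hd (differentiableAt_const _)]
    simp
  rw [h1, h1]
  exact (hf.smooth.contDiffAt.isSymmSndFDerivAt (by simp; norm_cast)) _ _

theorem Dw_D (hf : SP f) (θ : List (Fin 3)) (i : Fin 3) : Dw θ (D i f) = D i (Dw θ f) := by
  induction θ with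
  | nil => rfl
  | cons j θ ih => rw [Dw, ih, D_comm (hf.Dw θ), Dw]

theorem Dw_add (hf : SP f) (hg : SP g) (θ : List (Fin 3)) :
    Dw θ (fun x => f x + g x) = fun x => Dw θ f x + Dw θ g x := by
  induction θ with
  | nil => rfl
  | cons j θ ih => rw [Dw, ih, D_add (hf.Dw θ) (hg.Dw θ)]; rfl

theorem Dw_sub (hf : SP f) (hg : SP g) (θ : List (Fin 3)) :
    Dw θ (fun x => f x - g x) = fun x => Dw θ f x - Dw θ g x := by
  induction θ with
  | nil => rfl
  | cons j θ ih => rw [Dw, ih, D_sub (hf.Dw θ) (hg.Dw θ)]; rfl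

theorem Dw_const_mul (c : ℝ) (hf : SP f) (θ : List (Fin 3)) :
    Dw θ (fun x => c * f x) = fun x => c * Dw θ f x := by
  induction θ with
  | nil => rfl
  | cons j θ ih => rw [Dw, ih, D_const_mul c (hf.Dw θ)]; rfl

theorem Dw_sum {ι : Type*} (s : Finset ι) {f : ι → E3 → ℝ} (hf : ∀ i ∈ s, SP (f i))
    (θ : List (Fin 3)) :
    Dw θ (fun x => ∑ i ∈ s, f i x) = fun x => ∑ i ∈ s, Dw θ (f i) x := by
  induction θ with
  | nil => rfl
  | cons j θ ih => rw [Dw, ih, D_sum s fun i hi => (hf i hi).Dw θ]; rfl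

theorem Dw_zero (θ : List (Fin 3)) : Dw θ (fun _ => 0) = fun _ => 0 := by
  induction θ with
  | nil => rfl
  | cons j θ ih => rw [Dw, ih, D_const]

end Algebra

/-! ### Space-time calculus -/

namespace STP

variable {t₀ t₁ : ℝ} {f g : ℝ → E3 → ℝ}

theorem slice (hf : STP t₀ t₁ f) {t : ℝ} (ht : t ∈ Icc t₀ t₁) : SP (f t) := by
  refine ⟨?_, hf.per t ht⟩
  rw [← contDiffOn_univ]
  exact hf.smooth.comp (t := slab t₀ t₁) (f := fun x : E3 => (t, x))
    (contDiff_const.prodMk contDiff_id).contDiffOn fun x _ => mem_slab.2 ht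

theorem hasFDerivWithinAt (hf : STP t₀ t₁ f) {t : ℝ} (ht : t ∈ Icc t₀ t₁) (x : E3) :
    HasFDerivWithinAt (fun z : ℝ × E3 => f z.1 z.2)
      (fderivWithin ℝ (fun z : ℝ × E3 => f z.1 z.2) (slab t₀ t₁) (t, x)) (slab t₀ t₁) (t, x) :=
  (hf.smooth.differentiableOn (by simp) (t, x) (mem_slab.2 ht)).hasFDerivWithinAt

theorem fderiv_apply (hf : STP t₀ t₁ f) {t : ℝ} (ht : t ∈ Icc t₀ t₁) (x v : E3) :
    fderiv ℝ (f t) x v =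
      fderivWithin ℝ (fun z : ℝ × E3 => f z.1 z.2) (slab t₀ t₁) (t, x) (0, v) := by
  have h := HasFDerivWithinAt.comp (t := slab t₀ t₁) (s := univ) x (f := fun x : E3 => (t, x))
    (hf.hasFDerivWithinAt ht x)
    (((hasFDerivAt_const t x).prodMk (hasFDerivAt_id x)).hasFDerivWithinAt)
    (fun x _ => mem_slab.2 ht)
  rw [hasFDerivWithinAt_univ] at h
  rw [HasFDerivAt.fderiv (f := f t) h]
  simp

theorem hasDerivWithinAt (hf : STP t₀ t₁ f) {t : ℝ} (ht : t ∈ Icc t₀ t₁) (x : E3) :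
    HasDerivWithinAt (fun s => f s x)
      (fderivWithin ℝ (fun z : ℝ × E3 => f z.1 z.2) (slab t₀ t₁) (t, x) (1, 0)) (Icc t₀ t₁) t := by
  have h := (hf.hasFDerivWithinAt ht x).comp_hasDerivWithinAt (t := slab t₀ t₁)
    (f := fun s : ℝ => (s, x)) (s := Icc t₀ t₁) (f' := ((1 : ℝ), (0 : E3))) t
    (((hasDerivAt_id t).prodMk (hasDerivAt_const t x)).hasDerivWithinAt)
    (fun s hs => mem_slab.2 hs)
  exact h

theorem dt_eq (h : t₀ < t₁) (hf : STP t₀ t₁ f) {t : ℝ} (ht : t ∈ Icc t₀ t₁) (x : E3) :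
    dt t₀ t₁ f t x =
      fderivWithin ℝ (fun z : ℝ × E3 => f z.1 z.2) (slab t₀ t₁) (t, x) (1, 0) :=
  (hf.hasDerivWithinAt ht x).derivWithin (uniqueDiffOn_Icc h t ht)

theorem hasDerivWithinAt_dt (h : t₀ < t₁) (hf : STP t₀ t₁ f) {t : ℝ} (ht : t ∈ Icc t₀ t₁) (x : E3) :
    HasDerivWithinAt (fun s => f s x) (dt t₀ t₁ f t x) (Icc t₀ t₁) t := by
  rw [hf.dt_eq h ht x]
  exact hf.hasDerivWithinAt ht x

theorem congr (hf : STP t₀ t₁ f) (hfg : ∀ t ∈ Icc t₀ t₁, ∀ x, g t x = f t x) : STP t₀ t₁ g := by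
  refine ⟨hf.smooth.congr fun z hz => hfg z.1 (mem_slab.1 hz) _, fun t ht x i => ?_⟩
  simp only [hfg t ht]
  exact hf.per t ht x i

/-- Directional derivatives on the slab preserve smoothness and periodicity. -/
theorem dir (h : t₀ < t₁) (hf : STP t₀ t₁ f) (v : ℝ × E3) :
    STP t₀ t₁ fun t x => fderivWithin ℝ (fun z : ℝ × E3 => f z.1 z.2) (slab t₀ t₁) (t, x) v := by
  have h1 := SmoothPer.fderivWithin h hf
  refine ⟨h1.smooth.clm_apply contDiffOn_const, fun t ht x i => ?_⟩
  have h2 := h1.per t ht x i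
  simp only at h2 ⊢
  rw [h2]

theorem D (h : t₀ < t₁) (hf : STP t₀ t₁ f) (i : Fin 3) : STP t₀ t₁ fun t => D i (f t) :=
  (hf.dir h (0, e i)).congr fun _ ht x => hf.fderiv_apply ht x (e i)

theorem dt (h : t₀ < t₁) (hf : STP t₀ t₁ f) : STP t₀ t₁ (dt t₀ t₁ f) :=
  (hf.dir h (1, 0)).congr fun _ ht x => hf.dt_eq h ht x

theorem Dw (h : t₀ < t₁) (hf : STP t₀ t₁ f) (θ : List (Fin 3)) :
    STP t₀ t₁ fun t => Dw θ (f t) := by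
  induction θ with
  | nil => exact hf
  | cons i θ ih => exact ih.D h i

/-- Symmetry of second derivatives holds up to the end points of the time interval, because the
slab is the closure of its interior. -/
theorem D_dt (h : t₀ < t₁) (hf : STP t₀ t₁ f) (i : Fin 3) {t : ℝ} (ht : t ∈ Icc t₀ t₁) (x : E3) :
    FracNS.D i (FracNS.dt t₀ t₁ f t) x = FracNS.dt t₀ t₁ (fun s => FracNS.D i (f s)) t x := by
  have hdf := (SmoothPer.fderivWithin h hf).smooth.differentiableOn (by simp) (t, x) (mem_slab.2 ht)
  have hud := uniqueDiffOn_slab h (t, x) (mem_slab.2 ht)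
  have key : ∀ v v' : ℝ × E3,
      fderivWithin ℝ (fun z : ℝ × E3 => fderivWithin ℝ (fun z : ℝ × E3 => f z.1 z.2)
        (slab t₀ t₁) (z.1, z.2) v) (slab t₀ t₁) (t, x) v' =
      fderivWithin ℝ (fderivWithin ℝ (fun z : ℝ × E3 => f z.1 z.2) (slab t₀ t₁)) (slab t₀ t₁)
        (t, x) v' v := fun v v' => by
    have := (hdf.hasFDerivWithinAt.clm_apply (hasFDerivWithinAt_const v (t, x) _)).fderivWithin hud
    simp only [Prod.mk.eta]
    rw [this]
    simp
  have e1 : FracNS.D i (FracNS.dt t₀ t₁ f t) x = fderivWithin ℝ (fun z : ℝ × E3 =>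
      fderivWithin ℝ (fun z : ℝ × E3 => f z.1 z.2) (slab t₀ t₁) (z.1, z.2) (1, 0))
        (slab t₀ t₁) (t, x) (0, e i) := by
    rw [FracNS.D, (hf.dt h).fderiv_apply ht]
    rw [fderivWithin_congr (fun z hz => hf.dt_eq h (mem_slab.1 hz) z.2)
      (hf.dt_eq h ht x)]
  have e2 : FracNS.dt t₀ t₁ (fun s => FracNS.D i (f s)) t x = fderivWithin ℝ (fun z : ℝ × E3 =>
      fderivWithin ℝ (fun z : ℝ × E3 => f z.1 z.2) (slab t₀ t₁) (z.1, z.2) (0, e i))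
        (slab t₀ t₁) (t, x) (1, 0) := by
    rw [(hf.D h i).dt_eq h ht]
    rw [fderivWithin_congr (𝕜 := ℝ) (s := slab t₀ t₁) (x := (t, x))
      (f₁ := fun z : ℝ × E3 => FracNS.D i (f z.1) z.2)
      (fun z hz => hf.fderiv_apply (mem_slab.1 hz) z.2 (e i)) (hf.fderiv_apply ht x (e i))]
  rw [e1, e2, key, key]
  refine (hf.smooth (t, x) (mem_slab.2 ht)).isSymmSndFDerivWithinAt (n := ∞)
    (by simp; norm_cast) (uniqueDiffOn_slab h) ?_ (mem_slab.2 ht) _ _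
  rw [slab, interior_prod_eq, interior_Icc, interior_univ, closure_prod_eq, closure_Ioo h.ne]
  exact ⟨ht, by simp⟩

theorem Dw_dt (h : t₀ < t₁) (hf : STP t₀ t₁ f) (θ : List (Fin 3)) {t : ℝ} (ht : t ∈ Icc t₀ t₁) :
    FracNS.Dw θ (FracNS.dt t₀ t₁ f t) = FracNS.dt t₀ t₁ (fun s => FracNS.Dw θ (f s)) t := by
  induction θ with
  | nil => rfl
  | cons i θ ih =>
    ext x
    rw [FracNS.Dw, ih, (hf.Dw h θ).D_dt h i ht]
    rfl

theorem add (hf : STP t₀ t₁ f) (hg : STP t₀ t₁ g) : STP t₀ t₁ fun t x => f t x + g t x :=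
  ⟨hf.smooth.add hg.smooth, fun _ ht => ((hf.slice ht).add (hg.slice ht)).per⟩

theorem sub (hf : STP t₀ t₁ f) (hg : STP t₀ t₁ g) : STP t₀ t₁ fun t x => f t x - g t x :=
  ⟨hf.smooth.sub hg.smooth, fun _ ht => ((hf.slice ht).sub (hg.slice ht)).per⟩

theorem mul (hf : STP t₀ t₁ f) (hg : STP t₀ t₁ g) : STP t₀ t₁ fun t x => f t x * g t x :=
  ⟨hf.smooth.mul hg.smooth, fun _ ht => ((hf.slice ht).mul (hg.slice ht)).per⟩

theorem const_mul (c : ℝ) (hf : STP t₀ t₁ f) : STP t₀ t₁ fun t x => c * f t x :=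
  ⟨contDiffOn_const.mul hf.smooth, fun _ ht => ((hf.slice ht).const_mul c).per⟩

theorem sum {ι : Type*} (s : Finset ι) {f : ι → ℝ → E3 → ℝ} (hf : ∀ i ∈ s, STP t₀ t₁ (f i)) :
    STP t₀ t₁ fun t x => ∑ i ∈ s, f i t x :=
  ⟨ContDiffOn.sum fun i hi => (hf i hi).smooth,
    fun _ ht => (SP.sum s fun i hi => (hf i hi).slice ht).per⟩

theorem mono (hf : STP t₀ t₁ f) {s₀ s₁ : ℝ} (hs : Icc s₀ s₁ ⊆ Icc t₀ t₁) : STP s₀ s₁ f :=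
  ⟨hf.smooth.mono (prod_mono hs le_rfl), fun t ht => hf.per t (hs ht)⟩

theorem dt_mono (hf : STP t₀ t₁ f) {s₀ s₁ : ℝ} (h : s₀ < s₁) (hs : Icc s₀ s₁ ⊆ Icc t₀ t₁)
    {t : ℝ} (ht : t ∈ Icc s₀ s₁) (x : E3) :
    FracNS.dt s₀ s₁ f t x = FracNS.dt t₀ t₁ f t x := by
  have h' : t₀ < t₁ := (hs ⟨le_rfl, h.le⟩).1.trans_lt (h.trans_le (hs ⟨h.le, le_rfl⟩).2)
  exact ((hf.hasDerivWithinAt_dt h' (hs ht) x).mono hs).derivWithin (uniqueDiffOn_Icc h t ht)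

theorem dt_sub (h : t₀ < t₁) (hf : STP t₀ t₁ f) (hg : STP t₀ t₁ g) {t : ℝ} (ht : t ∈ Icc t₀ t₁)
    (x : E3) : FracNS.dt t₀ t₁ (fun t x => f t x - g t x) t x
      = FracNS.dt t₀ t₁ f t x - FracNS.dt t₀ t₁ g t x :=
  ((hf.hasDerivWithinAt_dt h ht x).sub (hg.hasDerivWithinAt_dt h ht x)).derivWithin
    (uniqueDiffOn_Icc h t ht)

theorem dt_sum (h : t₀ < t₁) {ι : Type*} (s : Finset ι) {f : ι → ℝ → E3 → ℝ}
    (hf : ∀ i ∈ s, STP t₀ t₁ (f i)) {t : ℝ} (ht : t ∈ Icc t₀ t₁) (x : E3) :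
    FracNS.dt t₀ t₁ (fun t x => ∑ i ∈ s, f i t x) t x = ∑ i ∈ s, FracNS.dt t₀ t₁ (f i) t x :=
  (HasDerivWithinAt.fun_sum fun i hi => (hf i hi).hasDerivWithinAt_dt h ht x).derivWithin
    (uniqueDiffOn_Icc h t ht)

end STP

/-! ### Averages over translates -/

section Avg

variable {t₀ t₁ : ℝ} {k : E3 → ℝ}

theorem STP.avg (h : t₀ < t₁) {f : ℝ → E3 → ℝ} (hf : STP t₀ t₁ f) (hk : Integrable k) (c : ℝ) :
    STP t₀ t₁ fun t => avg k c (f t) := SmoothPer.avgT h hf hk c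

theorem STP.dt_avg (h : t₀ < t₁) {f : ℝ → E3 → ℝ} (hf : STP t₀ t₁ f) (hk : Integrable k) (c : ℝ)
    {t : ℝ} (ht : t ∈ Icc t₀ t₁) (x : E3) :
    FracNS.dt t₀ t₁ (fun t => FracNS.avg k c (f t)) t x = FracNS.avg k c (FracNS.dt t₀ t₁ f t) x := by
  rw [(hf.avg h hk c).dt_eq h ht]
  have := SmoothPer.fderivWithin_avgT h hf hk c (mem_slab.2 ht : (t, x) ∈ _)
  unfold FracNS.avgT at this
  unfold FracNS.avg
  simp only at this
  rw [this, ContinuousLinearMap.integral_apply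
    ((SmoothPer.fderivWithin h hf).integrable_avg hk c (mem_slab.2 ht : (t, x) ∈ _))]
  refine integral_congr_ae (Filter.Eventually.of_forall fun y => ?_)
  simp only [smul_apply]
  rw [hf.dt_eq h ht]

variable {f : E3 → ℝ}

theorem SP.integrable_avg (hf : SP f) (hk : Integrable k) (c : ℝ) (x : E3) :
    Integrable fun y => k y * f (x + c • y) :=
  (hf.stp 0 1).integrable_avg hk c (z := (0, x)) (mem_slab.2 (by simp))

theorem SP.avg (hf : SP f) (hk : Integrable k) (c : ℝ) : SP (avg k c f) :=
  ((hf.stp 0 1).avg one_pos hk c).slice (t := 0) (by simp)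

theorem D_avg (hf : SP f) (hk : Integrable k) (c : ℝ) (i : Fin 3) :
    D i (avg k c f) = avg k c (D i f) := by
  ext x
  have h0 : (0 : ℝ) ∈ Icc (0 : ℝ) 1 := by simp
  have hs := hf.stp 0 1
  rw [D, (hs.avg one_pos hk c).fderiv_apply h0]
  have := SmoothPer.fderivWithin_avgT one_pos hs hk c (mem_slab.2 h0 : ((0 : ℝ), x) ∈ _)
  unfold FracNS.avgT at this
  unfold FracNS.avg
  simp only at this
  rw [this, ContinuousLinearMap.integral_apply
    ((SmoothPer.fderivWithin one_pos hs).integrable_avg hk c (mem_slab.2 h0 : ((0 : ℝ), x) ∈ _))]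
  refine integral_congr_ae (Filter.Eventually.of_forall fun y => ?_)
  simp only [smul_apply]
  rw [D, hs.fderiv_apply h0]

/-- Integration by parts moves a derivative from the function to the kernel. -/
theorem avg_D (hf : SP f) (hk : Integrable k) (hkd : Differentiable ℝ k) {i : Fin 3}
    (hDk : Integrable (D i k)) {c : ℝ} (hc : c ≠ 0) (x : E3) :
    avg k c (D i f) x = -c⁻¹ * avg (D i k) c f x := by
  have hg : ∀ y, fderiv ℝ (fun y : E3 => f (x + c • y)) y (e i) = c * D i f (x + c • y) := by
    intro y
    have h1 : HasFDerivAt (fun y : E3 => x + c • y) (c • ContinuousLinearMap.id ℝ E3) y :=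
      ((hasFDerivAt_id y).const_smul c).const_add x
    rw [HasFDerivAt.fderiv (f := fun y : E3 => f (x + c • y))
      ((hf.differentiable _).hasFDerivAt.comp y h1)]
    simp [D]
  have hgd : Differentiable ℝ fun y : E3 => f (x + c • y) := fun y =>
    (hf.differentiable _).comp y (by fun_prop)
  have := integral_mul_fderiv_eq_neg_fderiv_mul_of_integrable (μ := volume) (f := k)
    (g := fun y : E3 => f (x + c • y)) (v := e i) (hf.integrable_avg hDk c x)
    (by
      simp only [hg]
      refine (((hf.D i).integrable_avg hk c x).const_mul c).congr
        (Filter.Eventually.of_forall fun y => ?_)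
      simp only; ring)
    (hf.integrable_avg hk c x) (fun y _ => hkd y) (fun y _ => hgd y)
  simp only [hg] at this
  have e1 : c * avg k c (D i f) x = -avg (D i k) c f x := by
    simp only [avg, smul_eq_mul]
    rw [← integral_const_mul]
    rw [show (∫ y, fderiv ℝ k y (e i) * f (x + c • y)) = ∫ y, D i k y * f (x + c • y) from rfl]
      at this
    rw [← this]
    congr 1 with y
    ring
  field_simp
  linarith

theorem abs_avg_le (hk : Integrable k) {c : ℝ} {x : E3} {A : ℝ}
    (hA : ∀ y, k y ≠ 0 → |f (x + c • y)| ≤ A) :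
    |avg k c f x| ≤ (∫ y, |k y|) * A := by
  rw [← integral_mul_const, ← Real.norm_eq_abs, avg]
  refine norm_integral_le_of_norm_le (hk.abs.mul_const A) (Filter.Eventually.of_forall fun y => ?_)
  rw [norm_smul, Real.norm_eq_abs, Real.norm_eq_abs]
  by_cases h : k y = 0
  · simp [h]
  · exact mul_le_mul_of_nonneg_left (hA y h) (abs_nonneg _)

theorem avg_add {g : E3 → ℝ} (hf : SP f) (hg : SP g) (hk : Integrable k) (c : ℝ) :
    avg k c (fun x => f x + g x) = fun x => avg k c f x + avg k c g x := by
  ext x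
  simp only [avg, smul_eq_mul, mul_add]
  exact integral_add (hf.integrable_avg hk c x) (hg.integrable_avg hk c x)

theorem avg_sub {g : E3 → ℝ} (hf : SP f) (hg : SP g) (hk : Integrable k) (c : ℝ) :
    avg k c (fun x => f x - g x) = fun x => avg k c f x - avg k c g x := by
  ext x
  simp only [avg, smul_eq_mul, mul_sub]
  exact integral_sub (hf.integrable_avg hk c x) (hg.integrable_avg hk c x)

theorem avg_const_mul (a : ℝ) (f : E3 → ℝ) (k : E3 → ℝ) (c : ℝ) :
    avg k c (fun x => a * f x) = fun x => a * avg k c f x := by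
  ext x
  simp only [avg, smul_eq_mul, ← integral_const_mul]
  congr 1 with y
  ring

theorem avg_sum {ι : Type*} (s : Finset ι) {f : ι → E3 → ℝ} (hf : ∀ i ∈ s, SP (f i))
    (hk : Integrable k) (c : ℝ) :
    avg k c (fun x => ∑ i ∈ s, f i x) = fun x => ∑ i ∈ s, avg k c (f i) x := by
  ext x
  simp only [avg, smul_eq_mul, Finset.mul_sum]
  exact integral_finsetSum s fun i hi => (hf i hi).integrable_avg hk c x

/-- Averages with respect to two kernels commute. -/
theorem avg_avg_comm {k' : E3 → ℝ} (hf : SP f) (hk : Integrable k) (hk' : Integrable k')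
    (c c' : ℝ) (x : E3) : avg k c (avg k' c' f) x = avg k' c' (avg k c f) x := by
  simp only [avg, smul_eq_mul, ← integral_const_mul]
  obtain ⟨K, -, hK⟩ := hf.bounded
  rw [integral_integral_swap]
  · congr 1 with y
    congr 1 with z
    rw [show x + c • z + c' • y = x + c' • y + c • z by abel]
    ring
  · have h1 := (hk.mul_prod hk').mul_bdd (c := K) (g := fun p : E3 × E3 => f (x + c • p.1 + c' • p.2))
      (hf.continuous.comp (f := fun p : E3 × E3 => x + c • p.1 + c' • p.2)
        (by fun_prop)).aestronglyMeasurable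
      (Filter.Eventually.of_forall fun p => hK _)
    refine h1.congr (Filter.Eventually.of_forall fun p => ?_)
    simp only [Function.uncurry]
    ring

end Avg

/-! ### Fourier series of smooth periodic functions -/

/-- The eigenvalue `|2πk|²` of `-Δ` on the character `k`. -/
def mu (k : Fin 3 → ℤ) : ℝ := (2 * Real.pi) ^ 2 * ∑ i, (k i : ℝ) ^ 2

theorem mu_nonneg (k : Fin 3 → ℤ) : 0 ≤ mu k :=
  mul_nonneg (sq_nonneg _) (Finset.sum_nonneg fun _ _ => sq_nonneg _)

theorem norm_character (k : Fin 3 → ℤ) (x : E3) : ‖character k x‖ = 1 := by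
  rw [character, show (2 * Real.pi * Complex.I * ((∑ i, (k i : ℝ) * x i : ℝ) : ℂ))
    = ((2 * Real.pi * ∑ i, (k i : ℝ) * x i : ℝ) : ℂ) * Complex.I by push_cast; ring]
  exact Complex.norm_exp_ofReal_mul_I _

theorem character_add (k : Fin 3 → ℤ) (x y : E3) :
    character k (x + y) = character k x * character k y := by
  simp only [character, ← Complex.exp_add]
  congr 1
  push_cast
  simp only [PiLp.add_apply, Complex.ofReal_add, mul_add, Finset.sum_add_distrib]

theorem character_e (k : Fin 3 → ℤ) (i : Fin 3) : character k (e i) = 1 := by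
  have : (∑ j, (k j : ℝ) * (e i) j : ℝ) = k i := by
    rw [Finset.sum_eq_single i] <;> simp +contextual [e]
  rw [character, this]
  rw [show (2 * Real.pi * Complex.I * ((k i : ℝ) : ℂ)) = (k i : ℂ) * (2 * Real.pi * Complex.I) by
    push_cast; ring]
  exact Complex.exp_int_mul_two_pi_mul_I _

theorem character_periodic (k : Fin 3 → ℤ) : IsPeriodic (character k) := fun x i => by
  rw [character_add, character_e, mul_one]

/-- The linear form `x ↦ 2π k·x`. -/
def phase (k : Fin 3 → ℤ) : E3 →L[ℝ] ℝ :=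
  ∑ i, (2 * Real.pi * k i) • (EuclideanSpace.proj i : E3 →L[ℝ] ℝ)

theorem character_eq_phase (k : Fin 3 → ℤ) (x : E3) :
    character k x = Complex.exp ((phase k x : ℂ) * Complex.I) := by
  simp only [character, phase]
  congr 1
  simp [Finset.mul_sum, Finset.sum_mul]
  refine Finset.sum_congr rfl fun i _ => by ring

theorem phase_e (k : Fin 3 → ℤ) (i : Fin 3) : phase k (e i) = 2 * Real.pi * k i := by
  simp only [phase, sum_apply, smul_apply]
  rw [Finset.sum_eq_single i] <;> simp +contextual [e]

theorem hasFDerivAt_character (k : Fin 3 → ℤ) (x : E3) :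
    HasFDerivAt (character k)
      (character k x • (Complex.I • Complex.ofRealCLM.comp (phase k))) x := by
  have h1 : HasFDerivAt (fun y : E3 => ((phase k y : ℝ) : ℂ) * Complex.I)
      (Complex.I • Complex.ofRealCLM.comp (phase k)) x := by
    have := (Complex.ofRealCLM.hasFDerivAt.comp x (phase k).hasFDerivAt).mul_const Complex.I
    exact this
  have h2 := h1.cexp
  simp only [← character_eq_phase] at h2
  exact h2

theorem continuous_character (k : Fin 3 → ℤ) : Continuous (character k) :=
  continuous_iff_continuousAt.2 fun x => (hasFDerivAt_character k x).continuousAt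

section Cube

/-- The half-open cube of the definition of the Fourier coefficients may be replaced by the closed
box on which the divergence theorem is available. -/
theorem setIntegral_unitCube (h : E3 → ℂ) :
    ∫ x in unitCube, h x = ∫ x in Icc (0 : Fin 3 → ℝ) 1, h (WithLp.toLp 2 x) := by
  have h1 := (PiLp.volume_preserving_toLp (Fin 3)).setIntegral_preimage_emb
    (MeasurableEquiv.toLp 2 (Fin 3 → ℝ)).measurableEmbedding h unitCube
  rw [← h1]
  refine setIntegral_congr_set ?_
  have h2 : (WithLp.toLp 2 ⁻¹' unitCube : Set (Fin 3 → ℝ))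
      = univ.pi fun i => Ico ((0 : Fin 3 → ℝ) i) ((1 : Fin 3 → ℝ) i) := by
    ext x; simp [unitCube]
  rw [h2]
  exact Measure.univ_pi_Ico_ae_eq_Icc

theorem volume_Icc_cube : (volume : Measure (Fin 3 → ℝ)).real (Icc 0 1) = 1 := by
  rw [Measure.real, Real.volume_Icc_pi]
  simp

theorem norm_setIntegral_unitCube_le {h : E3 → ℂ} {K : ℝ} (hK : ∀ x, ‖h x‖ ≤ K) :
    ‖∫ x in unitCube, h x‖ ≤ K := by
  rw [setIntegral_unitCube]
  have := norm_setIntegral_le_of_norm_le_const (μ := (volume : Measure (Fin 3 → ℝ)))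
    (s := Icc 0 1) (f := fun x => h (WithLp.toLp 2 x)) (C := K) isCompact_Icc.measure_lt_top
    fun x _ => hK _
  rwa [volume_Icc_cube, mul_one] at this

/-- The integral over the torus of a partial derivative of a periodic function vanishes. -/
theorem setIntegral_unitCube_fderiv {h : E3 → ℂ} (hd : ContDiff ℝ 1 h) (hp : IsPeriodic h)
    (i : Fin 3) : ∫ x in unitCube, fderiv ℝ h x (e i) = 0 := by
  rw [setIntegral_unitCube]
  let L : (Fin 3 → ℝ) →L[ℝ] E3 := (PiLp.continuousLinearEquiv 2 ℝ fun _ : Fin 3 => ℝ).symm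
  have hL : ∀ x, L x = WithLp.toLp 2 x := fun x => rfl
  let f : Fin 3 → (Fin 3 → ℝ) → ℂ := fun j x => if j = i then h (L x) else 0
  let f' : Fin 3 → (Fin 3 → ℝ) → (Fin 3 → ℝ) →L[ℝ] ℂ :=
    fun j x => if j = i then (fderiv ℝ h (L x)).comp L else 0
  have hsum : ∀ x, ∑ j, f' j x (Pi.single j 1) = fderiv ℝ h (WithLp.toLp 2 x) (e i) := by
    intro x
    rw [Finset.sum_eq_single i]
    · simp [f', hL, e]
    · intro j _ hj; simp [f', hj]
    · simp
  have hc : Continuous fun x : Fin 3 → ℝ => fderiv ℝ h (WithLp.toLp 2 x) (e i) :=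
    ((hd.continuous_fderiv (by simp)).comp L.continuous).clm_apply continuous_const
  have key := integral_divergence_of_hasFDerivAt_off_countable' (0 : Fin 3 → ℝ) 1 (by simp) f f' ∅
    countable_empty
    (fun j => by
      by_cases hj : j = i
      · simp only [f, hj, if_true]; exact (hd.continuous.comp L.continuous).continuousOn
      · simp only [f, hj, if_false]; exact continuousOn_const)
    (fun x _ j => by
      by_cases hj : j = i
      · simp only [f, f', hj, if_true]
        exact (hd.differentiable (by simp) _).hasFDerivAt.comp x L.hasFDerivAt
      · simp only [f, f', hj, if_false]; exact hasFDerivAt_const _ _)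
    (by simp only [hsum]; exact hc.continuousOn.integrableOn_compact isCompact_Icc)
  simp only [hsum] at key
  rw [key]
  refine Finset.sum_eq_zero fun j _ => ?_
  rw [sub_eq_zero]
  congr 1 with x
  by_cases hj : j = i
  · subst hj
    simp only [f, if_true, hL]
    refine (congrArg h ?_).trans (hp _ j)
    ext l
    simp only [Pi.one_apply, Pi.zero_apply, e, PiLp.add_apply]
    refine Fin.succAboveCases j ?_ (fun m => ?_) l
    · simp
    · simp [Fin.succAbove_ne]
  · simp [f, hj]

end Cube

theorem norm_fourierCoef_le {f : E3 → ℝ} {K : ℝ} (hK : ∀ x, |f x| ≤ K) (k : Fin 3 → ℤ) :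
    ‖fourierCoef f k‖ ≤ K :=
  norm_setIntegral_unitCube_le fun x => by
    rw [norm_mul, norm_character, mul_one, Complex.norm_real]; exact hK x

theorem integrableOn_unitCube {h : E3 → ℂ} (hc : Continuous h) : IntegrableOn h unitCube := by
  refine (hc.continuousOn.integrableOn_compact (isCompact_closedBall (0 : E3) 2)).mono_set ?_
  intro x hx
  rw [mem_closedBall_zero_iff]
  refine le_of_sq_le_sq ?_ (by norm_num)
  rw [EuclideanSpace.norm_sq_eq]
  simp only [Fin.sum_univ_three, Real.norm_eq_abs, sq_abs]
  have h1 : ∀ i, x i ^ 2 ≤ 1 := fun i => by have := hx i; nlinarith [this.1, this.2]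
  linarith [h1 0, h1 1, h1 2]

theorem fourierCoef_D {f : E3 → ℝ} (hf : SP f) (i : Fin 3) (k : Fin 3 → ℤ) :
    fourierCoef (D i f) k = (2 * Real.pi * k i : ℝ) * Complex.I * fourierCoef f k := by
  have hsm : ContDiff ℝ 1 (character (-k)) := by
    have : (character (-k)) = fun x => Complex.exp ((phase (-k) x : ℂ) * Complex.I) := by
      ext x; exact character_eq_phase _ _
    rw [this]
    exact ((Complex.ofRealCLM.contDiff.comp (phase (-k)).contDiff).mul contDiff_const).cexp
  have hfc : ContDiff ℝ 1 fun x => (f x : ℂ) :=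
    Complex.ofRealCLM.contDiff.comp (hf.smooth.of_le (by norm_cast))
  have h0 := setIntegral_unitCube_fderiv (h := fun x => (f x : ℂ) * character (-k) x)
    (hfc.mul hsm) (fun x j => by simp only [hf.per x j, character_periodic (-k) x j]) i
  have hder : ∀ x, fderiv ℝ (fun x => (f x : ℂ) * character (-k) x) x (e i)
      = (D i f x : ℂ) * character (-k) x
        - (2 * Real.pi * k i : ℝ) * Complex.I * ((f x : ℂ) * character (-k) x) := by
    intro x
    have h1 : HasFDerivAt (fun x => (f x : ℂ)) (Complex.ofRealCLM.comp (fderiv ℝ f x)) x :=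
      Complex.ofRealCLM.hasFDerivAt.comp x (hf.differentiable x).hasFDerivAt
    rw [HasFDerivAt.fderiv (f := fun x => (f x : ℂ) * character (-k) x)
      (h1.mul (hasFDerivAt_character (-k) x))]
    simp [D, phase_e]
    ring
  simp only [hder] at h0
  rw [integral_sub, integral_const_mul, sub_eq_zero] at h0
  · exact h0
  · exact integrableOn_unitCube
      ((Complex.continuous_ofReal.comp (hf.D i).continuous).mul (continuous_character _))
  · exact (integrableOn_unitCube
      ((Complex.continuous_ofReal.comp hf.continuous).mul (continuous_character _))).const_mul _

theorem fourierCoef_sub {f g : E3 → ℝ} (hf : SP f) (hg : SP g) (k : Fin 3 → ℤ) :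
    fourierCoef (fun x => f x - g x) k = fourierCoef f k - fourierCoef g k := by
  simp only [fourierCoef, Complex.ofReal_sub, sub_mul]
  refine integral_sub ?_ ?_
  · exact integrableOn_unitCube
      ((Complex.continuous_ofReal.comp hf.continuous).mul (continuous_character _))
  · exact integrableOn_unitCube
      ((Complex.continuous_ofReal.comp hg.continuous).mul (continuous_character _))

theorem fourierCoef_sum {ι : Type*} (s : Finset ι) {f : ι → E3 → ℝ} (hf : ∀ i ∈ s, SP (f i))
    (k : Fin 3 → ℤ) :
    fourierCoef (fun x => ∑ i ∈ s, f i x) k = ∑ i ∈ s, fourierCoef (f i) k := by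
  simp only [fourierCoef, Complex.ofReal_sum, Finset.sum_mul]
  refine integral_finsetSum _ fun i hi => ?_
  exact integrableOn_unitCube
      ((Complex.continuous_ofReal.comp (hf i hi).continuous).mul (continuous_character _))

/-- The Laplacian. -/
def lap (f : E3 → ℝ) (x : E3) : ℝ := ∑ i, D i (D i f) x

theorem SP.lap {f : E3 → ℝ} (hf : SP f) : SP (lap f) := SP.sum _ fun i _ => (hf.D i).D i

theorem fourierCoef_lap {f : E3 → ℝ} (hf : SP f) (k : Fin 3 → ℤ) :
    fourierCoef (lap f) k = -(mu k : ℂ) * fourierCoef f k := by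
  rw [show lap f = fun x => ∑ i, D i (D i f) x from rfl,
    fourierCoef_sum _ fun i _ => (hf.D i).D i]
  simp only [fourierCoef_D (hf.D _), fourierCoef_D hf, mu]
  push_cast
  rw [Finset.mul_sum, ← Finset.sum_neg_distrib, Finset.sum_mul]
  refine Finset.sum_congr rfl fun i _ => ?_
  linear_combination ((2 * Real.pi * k i : ℂ) ^ 2 * fourierCoef f k) * Complex.I_sq

/-- Fourier coefficients of smooth functions decay faster than any power. -/
theorem SP.fourierCoef_decay {f : E3 → ℝ} (hf : SP f) (m : ℕ) :
    ∃ K, 0 ≤ K ∧ ∀ k, (1 + mu k) ^ m * ‖fourierCoef f k‖ ≤ K := by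
  induction m generalizing f with
  | zero =>
    obtain ⟨K, h0, hK⟩ := hf.bounded
    exact ⟨K, h0, fun k => by simpa using norm_fourierCoef_le hK k⟩
  | succ m ih =>
    obtain ⟨K, h0, hK⟩ := ih (hf.sub hf.lap)
    refine ⟨K, h0, fun k => ?_⟩
    have h1 := hK k
    rw [fourierCoef_sub hf hf.lap, fourierCoef_lap hf] at h1
    rw [show fourierCoef f k - -(mu k : ℂ) * fourierCoef f k
      = ((1 + mu k : ℝ) : ℂ) * fourierCoef f k by push_cast; ring, norm_mul, Complex.norm_real,
      Real.norm_of_nonneg (by linarith [mu_nonneg k])] at h1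
    rw [pow_succ, mul_assoc]
    exact h1

/-- Comparison with `∑ ‖k‖⁻⁴` over the lattice `ℤ³`. -/
theorem summable_one_add_mu : Summable fun k : Fin 3 → ℤ => ((1 + mu k) ^ 2)⁻¹ := by
  let b := Pi.basisFun ℝ (Fin 3)
  let L : Submodule ℤ (Fin 3 → ℝ) := Submodule.span ℤ (range b)
  let bL : Module.Basis (Fin 3) ℤ L := b.restrictScalars ℤ
  have hs : Summable fun z : L => ‖z‖ ^ (-4 : ℝ) := by
    refine ZLattice.summable_norm_rpow L (-4) ?_
    rw [Module.finrank_eq_card_basis bL]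
    norm_num
  have hs2 := bL.equivFun.symm.toEquiv.summable_iff.2 hs
  refine Summable.of_norm_bounded_eventually hs2 ?_
  have hfin : {k : Fin 3 → ℤ | ¬ k ≠ 0}.Finite := by simp
  filter_upwards [Filter.eventually_cofinite.2 hfin] with k hk
  have hco : ∀ i, ((bL.equivFun.symm k : L) : Fin 3 → ℝ) i = k i := by
    intro i
    rw [Module.Basis.equivFun_symm_apply]
    have hbL : ∀ j, ((bL j : L) : Fin 3 → ℝ) = b j := fun j =>
      Module.Basis.restrictScalars_apply ℤ b j
    simp [hbL, b, Pi.single_apply]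
  have hn : ‖(bL.equivFun.symm k : L)‖ ^ 2 ≤ 1 + mu k := by
    have h1 : ‖(bL.equivFun.symm k : L)‖ ≤ Real.sqrt (∑ i, (k i : ℝ) ^ 2) := by
      rw [Submodule.coe_norm, pi_norm_le_iff_of_nonneg (Real.sqrt_nonneg _)]
      intro i
      rw [hco, Real.norm_eq_abs]
      exact Real.abs_le_sqrt
        (Finset.single_le_sum (f := fun i => (k i : ℝ) ^ 2) (fun _ _ => sq_nonneg _)
          (Finset.mem_univ i))
    have h3 : 0 ≤ ∑ i, (k i : ℝ) ^ 2 := Finset.sum_nonneg fun _ _ => sq_nonneg _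
    have h2 : ‖(bL.equivFun.symm k : L)‖ ^ 2 ≤ ∑ i, (k i : ℝ) ^ 2 := by
      rw [← Real.sq_sqrt h3]
      exact pow_le_pow_left₀ (norm_nonneg _) h1 2
    have h4 : 1 ≤ (2 * Real.pi) ^ 2 := by nlinarith [Real.pi_gt_three]
    rw [mu]
    nlinarith
  have hpos : 0 < ‖(bL.equivFun.symm k : L)‖ :=
    norm_pos_iff.2 ((LinearEquiv.map_ne_zero_iff _).2 hk)
  rw [Real.norm_of_nonneg (by have := mu_nonneg k; positivity)]
  simp only [Function.comp]
  change _ ≤ ‖(bL.equivFun.symm k : L)‖ ^ (-4 : ℝ)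
  rw [Real.rpow_neg hpos.le]
  refine inv_anti₀ (by positivity) ?_
  rw [show (4 : ℝ) = ((4 : ℕ) : ℝ) by norm_num, Real.rpow_natCast,
    show ‖(bL.equivFun.symm k : L)‖ ^ 4 = (‖(bL.equivFun.symm k : L)‖ ^ 2) ^ 2 by ring]
  exact pow_le_pow_left₀ (by positivity) hn 2

theorem SP.summable_fourierCoef {f : E3 → ℝ} (hf : SP f) (m : ℕ) :
    Summable fun k => (1 + mu k) ^ m * ‖fourierCoef f k‖ := by
  obtain ⟨K, h0, hK⟩ := hf.fourierCoef_decay (m + 2)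
  refine Summable.of_nonneg_of_le (fun k => ?_) (fun k => ?_) (summable_one_add_mu.mul_left K)
  · have := mu_nonneg k
    positivity
  · have h1 : 0 < (1 + mu k) ^ 2 := by have := mu_nonneg k; positivity
    rw [← div_eq_mul_inv, le_div_iff₀ h1]
    calc _ = (1 + mu k) ^ (m + 2) * ‖fourierCoef f k‖ := by ring
      _ ≤ K := hK k

theorem SP.summable_norm_fourierCoef {f : E3 → ℝ} (hf : SP f) :
    Summable fun k => ‖fourierCoef f k‖ := by simpa using hf.summable_fourierCoef 0

/-- The torus `(ℝ/ℤ)³` is a topological quotient of `ℝ³`. -/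
theorem isQuotientMap_torus :
    Topology.IsQuotientMap (fun (x : Fin 3 → ℝ) (i : Fin 3) => ((x i : ℝ) : UnitAddCircle)) :=
  (IsOpenQuotientMap.piMap (f := fun (_ : Fin 3) (x : ℝ) => (x : UnitAddCircle))
    fun _ => QuotientAddGroup.isOpenQuotientMap_mk).isQuotientMap

theorem mFourier_coe (k : Fin 3 → ℤ) (x : Fin 3 → ℝ) :
    UnitAddTorus.mFourier k (fun i => ((x i : ℝ) : UnitAddCircle))
      = character k (WithLp.toLp 2 x) := by
  simp only [UnitAddTorus.mFourier, ContinuousMap.coe_mk, fourier_coe_apply, character]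
  rw [← Complex.exp_sum]
  congr 1
  push_cast
  rw [Finset.mul_sum]
  refine Finset.sum_congr rfl fun i _ => ?_
  simp
  ring

/-- A smooth periodic function is the sum of its Fourier series. -/
theorem SP.hasSum_fourier {f : E3 → ℝ} (hf : SP f) (x : E3) :
    HasSum (fun k => fourierCoef f k * character k x) (f x : ℂ) := by
  let f₀ : C(Fin 3 → ℝ, ℂ) := ⟨fun x => (f (WithLp.toLp 2 x) : ℂ),
    Complex.continuous_ofReal.comp (hf.continuous.comp (PiLp.continuous_toLp 2 _))⟩
  have hfac : ∀ a b : Fin 3 → ℝ, (fun i => ((a i : ℝ) : UnitAddCircle))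
      = (fun i => ((b i : ℝ) : UnitAddCircle)) → f₀ a = f₀ b := by
    intro a b hab
    have h1 : ∀ i, ∃ n : ℤ, a i = b i + n := fun i => by
      have := congrFun hab i
      rw [← sub_eq_zero, ← AddCircle.coe_sub, AddCircle.coe_eq_zero_iff] at this
      obtain ⟨n, hn⟩ := this
      exact ⟨n, by simp at hn; linarith⟩
    choose n hn using h1
    have hper : ∀ i, Function.Periodic f (e i) := fun i x => hf.per x i
    have h2 := ((((hper 0).zsmul (n 0)).add_period ((hper 1).zsmul (n 1))).add_period
      ((hper 2).zsmul (n 2))) (WithLp.toLp 2 b)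
    simp only [f₀, ContinuousMap.coe_mk]
    rw [← h2]
    congr 2
    ext i
    fin_cases i <;> simp [e, hn]
  let g : C(UnitAddTorus (Fin 3), ℂ) :=
    Topology.IsQuotientMap.lift (f := ⟨_, isQuotientMap_torus.continuous⟩) isQuotientMap_torus f₀
      fun a b hab => hfac a b hab
  have hg : ∀ y : Fin 3 → ℝ, g (fun i => ((y i : ℝ) : UnitAddCircle)) = f (WithLp.toLp 2 y) := by
    intro y
    exact congrArg (fun h : C(Fin 3 → ℝ, ℂ) => h y)
      (Topology.IsQuotientMap.lift_comp (f := ⟨_, isQuotientMap_torus.continuous⟩)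
        isQuotientMap_torus f₀ fun a b hab => hfac a b hab)
  have hcoef : ∀ k, UnitAddTorus.mFourierCoeff g k = fourierCoef f k := by
    intro k
    rw [UnitAddTorus.mFourierCoeff_eq_integral _ _ 0, fourierCoef, setIntegral_unitCube]
    simp only [hg, mFourier_coe, smul_eq_mul, mul_comm (character _ _)]
    refine setIntegral_congr_set ?_
    have h2 : {x : Fin 3 → ℝ | ∀ i, x i ∈ Ioc ((0 : Fin 3 → ℝ) i) ((0 : Fin 3 → ℝ) i + 1)}
        = univ.pi fun i => Ioc ((0 : Fin 3 → ℝ) i) ((1 : Fin 3 → ℝ) i) := by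
      ext x; simp
    rw [h2]
    exact Measure.univ_pi_Ioc_ae_eq_Icc
  have hs : Summable (UnitAddTorus.mFourierCoeff g) := by
    rw [show UnitAddTorus.mFourierCoeff g = fourierCoef f from funext hcoef]
    exact hf.summable_norm_fourierCoef.of_norm
  have := UnitAddTorus.hasSum_mFourier_series_apply_of_summable hs
    (fun i => ((x i : ℝ) : UnitAddCircle))
  rw [hg] at this
  simpa [hcoef, mFourier_coe] using this

/-! ### The heat semigroup -/

/-- The Gaussian of total mass one whose rescalings form the heat kernel of `ℝ³`. -/
def gauss (z : E3) : ℝ :=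
  (∫ y : E3, Real.exp (-(1 / 4) * ‖y‖ ^ 2))⁻¹ * Real.exp (-(1 / 4) * ‖z‖ ^ 2)

/-- The heat semigroup, `heat s f (x) = ∫ gauss(z) f(x + √s z) dz`. -/
def heat (s : ℝ) (f : E3 → ℝ) : E3 → ℝ := avg gauss (Real.sqrt s) f

theorem integrable_exp_neg_norm_sq {b : ℝ} (hb : 0 < b) :
    Integrable fun y : E3 => Real.exp (-b * ‖y‖ ^ 2) := by
  have := (GaussianFourier.integrable_cexp_neg_mul_sq_norm_add (V := E3) (b := b) (by simpa) 0 0).re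
  refine this.congr (Filter.Eventually.of_forall fun y => ?_)
  simp only [zero_mul, add_zero, RCLike.re_eq_complex_re]
  rw [← Complex.ofReal_re (Real.exp _)]
  congr 1
  push_cast
  rfl

theorem integral_exp_pos : 0 < ∫ y : E3, Real.exp (-(1 / 4) * ‖y‖ ^ 2) := by
  rw [GaussianFourier.integral_rexp_neg_mul_sq_norm (by norm_num : (0 : ℝ) < 1 / 4)]
  positivity

theorem gauss_pos (z : E3) : 0 < gauss z := mul_pos (inv_pos.2 integral_exp_pos) (Real.exp_pos _)

theorem integrable_gauss : Integrable gauss :=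
  (integrable_exp_neg_norm_sq (by norm_num)).const_mul _

theorem integral_gauss : ∫ z, gauss z = 1 := by
  simp only [gauss]
  rw [integral_const_mul, inv_mul_cancel₀ integral_exp_pos.ne']

theorem integral_abs_gauss : ∫ z, |gauss z| = 1 := by
  simp only [abs_of_pos (gauss_pos _), integral_gauss]

theorem differentiable_gauss : Differentiable ℝ gauss := by
  have h : Differentiable ℝ fun z : E3 => ‖z‖ ^ 2 := (contDiff_norm_sq ℝ (n := 1)).differentiable (by simp)
  unfold gauss
  fun_prop

theorem continuous_gauss : Continuous gauss := differentiable_gauss.continuous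

/-- The Gaussian has finite second moments. -/
theorem integrable_sq_mul_gauss : Integrable fun z : E3 => (1 + ‖z‖ ^ 2) * gauss z := by
  have h1 := (integrable_exp_neg_norm_sq (b := 1 / 8) (by norm_num)).const_mul
    ((∫ y : E3, Real.exp (-(1 / 4) * ‖y‖ ^ 2))⁻¹ * 8)
  refine h1.mono' ?_ (Filter.Eventually.of_forall fun z => ?_)
  · have := continuous_gauss
    exact Continuous.aestronglyMeasurable (by fun_prop)
  · have h2 : (1 + ‖z‖ ^ 2) ≤ 8 * Real.exp (1 / 8 * ‖z‖ ^ 2) := by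
      have := Real.add_one_le_exp (1 / 8 * ‖z‖ ^ 2)
      nlinarith
    have h3 : Real.exp (-(1 / 4) * ‖z‖ ^ 2)
        = Real.exp (-(1 / 8) * ‖z‖ ^ 2) * Real.exp (-(1 / 8) * ‖z‖ ^ 2) := by
      rw [← Real.exp_add]; congr 1; ring
    have h4 : Real.exp (1 / 8 * ‖z‖ ^ 2) * Real.exp (-(1 / 8) * ‖z‖ ^ 2) = 1 := by
      rw [← Real.exp_add]; simp
    rw [Real.norm_of_nonneg (mul_nonneg (by positivity) (gauss_pos z).le), gauss, h3]
    have h5 := inv_pos.2 integral_exp_pos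
    have h6 := Real.exp_pos (-(1 / 8) * ‖z‖ ^ 2)
    calc (1 + ‖z‖ ^ 2) * ((∫ y : E3, Real.exp (-(1 / 4) * ‖y‖ ^ 2))⁻¹ *
          (Real.exp (-(1 / 8) * ‖z‖ ^ 2) * Real.exp (-(1 / 8) * ‖z‖ ^ 2)))
        ≤ (8 * Real.exp (1 / 8 * ‖z‖ ^ 2)) * ((∫ y : E3, Real.exp (-(1 / 4) * ‖y‖ ^ 2))⁻¹ *
          (Real.exp (-(1 / 8) * ‖z‖ ^ 2) * Real.exp (-(1 / 8) * ‖z‖ ^ 2))) :=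
          mul_le_mul_of_nonneg_right h2 (by positivity)
      _ = (∫ y : E3, Real.exp (-(1 / 4) * ‖y‖ ^ 2))⁻¹ * 8 * Real.exp (-(1 / 8) * ‖z‖ ^ 2) *
          (Real.exp (1 / 8 * ‖z‖ ^ 2) * Real.exp (-(1 / 8) * ‖z‖ ^ 2)) := by ring
      _ = _ := by rw [h4, mul_one]

/-- A constant which dominates all moments of the Gaussian and of its gradient that are used. -/
def gaussMom : ℝ := ∫ z : E3, (1 + ‖z‖ ^ 2) * gauss z

theorem gaussMom_pos : 0 < gaussMom := by
  have : (1 : ℝ) ≤ gaussMom := by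
    rw [← integral_gauss, gaussMom]
    refine integral_mono integrable_gauss integrable_sq_mul_gauss fun z => ?_
    simp only
    nlinarith [gauss_pos z, sq_nonneg ‖z‖, mul_nonneg (sq_nonneg ‖z‖) (gauss_pos z).le]
  linarith

theorem D_gauss (i : Fin 3) (z : E3) : D i gauss z = -(z i / 2) * gauss z := by
  have h1 : HasFDerivAt (fun z : E3 => ‖z‖ ^ 2) (2 • (innerSL ℝ z)) z :=
    (hasStrictFDerivAt_norm_sq z).hasFDerivAt
  have h2 := ((h1.const_mul (-(1 / 4 : ℝ))).exp.const_mul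
    (∫ y : E3, Real.exp (-(1 / 4) * ‖y‖ ^ 2))⁻¹)
  rw [D, HasFDerivAt.fderiv (f := gauss) h2]
  simp [gauss, e, PiLp.inner_apply]
  ring

theorem abs_coord_le (z : E3) (i : Fin 3) : |z i| ≤ ‖z‖ := by
  have := PiLp.norm_apply_le z i
  simpa using this

theorem abs_D_gauss_le (i : Fin 3) (z : E3) : |D i gauss z| ≤ ‖z‖ * gauss z := by
  rw [D_gauss, abs_mul, abs_of_pos (gauss_pos z)]
  refine mul_le_mul_of_nonneg_right ?_ (gauss_pos z).le
  rw [abs_neg, abs_div, abs_two]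
  linarith [abs_coord_le z i, abs_nonneg (z i)]

theorem continuous_D_gauss (i : Fin 3) : Continuous (D i gauss) := by
  have h : D i gauss = fun z => -(z i / 2) * gauss z := funext fun z => D_gauss i z
  rw [h]
  have := continuous_gauss
  fun_prop

/-- Weighted integrability of a continuous function dominated by `(1 + |z|²) gauss`. -/
theorem integrable_of_le_gauss {h : E3 → ℝ} (hc : Continuous h)
    (hb : ∀ z, |h z| ≤ (1 + ‖z‖ ^ 2) * gauss z) : Integrable h ∧ |∫ z, h z| ≤ gaussMom :=
  ⟨integrable_sq_mul_gauss.mono' hc.aestronglyMeasurable (Filter.Eventually.of_forall hb),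
    norm_integral_le_of_norm_le (f := h) integrable_sq_mul_gauss (Filter.Eventually.of_forall hb)⟩

theorem integrable_D_gauss (i : Fin 3) : Integrable (D i gauss) :=
  (integrable_of_le_gauss (continuous_D_gauss i) fun z => (abs_D_gauss_le i z).trans
    (mul_le_mul_of_nonneg_right (by nlinarith [sq_nonneg (‖z‖ - 1)]) (gauss_pos z).le)).1

theorem SP.heat {f : E3 → ℝ} (hf : SP f) (s : ℝ) : SP (heat s f) := hf.avg integrable_gauss _

theorem D_heat {f : E3 → ℝ} (hf : SP f) (s : ℝ) (i : Fin 3) : D i (heat s f) = heat s (D i f) :=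
  D_avg hf integrable_gauss _ _

/-- Characters are eigenfunctions of the heat semigroup. -/
theorem integral_gauss_character (k : Fin 3 → ℤ) (c : ℝ) :
    ∫ y, (gauss y : ℂ) * character k (c • y) = Real.exp (-(c ^ 2 * mu k)) := by
  let w : E3 := WithLp.toLp 2 fun i => (k i : ℝ)
  have h1 := GaussianFourier.integral_cexp_neg_mul_sq_norm_add (V := E3) (b := ((1 / 4 : ℝ) : ℂ))
    (by norm_num) (2 * Real.pi * Complex.I * c) w
  have h0 := GaussianFourier.integral_cexp_neg_mul_sq_norm (V := E3) (b := ((1 / 4 : ℝ) : ℂ))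
    (by norm_num)
  have hZ : ((∫ y : E3, Real.exp (-(1 / 4) * ‖y‖ ^ 2) : ℝ) : ℂ)
      = ∫ v : E3, Complex.exp (-((1 / 4 : ℝ) : ℂ) * (‖v‖ : ℂ) ^ 2) := by
    rw [← integral_complex_ofReal]
    congr 1 with y
    push_cast
    rfl
  have hne : ((∫ y : E3, Real.exp (-(1 / 4) * ‖y‖ ^ 2) : ℝ) : ℂ) ≠ 0 :=
    Complex.ofReal_ne_zero.2 integral_exp_pos.ne'
  have h2 : ∀ y : E3, (gauss y : ℂ) * character k (c • y)
      = ((∫ y : E3, Real.exp (-(1 / 4) * ‖y‖ ^ 2) : ℝ) : ℂ)⁻¹ *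
        Complex.exp (-((1 / 4 : ℝ) : ℂ) * (‖y‖ : ℂ) ^ 2
          + (2 * Real.pi * Complex.I * c) * ((inner ℝ w y : ℝ) : ℂ)) := by
    intro y
    rw [Complex.exp_add]
    simp only [gauss, character]
    push_cast
    rw [mul_assoc]
    congr 3
    simp only [w, PiLp.inner_apply]
    simp [Finset.mul_sum]
    refine Finset.sum_congr rfl fun i _ => by ring
  simp only [h2]
  rw [integral_const_mul, h1, ← h0, ← hZ, ← mul_assoc, inv_mul_cancel₀ hne, one_mul,
    Complex.ofReal_exp]
  congr 1
  have h3 : ‖w‖ ^ 2 = ∑ i, (k i : ℝ) ^ 2 := by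
    rw [EuclideanSpace.norm_sq_eq]; simp [w]
  have h4 : ((‖w‖ : ℂ)) ^ 2 = ((∑ i, (k i : ℝ) ^ 2 : ℝ) : ℂ) := by rw [← h3]; push_cast; rfl
  rw [h4, mu]
  push_cast
  linear_combination (4 * (Real.pi : ℂ) ^ 2 * c ^ 2 * ∑ i, (k i : ℂ) ^ 2) * Complex.I_sq

/-- The heat semigroup acts on Fourier series by the factors `exp(-s|2πk|²)`. -/
theorem hasSum_heat_of_hasSum {f : E3 → ℝ} {c : (Fin 3 → ℤ) → ℂ} (hc : Summable fun k => ‖c k‖)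
    (hf : ∀ x, HasSum (fun k => c k * character k x) (f x : ℂ)) {s : ℝ} (hs : 0 ≤ s) (x : E3) :
    HasSum (fun k => (c k * Real.exp (-(s * mu k))) * character k x) (heat s f x : ℂ) := by
  have hint : ∀ k, Integrable fun y : E3 =>
      (gauss y : ℂ) * (c k * character k (x + Real.sqrt s • y)) := fun k => by
    refine (integrable_gauss.ofReal (𝕜 := ℂ)).mul_bdd (c := ‖c k‖) ?_
      (Filter.Eventually.of_forall fun y => by rw [norm_mul, norm_character, mul_one])
    exact (continuous_const.mul ((continuous_character k).comp (by fun_prop))).aestronglyMeasurable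
  have hnorm : ∀ k, ∫ y : E3, ‖(gauss y : ℂ) * (c k * character k (x + Real.sqrt s • y))‖ = ‖c k‖ := by
    intro k
    simp only [norm_mul, norm_character, mul_one, Complex.norm_real, Real.norm_eq_abs]
    rw [integral_mul_const, integral_abs_gauss, one_mul]
  have h1 := hasSum_integral_of_summable_integral_norm hint (by simpa only [hnorm] using hc)
  have h2 : (∫ y : E3, ∑' k, (gauss y : ℂ) * (c k * character k (x + Real.sqrt s • y)))
      = (heat s f x : ℂ) := by
    simp only [tsum_mul_left, (hf _).tsum_eq]
    rw [heat, avg, ← integral_complex_ofReal]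
    simp
  rw [h2] at h1
  refine (congrArg (fun F : (Fin 3 → ℤ) → ℂ => HasSum F (heat s f x : ℂ))
    (funext fun k => ?_)).mp h1
  have h3 : ∀ y : E3, (gauss y : ℂ) * (c k * character k (x + Real.sqrt s • y))
      = (c k * character k x) * ((gauss y : ℂ) * character k (Real.sqrt s • y)) := fun y => by
    rw [character_add]; ring
  simp only [h3]
  rw [integral_const_mul, integral_gauss_character, Real.sq_sqrt hs]
  ring

theorem SP.hasSum_heat {f : E3 → ℝ} (hf : SP f) {s : ℝ} (hs : 0 ≤ s) (x : E3) :
    HasSum (fun k => (fourierCoef f k * Real.exp (-(s * mu k))) * character k x)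
      (FracNS.heat s f x : ℂ) :=
  hasSum_heat_of_hasSum hf.summable_norm_fourierCoef hf.hasSum_fourier hs x

/-- The semigroup property. -/
theorem heat_heat {f : E3 → ℝ} (hf : SP f) {s t : ℝ} (hs : 0 ≤ s) (ht : 0 ≤ t) (x : E3) :
    heat s (heat t f) x = heat (s + t) f x := by
  have hsum : Summable fun k => ‖fourierCoef f k * Real.exp (-(t * mu k))‖ := by
    refine Summable.of_nonneg_of_le (fun _ => norm_nonneg _) (fun k => ?_)
      hf.summable_norm_fourierCoef
    rw [norm_mul, Complex.norm_real, Real.norm_of_nonneg (Real.exp_pos _).le]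
    refine mul_le_of_le_one_right (norm_nonneg _) (Real.exp_le_one_iff.2 ?_)
    have := mul_nonneg ht (mu_nonneg k)
    linarith
  have h1 := hasSum_heat_of_hasSum hsum (fun x => hf.hasSum_heat ht x) hs x
  have h2 := hf.hasSum_heat (add_nonneg hs ht) x
  have h3 : ∀ k, fourierCoef f k * (Real.exp (-(t * mu k)) : ℂ) * (Real.exp (-(s * mu k)) : ℂ)
      = fourierCoef f k * (Real.exp (-((s + t) * mu k)) : ℂ) := fun k => by
    rw [mul_assoc, ← Complex.ofReal_mul, ← Real.exp_add]
    congr 3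
    ring
  simp only [h3] at h1
  exact_mod_cast h1.unique h2

/-- The heat semigroup is positivity preserving, hence does not increase differences of
translates. -/
theorem heat_sub_le {f : E3 → ℝ} (hf : SP f) (s : ℝ) {x y : E3} {A : ℝ}
    (hA : ∀ z, f (x + z) - f (y + z) ≤ A) : heat s f x - heat s f y ≤ A := by
  simp only [heat, avg, smul_eq_mul]
  rw [← integral_sub (hf.integrable_avg integrable_gauss _ x)
    (hf.integrable_avg integrable_gauss _ y), ← one_mul A, ← integral_gauss,
    ← integral_mul_const]
  refine integral_mono ((hf.integrable_avg integrable_gauss _ x).sub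
    (hf.integrable_avg integrable_gauss _ y)) (integrable_gauss.mul_const A) fun z => ?_
  simp only
  rw [← mul_sub]
  exact mul_le_mul_of_nonneg_left (hA _) (gauss_pos z).le

theorem heat_le {f : E3 → ℝ} (hf : SP f) (s : ℝ) {x : E3} {A : ℝ}
    (hA : ∀ z, f (x + z) ≤ A) : heat s f x ≤ A := by
  simp only [heat, avg, smul_eq_mul]
  rw [← one_mul A, ← integral_gauss, ← integral_mul_const]
  exact integral_mono (hf.integrable_avg integrable_gauss _ x) (integrable_gauss.mul_const A)
    fun z => mul_le_mul_of_nonneg_left (hA _) (gauss_pos z).le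

theorem abs_heat_le {f : E3 → ℝ} {s K : ℝ} (hK : ∀ x, |f x| ≤ K) (x : E3) :
    |heat s f x| ≤ K := by
  have := abs_avg_le (f := f) integrable_gauss (c := Real.sqrt s) (x := x) (A := K)
    fun y _ => hK _
  rwa [integral_abs_gauss, one_mul] at this

theorem rpow_le_one_add_sq {r a : ℝ} (hr : 0 ≤ r) (h0 : 0 ≤ a) (h2 : a ≤ 2) :
    r ^ a ≤ 1 + r ^ 2 := by
  rcases le_total r 1 with h | h
  · have := Real.rpow_le_one hr h h0
    nlinarith [sq_nonneg r]
  · have := Real.rpow_le_rpow_of_exponent_le h h2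
    rw [Real.rpow_two] at this
    linarith

theorem abs_sub_heat_le {f : E3 → ℝ} (hf : SP f) {s α K : ℝ} (hs : 0 ≤ s) (h0 : 0 ≤ α)
    (h1 : α ≤ 2) (hK0 : 0 ≤ K) (hK : ∀ x y, |f x - f y| ≤ K * ‖x - y‖ ^ α) (x : E3) :
    |f x - heat s f x| ≤ gaussMom * K * s ^ (α / 2) := by
  have e1 : f x - heat s f x = ∫ z, gauss z * (f x - f (x + Real.sqrt s • z)) := by
    simp only [mul_sub]
    rw [integral_sub (integrable_gauss.mul_const _) (hf.integrable_avg integrable_gauss _ x),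
      integral_mul_const, integral_gauss, one_mul]
    rfl
  rw [e1, mul_assoc, gaussMom, ← integral_mul_const]
  refine norm_integral_le_of_norm_le (f := fun z => gauss z * (f x - f (x + Real.sqrt s • z)))
    (integrable_sq_mul_gauss.mul_const _) (Filter.Eventually.of_forall fun z => ?_)
  rw [Real.norm_eq_abs, abs_mul, abs_of_pos (gauss_pos z)]
  have h2 := hK x (x + Real.sqrt s • z)
  rw [show x - (x + Real.sqrt s • z) = -(Real.sqrt s • z) by abel, norm_neg, norm_smul,
    Real.norm_of_nonneg (Real.sqrt_nonneg _), Real.mul_rpow (Real.sqrt_nonneg _) (norm_nonneg _),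
    Real.sqrt_eq_rpow, ← Real.rpow_mul hs] at h2
  have h3 := rpow_le_one_add_sq (norm_nonneg z) h0 h1
  have h4 : 0 ≤ s ^ (α / 2) := by positivity
  rw [show (1 / 2 * α) = α / 2 by ring] at h2
  rw [Real.sqrt_eq_rpow]
  calc gauss z * |f x - f (x + s ^ (1 / 2 : ℝ) • z)|
      ≤ gauss z * (K * (s ^ (α / 2) * (1 + ‖z‖ ^ 2))) :=
        mul_le_mul_of_nonneg_left (h2.trans (by gcongr)) (gauss_pos z).le
    _ = _ := by ring

theorem heat_D {f : E3 → ℝ} (hf : SP f) {s : ℝ} (hs : 0 < s) (i : Fin 3) (x : E3) :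
    heat s (D i f) x = -(Real.sqrt s)⁻¹ * avg (D i gauss) (Real.sqrt s) f x :=
  avg_D hf integrable_gauss differentiable_gauss (integrable_D_gauss i) (Real.sqrt_pos.2 hs).ne' x

theorem integral_D_gauss (i : Fin 3) : ∫ z, D i gauss z = 0 := by
  have h := heat_D (SP.const 1) one_pos i 0
  rw [D_const] at h
  simpa [heat, avg] using h

/-- Smoothing of the heat semigroup on Hölder continuous functions; `α = 0` is the case of bounded
functions. -/
theorem abs_heat_D_le {f : E3 → ℝ} (hf : SP f) {s α K : ℝ} (hs : 0 < s) (h0 : 0 ≤ α) (h1 : α ≤ 1)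
    (hK0 : 0 ≤ K) (hK : ∀ x y, |f x - f y| ≤ K * ‖x - y‖ ^ α) (i : Fin 3) (x : E3) :
    |heat s (D i f) x| ≤ gaussMom * K * s ^ (-(1 / 2) + α / 2) := by
  have e1 : avg (D i gauss) (Real.sqrt s) f x
      = ∫ z, D i gauss z * (f (x + Real.sqrt s • z) - f x) := by
    simp only [mul_sub]
    rw [integral_sub (hf.integrable_avg (integrable_D_gauss i) _ x)
      ((integrable_D_gauss i).mul_const _), integral_mul_const, integral_D_gauss, zero_mul, sub_zero]
    rfl
  have h2 : |avg (D i gauss) (Real.sqrt s) f x| ≤ gaussMom * (K * s ^ (α / 2)) := by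
    rw [e1, gaussMom, ← integral_mul_const]
    refine norm_integral_le_of_norm_le
      (f := fun z => D i gauss z * (f (x + Real.sqrt s • z) - f x))
      (integrable_sq_mul_gauss.mul_const _) (Filter.Eventually.of_forall fun z => ?_)
    rw [Real.norm_eq_abs, abs_mul]
    have h2 := hK (x + Real.sqrt s • z) x
    rw [show (x + Real.sqrt s • z) - x = (Real.sqrt s • z) by abel, norm_smul,
      Real.norm_of_nonneg (Real.sqrt_nonneg _), Real.mul_rpow (Real.sqrt_nonneg _) (norm_nonneg _),
      Real.sqrt_eq_rpow, ← Real.rpow_mul hs.le] at h2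
    have h3 := rpow_le_one_add_sq (a := 1 + α) (norm_nonneg z) (by linarith) (by linarith)
    rw [Real.rpow_add' (norm_nonneg z) (by linarith), Real.rpow_one] at h3
    have h4 : 0 ≤ s ^ (α / 2) := by positivity
    rw [show (1 / 2 * α) = α / 2 by ring] at h2
    rw [Real.sqrt_eq_rpow]
    calc |D i gauss z| * |f (x + s ^ (1 / 2 : ℝ) • z) - f x|
        ≤ (‖z‖ * gauss z) * (K * (s ^ (α / 2) * ‖z‖ ^ α)) :=
          mul_le_mul (abs_D_gauss_le i z) h2 (abs_nonneg _)
            (mul_nonneg (norm_nonneg _) (gauss_pos z).le)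
      _ = gauss z * K * s ^ (α / 2) * (‖z‖ * ‖z‖ ^ α) := by ring
      _ ≤ gauss z * K * s ^ (α / 2) * (1 + ‖z‖ ^ 2) :=
          mul_le_mul_of_nonneg_left h3
            (mul_nonneg (mul_nonneg (gauss_pos z).le hK0) h4)
      _ = _ := by ring
  rw [heat_D hf hs, abs_mul, abs_neg, abs_of_pos (inv_pos.2 (Real.sqrt_pos.2 hs)),
    Real.rpow_add hs, Real.rpow_neg hs.le, ← Real.sqrt_eq_rpow]
  calc (Real.sqrt s)⁻¹ * |avg (D i gauss) (Real.sqrt s) f x|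
      ≤ (Real.sqrt s)⁻¹ * (gaussMom * (K * s ^ (α / 2))) :=
        mul_le_mul_of_nonneg_left h2 (by positivity)
    _ = _ := by ring

theorem continuous_heat {f : E3 → ℝ} (hf : SP f) :
    Continuous fun p : ℝ × E3 => heat p.1 f p.2 := by
  obtain ⟨K, -, hK⟩ := hf.bounded
  refine continuous_of_dominated (bound := fun z => gauss z * K)
    (fun p => ?_) (fun p => Filter.Eventually.of_forall fun z => ?_)
    (integrable_gauss.mul_const K) (Filter.Eventually.of_forall fun z => ?_)
  · exact (hf.integrable_avg integrable_gauss _ p.2).aestronglyMeasurable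
  · rw [smul_eq_mul, norm_mul, Real.norm_of_nonneg (gauss_pos z).le]
    exact mul_le_mul_of_nonneg_left (hK _) (gauss_pos z).le
  · exact (hf.continuous.comp
      (f := fun p : ℝ × E3 => p.2 + Real.sqrt p.1 • z) (by fun_prop)).const_smul (gauss z)

theorem heat_avg_comm {f : E3 → ℝ} (hf : SP f) {k : E3 → ℝ} (hk : Integrable k) (c s : ℝ) (x : E3) :
    heat s (avg k c f) x = avg k c (heat s f) x :=
  avg_avg_comm hf integrable_gauss hk _ _ x

/-! ### The fractional Laplacian as a superposition of heat operators -/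

/-- Weight of the subordination formula, cut off at the spatial scale `r`. -/
theorem integrableOn_min_weight {γ r : ℝ} (h0 : 0 < γ) (h1 : γ < 1 / 2) (hr : 0 < r) :
    IntegrableOn (fun s : ℝ => min (Real.sqrt s / r) 1 * s ^ (-1 - γ)) (Ioi 0) ∧
    ∫ s in Ioi (0 : ℝ), min (Real.sqrt s / r) 1 * s ^ (-1 - γ)
      ≤ (1 / (1 / 2 - γ) + 1 / γ) * r ^ (-2 * γ) := by
  have hr2 : 0 < r ^ 2 := by positivity
  have hmeas : Measurable fun s : ℝ => min (Real.sqrt s / r) 1 * s ^ (-1 - γ) := by fun_prop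
  have hnn : ∀ s ∈ Ioi (0 : ℝ), 0 ≤ min (Real.sqrt s / r) 1 * s ^ (-1 - γ) := fun s hs =>
    mul_nonneg (le_min (by positivity) zero_le_one) (Real.rpow_nonneg (le_of_lt hs) _)
  -- small times
  have b1 : ∀ s ∈ Ioc 0 (r ^ 2), min (Real.sqrt s / r) 1 * s ^ (-1 - γ) ≤ r⁻¹ * s ^ (-(1 / 2) - γ) := by
    intro s hs
    have : s ^ (-(1 / 2) - γ) = Real.sqrt s * s ^ (-1 - γ) := by
      rw [Real.sqrt_eq_rpow, ← Real.rpow_add hs.1]; congr 1; ring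
    rw [this, ← mul_assoc, ← div_eq_inv_mul]
    exact mul_le_mul_of_nonneg_right (min_le_left _ _) (Real.rpow_nonneg hs.1.le _)
  have i1' : IntegrableOn (fun s : ℝ => r⁻¹ * s ^ (-(1 / 2) - γ)) (Ioc 0 (r ^ 2)) := by
    refine Integrable.const_mul ?_ _
    have := intervalIntegral.intervalIntegrable_rpow' (a := 0) (b := r ^ 2) (r := -(1 / 2) - γ)
      (by linarith)
    exact (intervalIntegrable_iff_integrableOn_Ioc_of_le hr2.le).1 this
  have i1 : IntegrableOn (fun s : ℝ => min (Real.sqrt s / r) 1 * s ^ (-1 - γ)) (Ioc 0 (r ^ 2)) := by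
    refine i1'.mono' hmeas.aestronglyMeasurable ?_
    refine (ae_restrict_mem measurableSet_Ioc).mono fun s hs => ?_
    rw [Real.norm_of_nonneg (hnn s hs.1)]
    exact b1 s hs
  have e1 : ∫ s in Ioc 0 (r ^ 2), min (Real.sqrt s / r) 1 * s ^ (-1 - γ)
      ≤ 1 / (1 / 2 - γ) * r ^ (-2 * γ) := by
    refine (setIntegral_mono_on i1 i1' measurableSet_Ioc b1).trans_eq ?_
    rw [integral_const_mul, ← intervalIntegral.integral_of_le hr2.le,
      integral_rpow (Or.inl (by linarith)), Real.zero_rpow (by linarith), sub_zero,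
      show -(1 / 2) - γ + 1 = 1 / 2 - γ by ring, ← Real.rpow_natCast, ← Real.rpow_mul hr.le,
      show ((2 : ℕ) : ℝ) * (1 / 2 - γ) = 1 + -2 * γ by push_cast; ring, Real.rpow_add hr,
      Real.rpow_one]
    field_simp
  -- large times
  have b2 : ∀ s ∈ Ioi (r ^ 2), min (Real.sqrt s / r) 1 * s ^ (-1 - γ) ≤ s ^ (-1 - γ) := by
    intro s hs
    have hs0 : 0 < s := hr2.trans hs
    exact mul_le_of_le_one_left (Real.rpow_nonneg hs0.le _) (min_le_right _ _)
  have i2' : IntegrableOn (fun s : ℝ => s ^ (-1 - γ)) (Ioi (r ^ 2)) :=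
    integrableOn_Ioi_rpow_of_lt (by linarith) hr2
  have i2 : IntegrableOn (fun s : ℝ => min (Real.sqrt s / r) 1 * s ^ (-1 - γ)) (Ioi (r ^ 2)) := by
    refine i2'.mono' hmeas.aestronglyMeasurable ?_
    refine (ae_restrict_mem measurableSet_Ioi).mono fun s hs => ?_
    rw [Real.norm_of_nonneg (hnn s (hr2.trans hs))]
    exact b2 s hs
  have e2 : ∫ s in Ioi (r ^ 2), min (Real.sqrt s / r) 1 * s ^ (-1 - γ) ≤ 1 / γ * r ^ (-2 * γ) := by
    refine (setIntegral_mono_on i2 i2' measurableSet_Ioi b2).trans_eq ?_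
    rw [integral_Ioi_rpow_of_lt (by linarith) hr2, show -1 - γ + 1 = -γ by ring,
      ← Real.rpow_natCast, ← Real.rpow_mul hr.le,
      show ((2 : ℕ) : ℝ) * (-γ) = -2 * γ by push_cast; ring]
    field_simp
  have hu : Ioc 0 (r ^ 2) ∪ Ioi (r ^ 2) = Ioi (0 : ℝ) := Ioc_union_Ioi_eq_Ioi hr2.le
  rw [← hu]
  refine ⟨i1.union i2, ?_⟩
  rw [setIntegral_union (Ioc_disjoint_Ioi le_rfl) measurableSet_Ioi i1 i2, add_mul]
  exact add_le_add e1 e2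

/-- The normalization `∫₀^∞ (1 - e^{-s}) s^{-1-γ} ds` of the subordination formula. -/
def subConst (γ : ℝ) : ℝ := ∫ s in Ioi (0 : ℝ), (1 - Real.exp (-s)) * s ^ (-1 - γ)

theorem one_sub_exp_le {s : ℝ} (hs : 0 ≤ s) : 1 - Real.exp (-s) ≤ min (Real.sqrt s / 1) 1 := by
  refine le_min ?_ (by linarith [Real.exp_pos (-s)])
  rw [div_one]
  rcases le_total s 1 with h | h
  · have h1 := Real.add_one_le_exp (-s)
    have h2 : s ≤ Real.sqrt s := Real.le_sqrt_of_sq_le (by nlinarith)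
    linarith
  · have : (1 : ℝ) ≤ Real.sqrt s := Real.one_le_sqrt.2 h
    linarith [Real.exp_pos (-s)]

theorem integrableOn_subConst {γ : ℝ} (h0 : 0 < γ) (h1 : γ < 1 / 2) :
    IntegrableOn (fun s : ℝ => (1 - Real.exp (-s)) * s ^ (-1 - γ)) (Ioi 0) := by
  refine (integrableOn_min_weight h0 h1 one_pos).1.mono' (by fun_prop) ?_
  refine (ae_restrict_mem measurableSet_Ioi).mono fun s hs => ?_
  have hs0 : (0 : ℝ) < s := hs
  have : 0 ≤ 1 - Real.exp (-s) := by
    have := Real.exp_le_one_iff.2 (by linarith : -s ≤ 0)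
    linarith
  rw [Real.norm_of_nonneg (mul_nonneg this (Real.rpow_nonneg hs0.le _))]
  exact mul_le_mul_of_nonneg_right (one_sub_exp_le hs0.le) (Real.rpow_nonneg hs0.le _)

theorem subConst_pos {γ : ℝ} (h0 : 0 < γ) (h1 : γ < 1 / 2) : 0 < subConst γ := by
  have hpos : ∀ s ∈ Ioi (0 : ℝ), 0 < (1 - Real.exp (-s)) * s ^ (-1 - γ) := fun s hs => by
    have hs0 : (0 : ℝ) < s := hs
    have : Real.exp (-s) < 1 := by
      rw [← Real.exp_zero]
      exact Real.exp_lt_exp.2 (by linarith)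
    exact mul_pos (by linarith) (Real.rpow_pos_of_pos hs0 _)
  refine (setIntegral_pos_iff_support_of_nonneg_ae ?_ (integrableOn_subConst h0 h1)).2 ?_
  · exact (ae_restrict_mem measurableSet_Ioi).mono fun s hs => (hpos s hs).le
  · have : Function.support (fun s : ℝ => (1 - Real.exp (-s)) * s ^ (-1 - γ)) ∩ Ioi 0 = Ioi 0 :=
      inter_eq_right.2 fun s hs => (hpos s hs).ne'
    rw [this]
    simp

/-- The subordination formula for `m ^ γ`. -/
theorem subordination {γ m : ℝ} (h0 : 0 < γ) (h1 : γ < 1 / 2) (hm : 0 ≤ m) :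
    IntegrableOn (fun s : ℝ => (1 - Real.exp (-(s * m))) * s ^ (-1 - γ)) (Ioi 0) ∧
    ∫ s in Ioi (0 : ℝ), (1 - Real.exp (-(s * m))) * s ^ (-1 - γ) = subConst γ * m ^ γ := by
  rcases hm.eq_or_lt with rfl | hm
  · simp [Real.zero_rpow h0.ne']
  · have e1 : ∀ s ∈ Ioi (0 : ℝ), (1 - Real.exp (-(s * m))) * s ^ (-1 - γ)
        = m ^ (1 + γ) * ((1 - Real.exp (-(m * s))) * (m * s) ^ (-1 - γ)) := fun s hs => by
      have hs0 : (0 : ℝ) < s := hs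
      rw [Real.mul_rpow hm.le hs0.le, mul_comm s m]
      have : m ^ (1 + γ) * m ^ (-1 - γ) = 1 := by
        rw [← Real.rpow_add hm]; simp
      linear_combination (-(1 - Real.exp (-(m * s))) * s ^ (-1 - γ)) * this
    refine ⟨?_, ?_⟩
    · refine IntegrableOn.congr_fun (Integrable.const_mul ?_ (m ^ (1 + γ))) (fun s hs => (e1 s hs).symm)
        measurableSet_Ioi
      have := (integrableOn_Ioi_comp_mul_left_iff
        (fun s : ℝ => (1 - Real.exp (-s)) * s ^ (-1 - γ)) 0 hm).2
        (by simpa using integrableOn_subConst h0 h1)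
      exact this
    · rw [setIntegral_congr_fun measurableSet_Ioi e1, integral_const_mul,
        integral_comp_mul_left_Ioi (fun s : ℝ => (1 - Real.exp (-s)) * s ^ (-1 - γ)) 0 hm]
      simp only [mul_zero, smul_eq_mul]
      rw [← subConst, ← mul_assoc, mul_comm]
      congr 1
      rw [Real.rpow_add hm, Real.rpow_one]
      field_simp

theorem mu_rpow (γ : ℝ) (k : Fin 3 → ℤ) :
    (2 * Real.pi * Real.sqrt (∑ i, (k i : ℝ) ^ 2)) ^ (2 * γ) = mu k ^ γ := by
  have h : 0 ≤ ∑ i, (k i : ℝ) ^ 2 := Finset.sum_nonneg fun _ _ => sq_nonneg _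
  rw [Real.rpow_mul (by positivity), Real.rpow_two, mul_pow, Real.sq_sqrt h, mu]

theorem SP.lipschitz {f : E3 → ℝ} (hf : SP f) : ∃ K, 0 ≤ K ∧ ∀ x y, |f x - f y| ≤ K * ‖x - y‖ := by
  obtain ⟨K, h0, hK⟩ := (hf.stp 0 1).lipschitz one_pos
  refine ⟨K, h0, fun x y => ?_⟩
  have := hK (0, y) (mem_slab.2 (by simp)) (0, x) (mem_slab.2 (by simp))
  simpa using this

section

variable {γ : ℝ} {f : E3 → ℝ}

theorem abs_sub_heat_le_min (hf : SP f) {r K : ℝ} (hr : 0 < r) (hK : ∀ x, |f x| ≤ K)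
    (hL : ∀ x y, |f x - f y| ≤ K / r * ‖x - y‖) {s : ℝ} (hs : 0 < s) (x : E3) :
    |f x - heat s f x| ≤ ((gaussMom + 2) * K) * min (Real.sqrt s / r) 1 := by
  have hK0 : 0 ≤ K := (abs_nonneg _).trans (hK 0)
  have hg := gaussMom_pos
  have h1 := abs_sub_heat_le hf hs.le zero_le_one (by norm_num) (div_nonneg hK0 hr.le)
    (by simpa using hL) x
  have h2 : |f x - heat s f x| ≤ 2 * K := by
    have := abs_sub (f x) (heat s f x)
    linarith [hK x, abs_heat_le (s := s) hK x]
  rw [mul_min_of_nonneg _ _ (by positivity)]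
  refine le_min ?_ ?_
  · rw [← Real.sqrt_eq_rpow] at h1
    refine h1.trans ?_
    rw [show gaussMom * (K / r) * Real.sqrt s = gaussMom * K * (Real.sqrt s / r) by ring]
    gcongr
    linarith
  · nlinarith

theorem integrableOn_sub_heat (h0 : 0 < γ) (h1 : γ < 1 / 2) (hf : SP f) (x : E3) :
    IntegrableOn (fun s : ℝ => (f x - heat s f x) * s ^ (-1 - γ)) (Ioi 0) := by
  obtain ⟨K, hK0, hK⟩ := hf.bounded
  obtain ⟨L, hL0, hL⟩ := hf.lipschitz
  refine ((integrableOn_min_weight h0 h1 one_pos).1.const_mul ((gaussMom + 2) * (K + L))).mono' ?_ ?_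
  · have : Measurable fun s : ℝ => heat s f x :=
      ((continuous_heat hf).comp (by fun_prop : Continuous fun s : ℝ => (s, x))).measurable
    fun_prop
  · refine (ae_restrict_mem measurableSet_Ioi).mono fun s hs => ?_
    have hs0 : (0 : ℝ) < s := hs
    rw [norm_mul, Real.norm_of_nonneg (Real.rpow_nonneg hs0.le _), Real.norm_eq_abs, ← mul_assoc]
    refine mul_le_mul_of_nonneg_right ?_ (Real.rpow_nonneg hs0.le _)
    refine abs_sub_heat_le_min hf one_pos (fun y => (hK y).trans (by linarith)) (fun y z => ?_) hs0 x
    refine (hL y z).trans (mul_le_mul_of_nonneg_right ?_ (norm_nonneg _))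
    linarith

/-- The fractional Laplacian is a positive superposition of the operators `1 - e^{sΔ}`. -/
theorem fracLapScalar_eq (h0 : 0 < γ) (h1 : γ < 1 / 2) (hf : SP f) (x : E3) :
    fracLapScalar γ f x
      = (subConst γ)⁻¹ * ∫ s in Ioi (0 : ℝ), (f x - heat s f x) * s ^ (-1 - γ) := by
  have hc := subConst_pos h0 h1
  let F : (Fin 3 → ℤ) → ℝ → ℂ := fun k s =>
    (fourierCoef f k * character k x) * (((1 - Real.exp (-(s * mu k))) * s ^ (-1 - γ) : ℝ) : ℂ)
  have hint : ∀ k, Integrable (F k) (volume.restrict (Ioi 0)) := fun k =>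
    ((subordination h0 h1 (mu_nonneg k)).1.ofReal (𝕜 := ℂ)).const_mul _
  have hnorm : ∀ k, ∫ s in Ioi (0 : ℝ), ‖F k s‖ = ‖fourierCoef f k‖ * (subConst γ * mu k ^ γ) := by
    intro k
    rw [← (subordination h0 h1 (mu_nonneg k)).2, ← integral_const_mul]
    refine setIntegral_congr_fun measurableSet_Ioi fun s hs => ?_
    have hs0 : (0 : ℝ) < s := hs
    simp only [F, norm_mul, norm_character, mul_one, Complex.norm_real]
    have h2 : 0 ≤ 1 - Real.exp (-(s * mu k)) := by
      have := Real.exp_le_one_iff.2 (by nlinarith [mul_nonneg hs0.le (mu_nonneg k)] : -(s * mu k) ≤ 0)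
      linarith
    rw [Real.norm_of_nonneg h2, Real.norm_of_nonneg (Real.rpow_nonneg hs0.le _)]
  have hsum : Summable fun k => ∫ s in Ioi (0 : ℝ), ‖F k s‖ := by
    simp only [hnorm]
    refine Summable.of_nonneg_of_le (fun k => ?_) (fun k => ?_)
      ((hf.summable_fourierCoef 1).mul_left (subConst γ))
    · have := mu_nonneg k; positivity
    · have h2 : mu k ^ γ ≤ 1 + mu k := by
        have := mu_nonneg k
        rcases le_total (mu k) 1 with h | h
        · have := Real.rpow_le_one this h h0.le
          linarith
        · have := Real.rpow_le_rpow_of_exponent_le h (by linarith : γ ≤ 1)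
          rw [Real.rpow_one] at this
          linarith
      calc ‖fourierCoef f k‖ * (subConst γ * mu k ^ γ)
          ≤ ‖fourierCoef f k‖ * (subConst γ * (1 + mu k)) := by gcongr
        _ = _ := by ring
  have key := hasSum_integral_of_summable_integral_norm hint hsum
  have e1 : ∀ s ∈ Ioi (0 : ℝ), ∑' k, F k s = (((f x - heat s f x) * s ^ (-1 - γ) : ℝ) : ℂ) := by
    intro s hs
    have hs0 : (0 : ℝ) < s := hs
    have h2 := ((hf.hasSum_fourier x).sub (hf.hasSum_heat hs0.le x)).mul_right
      ((s ^ (-1 - γ) : ℝ) : ℂ)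
    rw [← Complex.ofReal_sub, ← Complex.ofReal_mul] at h2
    rw [← h2.tsum_eq]
    refine tsum_congr fun k => ?_
    simp only [F]
    push_cast
    ring
  have e2 : ∀ k, ∫ s in Ioi (0 : ℝ), F k s
      = (subConst γ : ℂ) * (((mu k ^ γ : ℝ) : ℂ) * fourierCoef f k * character k x) := by
    intro k
    simp only [F]
    rw [integral_const_mul, integral_complex_ofReal, (subordination h0 h1 (mu_nonneg k)).2]
    push_cast
    ring
  rw [setIntegral_congr_fun measurableSet_Ioi e1, integral_complex_ofReal] at key
  simp only [e2] at key
  have h3 := (key.mul_left (subConst γ : ℂ)⁻¹).tsum_eq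
  have h4 : (subConst γ : ℂ) ≠ 0 := Complex.ofReal_ne_zero.2 hc.ne'
  simp only [← mul_assoc, inv_mul_cancel₀ h4, one_mul] at h3
  rw [fracLapScalar]
  simp only [mu_rpow]
  rw [h3, ← Complex.ofReal_inv, ← Complex.ofReal_mul, Complex.ofReal_re]

/-- The constant in the interpolation bound for the fractional Laplacian. -/
def fracConst (γ : ℝ) : ℝ := (subConst γ)⁻¹ * ((gaussMom + 2) * (1 / (1 / 2 - γ) + 1 / γ))

theorem fracConst_pos (h0 : 0 < γ) (h1 : γ < 1 / 2) : 0 < fracConst γ := by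
  have := subConst_pos h0 h1
  have := gaussMom_pos
  have : 0 < 1 / 2 - γ := by linarith
  unfold fracConst
  positivity

/-- Interpolation: if `f` is of size `K` and varies at the length scale `r`, then `(-Δ)^γ f` is of
size `r^{-2γ} K`. -/
theorem abs_fracLapScalar_le (h0 : 0 < γ) (h1 : γ < 1 / 2) (hf : SP f) {r K : ℝ} (hr : 0 < r)
    (hK : ∀ x, |f x| ≤ K) (hL : ∀ x y, |f x - f y| ≤ K / r * ‖x - y‖) (x : E3) :
    |fracLapScalar γ f x| ≤ fracConst γ * (r ^ (-2 * γ) * K) := by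
  have hc := subConst_pos h0 h1
  have hK0 : 0 ≤ K := (abs_nonneg _).trans (hK 0)
  have hg := gaussMom_pos
  obtain ⟨i1, i2⟩ := integrableOn_min_weight h0 h1 hr
  rw [fracLapScalar_eq h0 h1 hf, abs_mul, abs_of_pos (inv_pos.2 hc), fracConst, mul_assoc]
  refine mul_le_mul_of_nonneg_left ?_ (inv_pos.2 hc).le
  have h2 : |∫ s in Ioi (0 : ℝ), (f x - heat s f x) * s ^ (-1 - γ)|
      ≤ ∫ s in Ioi (0 : ℝ), ((gaussMom + 2) * K) * (min (Real.sqrt s / r) 1 * s ^ (-1 - γ)) := by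
    refine norm_integral_le_of_norm_le
      (f := fun s : ℝ => (f x - heat s f x) * s ^ (-1 - γ)) (i1.const_mul _) ?_
    refine (ae_restrict_mem measurableSet_Ioi).mono fun s hs => ?_
    have hs0 : (0 : ℝ) < s := hs
    rw [norm_mul, Real.norm_of_nonneg (Real.rpow_nonneg hs0.le _), Real.norm_eq_abs, ← mul_assoc]
    exact mul_le_mul_of_nonneg_right (abs_sub_heat_le_min hf hr hK hL hs0 x)
      (Real.rpow_nonneg hs0.le _)
  refine h2.trans ?_
  rw [integral_const_mul]
  calc _ ≤ ((gaussMom + 2) * K) * ((1 / (1 / 2 - γ) + 1 / γ) * r ^ (-2 * γ)) :=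
        mul_le_mul_of_nonneg_left i2 (by positivity)
    _ = _ := by ring

/-- Positive maximum principle for differences: if the difference of two translates of `f` is
largest at the given points, then so is the difference of the values of `(-Δ)^γ f`. -/
theorem fracLapScalar_le_of_touching (h0 : 0 < γ) (h1 : γ < 1 / 2) (hf : SP f) {x y : E3}
    (h : ∀ z, f (x + z) - f (y + z) ≤ f x - f y) : fracLapScalar γ f y ≤ fracLapScalar γ f x := by
  rw [fracLapScalar_eq h0 h1 hf, fracLapScalar_eq h0 h1 hf]
  refine mul_le_mul_of_nonneg_left ?_ (inv_pos.2 (subConst_pos h0 h1)).le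
  refine setIntegral_mono_on (integrableOn_sub_heat h0 h1 hf y) (integrableOn_sub_heat h0 h1 hf x)
    measurableSet_Ioi fun s hs => ?_
  have := heat_sub_le hf s h
  exact mul_le_mul_of_nonneg_right (by linarith) (Real.rpow_nonneg (le_of_lt hs) _)

theorem fracLapScalar_nonneg_of_max (h0 : 0 < γ) (h1 : γ < 1 / 2) (hf : SP f) {x : E3}
    (h : ∀ z, f z ≤ f x) : 0 ≤ fracLapScalar γ f x := by
  rw [fracLapScalar_eq h0 h1 hf]
  refine mul_nonneg (inv_pos.2 (subConst_pos h0 h1)).le ?_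
  refine setIntegral_nonneg measurableSet_Ioi fun s hs => ?_
  have := heat_le hf s (x := x) fun z => h (x + z)
  exact mul_nonneg (by linarith) (Real.rpow_nonneg (le_of_lt hs) _)

theorem fracLapScalar_add (h0 : 0 < γ) (h1 : γ < 1 / 2) (hf : SP f) {g : E3 → ℝ} (hg : SP g)
    (x : E3) : fracLapScalar γ (fun x => f x + g x) x
      = fracLapScalar γ f x + fracLapScalar γ g x := by
  rw [fracLapScalar_eq h0 h1 hf, fracLapScalar_eq h0 h1 hg, fracLapScalar_eq h0 h1 (hf.add hg),
    ← mul_add, ← integral_add (integrableOn_sub_heat h0 h1 hf x) (integrableOn_sub_heat h0 h1 hg x)]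
  congr 2 with s
  rw [heat, avg_add hf hg integrable_gauss]
  simp only [heat]
  ring

theorem fracLapScalar_const_mul (h0 : 0 < γ) (h1 : γ < 1 / 2) (c : ℝ) (hf : SP f) (x : E3) :
    fracLapScalar γ (fun x => c * f x) x = c * fracLapScalar γ f x := by
  rw [fracLapScalar_eq h0 h1 hf, fracLapScalar_eq h0 h1 (hf.const_mul c), mul_left_comm,
    ← integral_const_mul c]
  congr 2 with s
  rw [heat, avg_const_mul]
  simp only [heat]
  ring

theorem fracLapScalar_sub (h0 : 0 < γ) (h1 : γ < 1 / 2) (hf : SP f) {g : E3 → ℝ} (hg : SP g)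
    (x : E3) : fracLapScalar γ (fun x => f x - g x) x
      = fracLapScalar γ f x - fracLapScalar γ g x := by
  have := fracLapScalar_add h0 h1 hf (hg.const_mul (-1)) x
  rw [fracLapScalar_const_mul h0 h1 _ hg] at this
  rw [show (fun x => f x - g x) = fun x => f x + -1 * g x by ext x; ring, this]
  ring

theorem fracLapScalar_sum (h0 : 0 < γ) (h1 : γ < 1 / 2) {ι : Type*} (s : Finset ι)
    {f : ι → E3 → ℝ} (hf : ∀ i ∈ s, SP (f i)) (x : E3) :
    fracLapScalar γ (fun x => ∑ i ∈ s, f i x) x = ∑ i ∈ s, fracLapScalar γ (f i) x := by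
  classical
  induction s using Finset.induction_on with
  | empty =>
    have := fracLapScalar_const_mul h0 h1 0 (SP.const 0) x
    simpa using this
  | insert a s ha ih =>
    simp only [Finset.sum_insert ha]
    rw [fracLapScalar_add h0 h1 (hf a (Finset.mem_insert_self _ _))
      (SP.sum s fun i hi => hf i (Finset.mem_insert_of_mem hi)),
      ih fun i hi => hf i (Finset.mem_insert_of_mem hi)]

theorem fracLapScalar_translate (h0 : 0 < γ) (h1 : γ < 1 / 2) (hf : SP f) (a x : E3) :
    fracLapScalar γ (fun x => f (x + a)) x = fracLapScalar γ f (x + a) := by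
  rw [fracLapScalar_eq h0 h1 hf, fracLapScalar_eq h0 h1 (hf.translate a)]
  congr 2 with s
  congr 2
  simp only [heat, avg]
  congr 1 with z
  congr 2
  abel

/-- The fractional Laplacian commutes with averages over translates. -/
theorem fracLapScalar_avg (h0 : 0 < γ) (h1 : γ < 1 / 2) (hf : SP f) {k : E3 → ℝ}
    (hk : Integrable k) (c : ℝ) (x : E3) :
    fracLapScalar γ (avg k c f) x = avg k c (fracLapScalar γ f) x := by
  rw [fracLapScalar_eq h0 h1 (hf.avg hk c)]
  simp only [avg, smul_eq_mul]
  have e1 : ∀ s, (∫ y, k y * f (x + c • y)) - heat s (fun x => ∫ y, k y * f (x + c • y)) x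
      = ∫ y, k y * (f (x + c • y) - heat s f (x + c • y)) := fun s => by
    have h2 := heat_avg_comm hf hk c s x
    simp only [avg, smul_eq_mul] at h2
    have h3 : avg k c f = fun x => ∫ y, k y * f (x + c • y) := rfl
    rw [h3] at h2
    rw [h2, ← integral_sub (hf.integrable_avg hk c x) ((hf.heat s).integrable_avg hk c x)]
    congr 1 with y
    ring
  obtain ⟨K, hK0, hK⟩ := hf.bounded
  obtain ⟨L, hL0, hL⟩ := hf.lipschitz
  have hB : Integrable (Function.uncurry fun (s : ℝ) (y : E3) =>
      k y * ((f (x + c • y) - heat s f (x + c • y)) * s ^ (-1 - γ)))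
      ((volume.restrict (Ioi 0)).prod volume) := by
    have hb := ((integrableOn_min_weight h0 h1 one_pos).1.const_mul
      ((gaussMom + 2) * (K + L))).mul_prod hk.norm
    refine hb.mono' ?_ ?_
    · have m1 : Continuous fun p : ℝ × E3 => heat p.1 f (x + c • p.2) :=
        (continuous_heat hf).comp (f := fun p : ℝ × E3 => (p.1, x + c • p.2)) (by fun_prop)
      have m2 : Continuous fun p : ℝ × E3 => f (x + c • p.2) :=
        hf.continuous.comp (f := fun p : ℝ × E3 => x + c • p.2) (by fun_prop)
      have m3 : Measurable fun p : ℝ × E3 => p.1 ^ (-1 - γ) := by fun_prop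
      exact hk.aestronglyMeasurable.comp_snd.mul
        (((m2.sub m1).measurable.mul m3).aestronglyMeasurable)
    · have hmem : ∀ᵐ p : ℝ × E3 ∂((volume.restrict (Ioi (0 : ℝ))).prod volume), p.1 ∈ Ioi (0 : ℝ) :=
        Measure.quasiMeasurePreserving_fst.ae (ae_restrict_mem measurableSet_Ioi)
      refine hmem.mono fun p hp => ?_
      have hs0 : (0 : ℝ) < p.1 := hp
      simp only [Function.uncurry]
      rw [norm_mul, norm_mul, Real.norm_of_nonneg (Real.rpow_nonneg hs0.le _), mul_comm]
      refine mul_le_mul_of_nonneg_right ?_ (norm_nonneg _)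
      rw [← mul_assoc]
      refine mul_le_mul_of_nonneg_right ?_ (Real.rpow_nonneg hs0.le _)
      refine abs_sub_heat_le_min hf one_pos (fun y => (hK y).trans (by linarith))
        (fun y z => ?_) hs0 _
      refine (hL y z).trans (mul_le_mul_of_nonneg_right ?_ (norm_nonneg _))
      linarith
  have e2 : (∫ s in Ioi (0 : ℝ), ((∫ y, k y * f (x + c • y))
      - heat s (fun x => ∫ y, k y * f (x + c • y)) x) * s ^ (-1 - γ))
      = ∫ y, ∫ s in Ioi (0 : ℝ), k y * ((f (x + c • y) - heat s f (x + c • y)) * s ^ (-1 - γ)) := by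
    rw [← integral_integral_swap hB]
    congr 1 with s
    rw [e1, ← integral_mul_const]
    congr 1 with y
    ring
  have e3 : (fun x => ∫ y, k y * f (x + c • y)) = avg k c f := rfl
  rw [← e3, e2, ← integral_const_mul]
  congr 1 with y
  rw [fracLapScalar_eq h0 h1 hf, integral_const_mul]
  ring

/-- The fractional Laplacian of a smooth function is differentiable: the first order Taylor
remainder of `f` with increment `h`, as a function of the base point, is of size `‖h‖²` together
with its gradient, and so is its fractional Laplacian. -/
theorem hasFDerivAt_fracLapScalar (h0 : 0 < γ) (h1 : γ < 1 / 2) (hf : SP f) (x : E3) :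
    HasFDerivAt (fracLapScalar γ f)
      (∑ i, fracLapScalar γ (D i f) x • (EuclideanSpace.proj i : E3 →L[ℝ] ℝ)) x := by
  have hfd : ∀ (g : E3 → ℝ) (y h : E3), fderiv ℝ g y h = ∑ i, h i * D i g y := fun g y h => by
    have : h = ∑ i, h i • e i := by
      ext j
      fin_cases j <;> simp [e, Fin.sum_univ_three]
    conv_lhs => rw [this]
    simp [D, map_sum]
  -- the remainder of the first order Taylor expansion, as a function of the base point
  let g : E3 → E3 → ℝ := fun h y => f (y + h) - f y - ∑ i, h i * D i f y
  have hg : ∀ h, SP (g h) := fun h =>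
    ((hf.translate h).sub hf).sub (SP.sum _ fun i _ => (hf.D i).const_mul (h i))
  have hTaylor : ∀ {f : E3 → ℝ}, SP f → ∃ A, 0 ≤ A ∧ ∀ h y,
      |f (y + h) - f y - ∑ i, h i * D i f y| ≤ A * ‖h‖ ^ 2 := by
    intro f hf
    obtain ⟨A, hA0, hA⟩ := (hf.stp 0 1).taylor one_pos
    refine ⟨A, hA0, fun h y => ?_⟩
    have h2 := hA (0, y) (mem_slab.2 (by simp)) (0, y + h) (mem_slab.2 (by simp))
    have h3 : ((0 : ℝ), y + h) - (0, y) = (0, h) := by simp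
    rw [h3, ← (hf.stp 0 1).fderiv_apply (by simp) y h, hfd] at h2
    simpa using h2
  obtain ⟨A, hA0, hA⟩ := hTaylor hf
  choose B hB0 hB using fun i => hTaylor (hf.D i)
  -- the remainder and its gradient are quadratically small
  have hDg : ∀ h i y, D i (g h) y = D i f (y + h) - D i f y - ∑ j, h j * D j (D i f) y := by
    intro h i y
    have t1 : D i (fun y => f (y + h)) = fun y => D i f (y + h) := by
      ext y
      simp only [D]
      rw [fderiv_comp_add_right]
    simp only [g]
    rw [D_sub ((hf.translate h).sub hf) (SP.sum _ fun i _ => (hf.D i).const_mul (h i)),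
      D_sub (hf.translate h) hf, t1, D_sum _ fun j _ => (hf.D j).const_mul (h j)]
    simp only [D_const_mul _ (hf.D _)]
    congr 1
    exact Finset.sum_congr rfl fun j _ => by rw [D_comm hf]
  let C : ℝ := A + ∑ i, B i
  have hC0 : 0 ≤ C := add_nonneg hA0 (Finset.sum_nonneg fun i _ => hB0 i)
  have hbound : ∀ h, |fracLapScalar γ (g h) x| ≤ fracConst γ * C * ‖h‖ ^ 2 := by
    intro h
    have hLip : ∀ y z, |g h y - g h z| ≤ C * ‖h‖ ^ 2 / 1 * ‖y - z‖ := by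
      intro y z
      have := Convex.norm_image_sub_le_of_norm_fderiv_le (𝕜 := ℝ) (f := g h) (s := univ)
        (C := C * ‖h‖ ^ 2 / 1) (x := z) (y := y) (fun w _ => (hg h).differentiable w)
        (fun w _ => ?_) convex_univ (mem_univ _) (mem_univ _)
      · simpa using this
      · refine ContinuousLinearMap.opNorm_le_bound _ (by positivity) fun u => ?_
        rw [hfd, div_one]
        refine (Finset.abs_sum_le_sum_abs _ _).trans ?_
        have : ∀ i ∈ Finset.univ, |u i * D i (g h) w| ≤ B i * ‖h‖ ^ 2 * ‖u‖ := fun i _ => by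
          rw [abs_mul, mul_comm, hDg]
          exact mul_le_mul (hB i h w) (abs_coord_le u i) (abs_nonneg _) (by
            have := hB0 i; positivity)
        refine (Finset.sum_le_sum this).trans ?_
        rw [← Finset.sum_mul, ← Finset.sum_mul]
        gcongr
        simp only [C]
        linarith
    have := abs_fracLapScalar_le h0 h1 (hg h) one_pos (K := C * ‖h‖ ^ 2) (fun y => ?_) hLip x
    · simpa [mul_assoc] using this
    · refine (hA h y).trans ?_
      gcongr
      simp only [C]
      linarith [Finset.sum_nonneg fun i (_ : i ∈ Finset.univ) => hB0 i]
  have hexp : ∀ h, fracLapScalar γ (g h) x = fracLapScalar γ f (x + h) - fracLapScalar γ f x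
      - ∑ i, h i * fracLapScalar γ (D i f) x := by
    intro h
    simp only [g]
    rw [fracLapScalar_sub h0 h1 ((hf.translate h).sub hf)
      (SP.sum _ fun i _ => (hf.D i).const_mul (h i)), fracLapScalar_sub h0 h1 (hf.translate h) hf,
      fracLapScalar_translate h0 h1 hf,
      fracLapScalar_sum h0 h1 _ fun i _ => (hf.D i).const_mul (h i)]
    congr 1
    exact Finset.sum_congr rfl fun i _ => fracLapScalar_const_mul h0 h1 _ (hf.D i) x
  rw [hasFDerivAt_iff_isLittleO_nhds_zero]
  have hO : (fun h : E3 => fracLapScalar γ f (x + h) - fracLapScalar γ f x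
      - (∑ i, fracLapScalar γ (D i f) x • (EuclideanSpace.proj i : E3 →L[ℝ] ℝ)) h)
      =O[nhds 0] fun h => ‖h‖ ^ 2 := by
    refine Asymptotics.IsBigO.of_bound (fracConst γ * C) (Filter.Eventually.of_forall fun h => ?_)
    have := hbound h
    rw [hexp] at this
    rw [Real.norm_eq_abs, Real.norm_of_nonneg (sq_nonneg ‖h‖)]
    simp only [sum_apply, smul_apply, smul_eq_mul]
    convert this using 3
    exact Finset.sum_congr rfl fun i _ => by simp [mul_comm]
  exact hO.trans_isLittleO (Asymptotics.isLittleO_norm_pow_id one_lt_two)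

theorem D_fracLapScalar (h0 : 0 < γ) (h1 : γ < 1 / 2) (hf : SP f) (i : Fin 3) :
    D i (fracLapScalar γ f) = fracLapScalar γ (D i f) := by
  ext x
  rw [D, (hasFDerivAt_fracLapScalar h0 h1 hf x).fderiv]
  simp only [sum_apply, smul_apply, smul_eq_mul]
  rw [Finset.sum_eq_single i] <;> simp +contextual [e]

theorem contDiff_fracLapScalar_nat (h0 : 0 < γ) (h1 : γ < 1 / 2) (n : ℕ) :
    ∀ {f : E3 → ℝ}, SP f → ContDiff ℝ n (fracLapScalar γ f) := by
  induction n with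
  | zero =>
    intro f hf
    rw [Nat.cast_zero, contDiff_zero]
    exact continuous_iff_continuousAt.2 fun x => (hasFDerivAt_fracLapScalar h0 h1 hf x).continuousAt
  | succ n ih =>
    intro f hf
    rw [Nat.cast_succ, contDiff_succ_iff_fderiv]
    refine ⟨fun x => (hasFDerivAt_fracLapScalar h0 h1 hf x).differentiableAt,
      fun hn => absurd hn (by simp), ?_⟩
    have : fderiv ℝ (fracLapScalar γ f) = fun x =>
        ∑ i, fracLapScalar γ (D i f) x • (EuclideanSpace.proj i : E3 →L[ℝ] ℝ) :=
      funext fun x => (hasFDerivAt_fracLapScalar h0 h1 hf x).fderiv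
    rw [this]
    exact ContDiff.sum fun i _ => (ih (hf.D i)).smul contDiff_const

theorem SP.fracLapScalar (h0 : 0 < γ) (h1 : γ < 1 / 2) (hf : SP f) : SP (fracLapScalar γ f) :=
  ⟨contDiff_infty.2 fun n => contDiff_fracLapScalar_nat h0 h1 n hf, fun x i => by
    rw [← fracLapScalar_translate h0 h1 hf]
    congr 1
    exact funext fun y => hf.per y i⟩

theorem Dw_fracLapScalar (h0 : 0 < γ) (h1 : γ < 1 / 2) (hf : SP f) (θ : List (Fin 3)) :
    Dw θ (FracNS.fracLapScalar γ f) = FracNS.fracLapScalar γ (Dw θ f) := by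
  induction θ with
  | nil => rfl
  | cons i θ ih => rw [Dw, ih, D_fracLapScalar h0 h1 (hf.Dw θ)]; rfl

end

/-! ### Maximum principles for drift and fractional diffusion -/

theorem deriv_nonpos_of_le {N : ℝ → ℝ} {N' δ : ℝ} (hδ : 0 < δ)
    (hN : HasDerivWithinAt N N' (Icc 0 δ) 0) (hle : ∀ ε ∈ Ioc 0 δ, N ε ≤ N 0) : N' ≤ 0 := by
  rw [hasDerivWithinAt_iff_tendsto_slope, Icc_sdiff_left] at hN
  have : (nhdsWithin (0 : ℝ) (Ioc 0 δ)).NeBot := by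
    rw [← mem_closure_iff_nhdsWithin_neBot, closure_Ioc hδ.ne]
    exact ⟨le_rfl, hδ.le⟩
  refine le_of_tendsto hN ?_
  filter_upwards [self_mem_nhdsWithin] with ε hε
  rw [slope_def_field, sub_zero]
  exact div_nonpos_of_nonpos_of_nonneg (by linarith [hle ε hε]) hε.1.le

/-- The derivative backwards along the straight line with velocity `b` is `-(∂ₜ + b·∇) φ`. -/
theorem STP.hasDerivWithinAt_backward {t₀ t₁ : ℝ} (h : t₀ < t₁) {φ : ℝ → E3 → ℝ}
    (hφ : STP t₀ t₁ φ) {t : ℝ} (ht : t ∈ Icc t₀ t₁) (x b : E3) :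
    HasDerivWithinAt (fun ε => φ (t - ε) (x - ε • b))
      (-(FracNS.dt t₀ t₁ φ t x + fderiv ℝ (φ t) x b)) (Icc 0 (t - t₀)) 0 := by
  have h1 : HasDerivAt (fun ε : ℝ => ((t - ε, x - ε • b) : ℝ × E3)) (-1, -b) 0 := by
    refine HasDerivAt.prodMk ?_ ?_
    · simpa using (hasDerivAt_id (0 : ℝ)).const_sub t
    · simpa using ((hasDerivAt_id (0 : ℝ)).smul_const b).const_sub x
  have h2 : HasFDerivWithinAt (fun z : ℝ × E3 => φ z.1 z.2)
      (fderivWithin ℝ (fun z : ℝ × E3 => φ z.1 z.2) (slab t₀ t₁) (t, x)) (slab t₀ t₁)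
      ((fun ε : ℝ => ((t - ε, x - ε • b) : ℝ × E3)) 0) := by
    simpa using hφ.hasFDerivWithinAt ht x
  have h3 := h2.comp_hasDerivWithinAt (f := fun ε : ℝ => ((t - ε, x - ε • b) : ℝ × E3))
    (s := Icc 0 (t - t₀)) (t := slab t₀ t₁) (0 : ℝ) h1.hasDerivWithinAt
    (fun ε hε => mem_slab.2 ⟨by linarith [hε.2], by linarith [hε.1, ht.2]⟩)
  refine HasDerivWithinAt.congr_deriv h3 ?_
  rw [hφ.dt_eq h ht, hφ.fderiv_apply ht, ← map_add, ← map_neg]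
  simp

section MaxPrinciple

variable {t₀ t₁ ν γ κ A G Λ : ℝ} {φ g : ℝ → E3 → ℝ} {b : ℝ → E3 → E3}

/-- Upper bound for solutions of `∂ₜφ + b·∇φ + ν(-Δ)^γ φ = g`. The factor `exp (κ (t - t₀))` absorbs
exponential growth of the right-hand side. -/
theorem sup_bound_of_transport (h : t₀ < t₁) (h0 : 0 < γ) (h1 : γ < 1 / 2) (hν : 0 ≤ ν)
    (hφ : STP t₀ t₁ φ)
    (heq : ∀ t ∈ Icc t₀ t₁, ∀ x, dt t₀ t₁ φ t x + fderiv ℝ (φ t) x (b t x)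
      + ν * fracLapScalar γ (φ t) x = g t x)
    (hg : ∀ t ∈ Icc t₀ t₁, ∀ x, g t x ≤ G * Real.exp (κ * (t - t₀)))
    (hκ : 0 < κ) (hG : 0 ≤ G) (hA0 : 0 ≤ A) (hA : ∀ x, φ t₀ x ≤ A) :
    ∀ t ∈ Icc t₀ t₁, ∀ x, φ t x ≤ (A + 2 * G / κ) * Real.exp (κ * (t - t₀)) := by
  -- a strict inequality for the constant excludes equality at the first touching time
  suffices hK : ∀ K, A + 2 * G / κ < K → ∀ t ∈ Icc t₀ t₁, ∀ x, φ t x ≤ K * Real.exp (κ * (t - t₀)) by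
    intro t ht x
    rw [← div_le_iff₀ (Real.exp_pos _)]
    exact le_of_forall_gt_imp_ge_of_dense fun K hK' =>
      (div_le_iff₀ (Real.exp_pos _)).2 (hK K hK' t ht x)
  intro K hK
  have hGκ : 0 ≤ 2 * G / κ := by positivity
  by_contra! hcon
  obtain ⟨t', ht', x', hx'⟩ := hcon
  let Z : Set (ℝ × E3) := (Icc t₀ t₁ ×ˢ Metric.closedBall 0 2) ∩
    (fun z : ℝ × E3 => φ z.1 z.2 - K * Real.exp (κ * (z.1 - t₀))) ⁻¹' Ici 0
  have hmemZ : ∀ t ∈ Icc t₀ t₁, ∀ x, K * Real.exp (κ * (t - t₀)) ≤ φ t x → ∃ y, (t, y) ∈ Z := by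
    intro t ht x hx
    obtain ⟨d, hd, hper⟩ := exists_lattice_shift x
    refine ⟨x + d, ⟨ht, by simpa using hd⟩, ?_⟩
    simp only [mem_preimage, mem_Ici]
    rw [hper (φ t) (hφ.per t ht)]
    linarith
  have hcomp : IsCompact (Icc t₀ t₁ ×ˢ Metric.closedBall (0 : E3) 2) :=
    isCompact_Icc.prod (isCompact_closedBall _ _)
  have hZ : IsCompact Z := by
    refine hcomp.of_isClosed_subset ?_ inter_subset_left
    refine ContinuousOn.preimage_isClosed_of_isClosed ?_ hcomp.isClosed isClosed_Ici
    refine (hφ.smooth.continuousOn.mono (prod_mono le_rfl (subset_univ _))).sub ?_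
    exact Continuous.continuousOn (by fun_prop)
  obtain ⟨y', hy'⟩ := hmemZ t' ht' x' hx'.le
  -- the first time `s` at which the bound is attained, and a point where this happens
  obtain ⟨⟨s, x⟩, ⟨⟨hs, -⟩, hsx⟩, hmin⟩ := hZ.exists_isMinOn ⟨_, hy'⟩ continuous_fst.continuousOn
  have hbefore : ∀ t ∈ Ico t₀ s, ∀ x, φ t x ≤ K * Real.exp (κ * (t - t₀)) := by
    intro t ht y
    by_contra! hlt
    obtain ⟨z, hz⟩ := hmemZ t ⟨ht.1, ht.2.le.trans hs.2⟩ y hlt.le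
    exact absurd (hmin hz) (not_le.2 ht.2)
  simp only [mem_preimage, mem_Ici] at hsx
  simp only at hs
  have hs0 : t₀ < s := by
    refine lt_of_le_of_ne hs.1 fun heq0 => ?_
    subst heq0
    have := hA x
    simp at hsx
    linarith
  have hat : ∀ y, φ s y ≤ K * Real.exp (κ * (s - t₀)) := by
    intro y
    have : (nhdsWithin s (Ico t₀ s)).NeBot := by
      rw [← mem_closure_iff_nhdsWithin_neBot, closure_Ico hs0.ne]
      exact ⟨hs0.le, le_rfl⟩
    have hc1 : ContinuousWithinAt (fun t => φ t y) (Ico t₀ s) s :=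
      (hφ.hasDerivWithinAt hs y).continuousWithinAt.mono fun t ht => ⟨ht.1, ht.2.le.trans hs.2⟩
    have hc2 : ContinuousWithinAt (fun t => K * Real.exp (κ * (t - t₀))) (Ico t₀ s) s :=
      Continuous.continuousWithinAt (by fun_prop)
    refine le_of_tendsto_of_tendsto hc1 hc2 ?_
    filter_upwards [self_mem_nhdsWithin] with t ht using hbefore t ht y
  have hfrac : 0 ≤ fracLapScalar γ (φ s) x :=
    fracLapScalar_nonneg_of_max h0 h1 (hφ.slice hs) fun z => (hat z).trans (by linarith)
  have hd1 := hφ.hasDerivWithinAt_backward h hs x (b s x)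
  have hd2 : HasDerivWithinAt (fun ε => K * Real.exp (κ * (s - ε - t₀)))
      (-(κ * (K * Real.exp (κ * (s - t₀))))) (Icc 0 (s - t₀)) 0 := by
    have : HasDerivAt (fun ε : ℝ => κ * (s - ε - t₀)) (-κ) 0 := by
      simpa using (((hasDerivAt_id (0 : ℝ)).const_sub s).sub_const t₀).const_mul κ
    refine (this.exp.const_mul K).hasDerivWithinAt.congr_deriv ?_
    simp only [sub_zero]
    ring
  have hle := deriv_nonpos_of_le (sub_pos.2 hs0) (hd1.sub hd2) fun ε hε => by
    have h2 := hbefore (s - ε) ⟨by linarith [hε.2], by linarith [hε.1]⟩ (x - ε • b s x)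
    simp only [Pi.sub_apply, sub_zero, zero_smul]
    linarith
  have h3 := heq s hs x
  have h4 := hg s hs x
  have h5 : 2 * G / κ < K := by linarith
  rw [div_lt_iff₀ hκ] at h5
  have h6 := Real.exp_pos (κ * (s - t₀))
  have h7 := mul_nonneg hν hfrac
  nlinarith

/-- Propagation of the Hölder seminorm by `∂ₜφ + b·∇φ + ν(-Δ)^γ φ = g` with a Lipschitz drift. At
the first time at which `φ(x) - φ(y)` touches a multiple of `|x-y|^α`, all translates of the pair
`(x,y)` give smaller differences, so that the diffusion has a sign; going backwards along the drift
changes `|x-y|` by a factor `1 + Λ ε` at most. -/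
theorem holder_bound_of_transport {α : ℝ} (hα0 : 0 < α) (hα1 : α < 1) (h : t₀ < t₁) (h0 : 0 < γ)
    (h1 : γ < 1 / 2) (hν : 0 ≤ ν) (hφ : STP t₀ t₁ φ)
    (heq : ∀ t ∈ Icc t₀ t₁, ∀ x, dt t₀ t₁ φ t x + fderiv ℝ (φ t) x (b t x)
      + ν * fracLapScalar γ (φ t) x = g t x)
    (hb : ∀ t ∈ Icc t₀ t₁, ∀ x y, ‖b t x - b t y‖ ≤ Λ * ‖x - y‖)
    (hg : ∀ t ∈ Icc t₀ t₁, ∀ x y, g t x - g t y ≤ G * Real.exp (κ * (t - t₀)) * ‖x - y‖ ^ α)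
    (hκ : 0 < κ) (hΛ0 : 0 ≤ Λ) (hΛ : 2 * Λ ≤ κ) (hG : 0 ≤ G) (hA0 : 0 ≤ A)
    (hA : ∀ x y, φ t₀ x - φ t₀ y ≤ A * ‖x - y‖ ^ α) :
    ∀ t ∈ Icc t₀ t₁, ∀ x y,
      φ t x - φ t y ≤ (A + 2 * G / κ) * Real.exp (κ * (t - t₀)) * ‖x - y‖ ^ α := by
  suffices hK : ∀ K, A + 2 * G / κ < K → ∀ t ∈ Icc t₀ t₁, ∀ x y,
      φ t x - φ t y ≤ K * Real.exp (κ * (t - t₀)) * ‖x - y‖ ^ α by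
    intro t ht x y
    rcases eq_or_ne x y with rfl | hxy
    · simp [Real.zero_rpow hα0.ne']
    have hpos : 0 < Real.exp (κ * (t - t₀)) * ‖x - y‖ ^ α :=
      mul_pos (Real.exp_pos _) (Real.rpow_pos_of_pos (norm_pos_iff.2 (sub_ne_zero.2 hxy)) _)
    rw [mul_assoc, ← div_le_iff₀ hpos]
    refine le_of_forall_gt_imp_ge_of_dense fun K hK' => (div_le_iff₀ hpos).2 ?_
    rw [← mul_assoc]
    exact hK K hK' t ht x y
  intro K hK
  have hGκ : 0 ≤ 2 * G / κ := by positivity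
  have hKpos : 0 < K := by linarith
  by_contra! hcon
  obtain ⟨t', ht', x', y', hxy'⟩ := hcon
  let B : ℝ → ℝ := fun t => K * Real.exp (κ * (t - t₀))
  have hBK : ∀ t ∈ Icc t₀ t₁, K ≤ B t := fun t ht =>
    le_mul_of_one_le_right hKpos.le (Real.one_le_exp (mul_nonneg hκ.le (by linarith [ht.1])))
  obtain ⟨P, hP0, hP⟩ := SmoothPer.bounded hφ
  obtain ⟨L, hL0, hL⟩ := SmoothPer.lipschitz h hφ
  -- violating pairs are neither too close nor too far apart: this gives compactness and keeps away
  -- from the diagonal, where the Hölder modulus is not differentiable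
  let r : ℝ := (K / (L + 1)) ^ (1 / (1 - α))
  have hr0 : 0 < r := by positivity
  let ρ : ℝ := (2 * P / K) ^ (1 / α)
  have hρ0 : 0 ≤ ρ := by positivity
  have hfar : ∀ t ∈ Icc t₀ t₁, ∀ x y, x ≠ y → B t * ‖x - y‖ ^ α ≤ φ t x - φ t y →
      r ≤ ‖x - y‖ ∧ ‖x - y‖ ≤ ρ := by
    intro t ht x y hxy hv
    have hd : 0 < ‖x - y‖ := norm_pos_iff.2 (sub_ne_zero.2 hxy)
    have hdα : 0 < ‖x - y‖ ^ α := Real.rpow_pos_of_pos hd _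
    have hv' : K * ‖x - y‖ ^ α ≤ φ t x - φ t y :=
      (mul_le_mul_of_nonneg_right (hBK t ht) hdα.le).trans hv
    constructor
    · have h2 := hL (t, y) (mem_slab.2 ht) (t, x) (mem_slab.2 ht)
      simp only [Prod.mk_sub_mk, sub_self, Prod.norm_mk, norm_zero, norm_nonneg, sup_of_le_right]
        at h2
      have h3 : K * ‖x - y‖ ^ α ≤ (L + 1) * (‖x - y‖ ^ (1 - α) * ‖x - y‖ ^ α) := by
        rw [← Real.rpow_add hd, sub_add_cancel, Real.rpow_one]
        have := (le_abs_self _).trans h2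
        nlinarith
      rw [← mul_assoc] at h3
      have h4 : K / (L + 1) ≤ ‖x - y‖ ^ (1 - α) := by
        rw [div_le_iff₀ (by linarith), mul_comm]
        exact le_of_mul_le_mul_right h3 hdα
      have h5 := Real.rpow_le_rpow (by positivity) h4
        (by have : 0 < 1 - α := by linarith
            positivity : 0 ≤ 1 / (1 - α))
      rwa [← Real.rpow_mul hd.le, mul_one_div_cancel (by linarith), Real.rpow_one] at h5
    · have h2 := hP (t, x) (mem_slab.2 ht)
      have h3 := hP (t, y) (mem_slab.2 ht)
      rw [Real.norm_eq_abs] at h2 h3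
      have h4 : ‖x - y‖ ^ α ≤ 2 * P / K := by
        rw [le_div_iff₀ hKpos]
        linarith [(abs_le.1 h2).2, (abs_le.1 h3).1]
      have h5 := Real.rpow_le_rpow hdα.le h4 (by positivity : 0 ≤ 1 / α)
      rwa [← Real.rpow_mul hd.le, mul_one_div_cancel hα0.ne', Real.rpow_one] at h5
  let Q : Set (ℝ × E3 × E3) :=
    Icc t₀ t₁ ×ˢ Metric.closedBall (0 : E3) 2 ×ˢ Metric.closedBall (0 : E3) (2 + ρ)
  have hcomp : IsCompact Q :=
    isCompact_Icc.prod ((isCompact_closedBall _ _).prod (isCompact_closedBall _ _))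
  let Z : Set (ℝ × E3 × E3) := (Q ∩ (fun z : ℝ × E3 × E3 =>
    φ z.1 z.2.1 - φ z.1 z.2.2 - B z.1 * ‖z.2.1 - z.2.2‖ ^ α) ⁻¹' Ici 0) ∩
      {z : ℝ × E3 × E3 | r ≤ ‖z.2.1 - z.2.2‖}
  have hmemZ : ∀ t ∈ Icc t₀ t₁, ∀ x y, x ≠ y → B t * ‖x - y‖ ^ α ≤ φ t x - φ t y →
      ∃ p, (t, p) ∈ Z := by
    intro t ht x y hxy hv
    obtain ⟨d, hd, hper⟩ := exists_lattice_shift x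
    obtain ⟨h2, h3⟩ := hfar t ht x y hxy hv
    have hsub : x + d - (y + d) = x - y := by abel
    refine ⟨(x + d, y + d), ⟨⟨ht, by simpa using hd, ?_⟩, ?_⟩, ?_⟩
    · rw [mem_closedBall_zero_iff]
      have : y + d = (x + d) - (x - y) := by abel
      simp only
      rw [this]
      exact (norm_sub_le _ _).trans (add_le_add hd h3)
    · simp only [mem_preimage, mem_Ici]
      rw [hper (φ t) (hφ.per t ht), hper (φ t) (hφ.per t ht), hsub]
      linarith
    · simp only [mem_ofPred_eq]
      rwa [hsub]
  have hZ : IsCompact Z := by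
    refine hcomp.of_isClosed_subset (IsClosed.inter ?_ ?_) (inter_subset_left.trans inter_subset_left)
    · refine ContinuousOn.preimage_isClosed_of_isClosed ?_ hcomp.isClosed isClosed_Ici
      have c1 : ContinuousOn (fun z : ℝ × E3 × E3 => φ z.1 z.2.1) Q :=
        hφ.smooth.continuousOn.comp (f := fun z : ℝ × E3 × E3 => (z.1, z.2.1))
          (Continuous.continuousOn (by fun_prop)) fun z hz => mem_slab.2 hz.1
      have c2 : ContinuousOn (fun z : ℝ × E3 × E3 => φ z.1 z.2.2) Q :=
        hφ.smooth.continuousOn.comp (f := fun z : ℝ × E3 × E3 => (z.1, z.2.2))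
          (Continuous.continuousOn (by fun_prop)) fun z hz => mem_slab.2 hz.1
      refine (c1.sub c2).sub (Continuous.continuousOn ?_)
      have : Continuous fun z : ℝ × E3 × E3 => ‖z.2.1 - z.2.2‖ ^ α :=
        Continuous.rpow_const (by fun_prop) fun _ => Or.inr hα0.le
      simp only [B]
      fun_prop
    · exact isClosed_le continuous_const (by fun_prop)
  have hne' : x' ≠ y' := by
    rintro rfl
    simp [Real.zero_rpow hα0.ne'] at hxy'
  obtain ⟨p', hp'⟩ := hmemZ t' ht' x' y' hne' hxy'.le
  -- the first time `s` at which the bound is attained, and a pair of points where this happens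
  obtain ⟨⟨s, x, y⟩, ⟨⟨⟨hs, -⟩, hsx⟩, hrd⟩, hmin⟩ :=
    hZ.exists_isMinOn ⟨_, hp'⟩ continuous_fst.continuousOn
  have hbefore : ∀ t ∈ Ico t₀ s, ∀ x y, φ t x - φ t y ≤ B t * ‖x - y‖ ^ α := by
    intro t ht x y
    rcases eq_or_ne x y with rfl | hxy
    · simp [Real.zero_rpow hα0.ne']
    by_contra! hlt
    obtain ⟨z, hz⟩ := hmemZ t ⟨ht.1, ht.2.le.trans hs.2⟩ x y hxy hlt.le
    exact absurd (hmin hz) (not_le.2 ht.2)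
  simp only [mem_preimage, mem_Ici] at hsx
  simp only [mem_ofPred_eq] at hrd
  simp only at hs
  have hd0 : 0 < ‖x - y‖ := hr0.trans_le hrd
  have hdα : 0 < ‖x - y‖ ^ α := Real.rpow_pos_of_pos hd0 _
  have hs0 : t₀ < s := by
    refine lt_of_le_of_ne hs.1 fun heq0 => ?_
    subst heq0
    have h2 := hA x y
    simp only [B, sub_self, mul_zero, Real.exp_zero, mul_one] at hsx
    nlinarith
  have hat : ∀ x y, φ s x - φ s y ≤ B s * ‖x - y‖ ^ α := by
    intro x y
    have : (nhdsWithin s (Ico t₀ s)).NeBot := by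
      rw [← mem_closure_iff_nhdsWithin_neBot, closure_Ico hs0.ne]
      exact ⟨hs0.le, le_rfl⟩
    have hsub : Ico t₀ s ⊆ Icc t₀ t₁ := fun t ht => ⟨ht.1, ht.2.le.trans hs.2⟩
    have hc1 : ∀ y, ContinuousWithinAt (fun t => φ t y) (Ico t₀ s) s := fun y =>
      (hφ.hasDerivWithinAt hs y).continuousWithinAt.mono hsub
    have hc2 : ContinuousWithinAt (fun t => B t * ‖x - y‖ ^ α) (Ico t₀ s) s :=
      Continuous.continuousWithinAt (by simp only [B]; fun_prop)
    refine le_of_tendsto_of_tendsto ((hc1 x).sub (hc1 y)) hc2 ?_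
    filter_upwards [self_mem_nhdsWithin] with t ht using hbefore t ht x y
  have hfrac : fracLapScalar γ (φ s) y ≤ fracLapScalar γ (φ s) x := by
    refine fracLapScalar_le_of_touching h0 h1 (hφ.slice hs) fun z => ?_
    have h2 := hat (x + z) (y + z)
    rw [show x + z - (y + z) = x - y by abel] at h2
    linarith
  have hd1 := (hφ.hasDerivWithinAt_backward h hs x (b s x)).sub
    (hφ.hasDerivWithinAt_backward h hs y (b s y))
  have hd2 : HasDerivWithinAt (fun ε => B (s - ε) * ‖x - y‖ ^ α * (1 + ε * Λ))
      (-(κ * B s) * ‖x - y‖ ^ α + B s * ‖x - y‖ ^ α * Λ) (Icc 0 (s - t₀)) 0 := by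
    have e1 : HasDerivAt (fun ε : ℝ => κ * (s - ε - t₀)) (-κ) 0 := by
      simpa using (((hasDerivAt_id (0 : ℝ)).const_sub s).sub_const t₀).const_mul κ
    have e2 : HasDerivAt (fun ε : ℝ => 1 + ε * Λ) Λ 0 := by
      simpa using ((hasDerivAt_id (0 : ℝ)).mul_const Λ).const_add 1
    refine (((e1.exp.const_mul K).mul_const (‖x - y‖ ^ α)).mul e2).hasDerivWithinAt.congr_deriv ?_
    simp only [B, sub_zero, zero_mul, add_zero]
    ring
  have hle := deriv_nonpos_of_le (sub_pos.2 hs0) (hd1.sub hd2) fun ε hε => by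
    have h2 := hbefore (s - ε) ⟨by linarith [hε.2], by linarith [hε.1]⟩
      (x - ε • b s x) (y - ε • b s y)
    have h3 : ‖x - ε • b s x - (y - ε • b s y)‖ ≤ ‖x - y‖ * (1 + ε * Λ) := by
      rw [show x - ε • b s x - (y - ε • b s y) = (x - y) - ε • (b s x - b s y) by
        rw [smul_sub]; abel]
      refine (norm_sub_le _ _).trans ?_
      rw [norm_smul, Real.norm_of_nonneg hε.1.le]
      have := mul_le_mul_of_nonneg_left (hb s hs x y) hε.1.le
      linarith
    have h4 : ‖x - ε • b s x - (y - ε • b s y)‖ ^ α ≤ ‖x - y‖ ^ α * (1 + ε * Λ) := by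
      have hΛε : 1 ≤ 1 + ε * Λ := by nlinarith [mul_nonneg hε.1.le hΛ0]
      refine (Real.rpow_le_rpow (norm_nonneg _) h3 hα0.le).trans ?_
      rw [Real.mul_rpow hd0.le (by linarith)]
      refine mul_le_mul_of_nonneg_left ?_ hdα.le
      exact (Real.rpow_le_rpow_of_exponent_le hΛε hα1.le).trans_eq (Real.rpow_one _)
    have hB0 : 0 ≤ B (s - ε) := mul_nonneg hKpos.le (Real.exp_pos _).le
    have h5 := h2.trans (mul_le_mul_of_nonneg_left h4 hB0)
    simp only [Pi.sub_apply, sub_zero, zero_smul, zero_mul, add_zero, mul_one]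
    linarith
  have h3 := heq s hs x
  have h4 := heq s hs y
  have h5 := hg s hs x y
  have h6 : 2 * G / κ < K := by linarith
  rw [div_lt_iff₀ hκ] at h6
  have h7 := Real.exp_pos (κ * (s - t₀))
  have h8 := mul_le_mul_of_nonneg_left hfrac hν
  have hBpos : 0 < B s := mul_pos hKpos h7
  have h9 : (κ - Λ) * B s * ‖x - y‖ ^ α ≤ G * Real.exp (κ * (s - t₀)) * ‖x - y‖ ^ α := by
    nlinarith
  have h10 : (κ - Λ) * B s ≤ G * Real.exp (κ * (s - t₀)) := le_of_mul_le_mul_right h9 hdα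
  have h11 : (κ - Λ) * K ≤ G := by
    simp only [B, ← mul_assoc] at h10
    exact le_of_mul_le_mul_right h10 h7
  nlinarith

end MaxPrinciple

/-! ### Hölder bounds -/

/-- `f` is bounded by `K` in the Hölder space `C^α`: both the supremum and the `α`-Hölder seminorm
are at most `K`. -/
structure HB (α K : ℝ) (f : E3 → ℝ) : Prop where
  sup : ∀ x, |f x| ≤ K
  hol : ∀ x y, |f x - f y| ≤ K * ‖x - y‖ ^ α

namespace HB

variable {α K K' : ℝ} {f g : E3 → ℝ}

theorem nonneg (hf : HB α K f) : 0 ≤ K := (abs_nonneg _).trans (hf.sup 0)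

theorem mono (hf : HB α K f) (h : K ≤ K') : HB α K' f :=
  ⟨fun x => (hf.sup x).trans h, fun x y => (hf.hol x y).trans (by gcongr)⟩

theorem zero (hK : 0 ≤ K) : HB α K fun _ => 0 :=
  ⟨fun _ => by simpa, fun x y => by simp; positivity⟩

theorem neg (hf : HB α K f) : HB α K fun x => -f x :=
  ⟨fun x => by simpa using hf.sup x, fun x y => by
    rw [show -f x - -f y = -(f x - f y) by ring, abs_neg]; exact hf.hol x y⟩

theorem add (hf : HB α K f) (hg : HB α K' g) : HB α (K + K') fun x => f x + g x :=
  ⟨fun x => (abs_add_le _ _).trans (add_le_add (hf.sup x) (hg.sup x)), fun x y => by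
    rw [show f x + g x - (f y + g y) = (f x - f y) + (g x - g y) by ring, add_mul]
    exact (abs_add_le _ _).trans (add_le_add (hf.hol x y) (hg.hol x y))⟩

theorem sub (hf : HB α K f) (hg : HB α K' g) : HB α (K + K') fun x => f x - g x := by
  simpa only [sub_eq_add_neg] using hf.add hg.neg

theorem const_mul (c : ℝ) (hf : HB α K f) : HB α (|c| * K) fun x => c * f x :=
  ⟨fun x => by rw [abs_mul]; exact mul_le_mul_of_nonneg_left (hf.sup x) (abs_nonneg _),
    fun x y => by
      rw [← mul_sub, abs_mul, mul_assoc]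
      exact mul_le_mul_of_nonneg_left (hf.hol x y) (abs_nonneg _)⟩

theorem mul (hf : HB α K f) (hg : HB α K' g) : HB α (2 * (K * K')) fun x => f x * g x := by
  have h1 := hf.nonneg
  have h2 := hg.nonneg
  refine ⟨fun x => ?_, fun x y => ?_⟩
  · rw [abs_mul]
    have := mul_le_mul (hf.sup x) (hg.sup x) (abs_nonneg _) h1
    nlinarith [mul_nonneg h1 h2]
  · rw [show f x * g x - f y * g y = f x * (g x - g y) + (f x - f y) * g y by ring]
    refine (abs_add_le _ _).trans ?_
    rw [abs_mul, abs_mul]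
    have h3 := mul_le_mul (hf.sup x) (hg.hol x y) (abs_nonneg _) h1
    have h4 := mul_le_mul (hf.hol x y) (hg.sup y) (abs_nonneg _) (by positivity)
    calc _ ≤ K * (K' * ‖x - y‖ ^ α) + K * ‖x - y‖ ^ α * K' := add_le_add h3 h4
      _ = _ := by ring

theorem sum {ι : Type*} (s : Finset ι) {f : ι → E3 → ℝ} {K : ι → ℝ}
    (hf : ∀ i ∈ s, HB α (K i) (f i)) : HB α (∑ i ∈ s, K i) fun x => ∑ i ∈ s, f i x := by
  classical
  induction s using Finset.induction_on with
  | empty => simpa using zero le_rfl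
  | insert a s ha ih =>
    simp only [Finset.sum_insert ha]
    exact (hf a (Finset.mem_insert_self _ _)).add
      (ih fun i hi => hf i (Finset.mem_insert_of_mem hi))

/-- A sum over the three coordinates. -/
theorem sum3 {f : Fin 3 → E3 → ℝ} (hf : ∀ i, HB α K (f i)) :
    HB α (3 * K) fun x => ∑ i, f i x := by
  have := sum Finset.univ (K := fun _ => K) fun i _ => hf i
  simpa using this

end HB

/-- A bound for the partial derivatives is a Lipschitz bound. -/
theorem SP.lipschitz_of_D {f : E3 → ℝ} (hf : SP f) {B : ℝ} (hB : ∀ i x, |FracNS.D i f x| ≤ B) (x y : E3) :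
    |f x - f y| ≤ 3 * B * ‖x - y‖ := by
  have hB0 : 0 ≤ B := (abs_nonneg _).trans (hB 0 0)
  have hfd : ∀ y h, fderiv ℝ f y h = ∑ i, h i * FracNS.D i f y := fun y h => by
    have : h = ∑ i, h i • e i := by
      ext j
      fin_cases j <;> simp [e, Fin.sum_univ_three]
    conv_lhs => rw [this]
    simp [FracNS.D, map_sum]
  have := Convex.norm_image_sub_le_of_norm_fderiv_le (𝕜 := ℝ) (f := f) (s := univ)
    (C := 3 * B) (x := y) (y := x) (fun w _ => hf.differentiable w)
    (fun w _ => ?_) convex_univ (mem_univ _) (mem_univ _)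
  · simpa using this
  · refine ContinuousLinearMap.opNorm_le_bound _ (by positivity) fun u => ?_
    rw [hfd]
    refine (Finset.abs_sum_le_sum_abs _ _).trans ?_
    have : ∀ i ∈ Finset.univ, |u i * FracNS.D i f w| ≤ B * ‖u‖ := fun i _ => by
      rw [abs_mul, mul_comm]
      exact mul_le_mul (hB i w) (abs_coord_le u i) (abs_nonneg _) hB0
    refine (Finset.sum_le_sum this).trans ?_
    simp
    linarith

/-- Interpolation between the supremum norm and the Lipschitz norm at the length scale `r`. -/
theorem SP.hb_of_D {f : E3 → ℝ} (hf : SP f) {A r α : ℝ} (hα0 : 0 ≤ α) (hα1 : α ≤ 1) (hr : 0 < r)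
    (hr1 : r ≤ 1) (hA : ∀ x, |f x| ≤ A) (hB : ∀ i x, |FracNS.D i f x| ≤ A / r) :
    HB α (3 * A * r ^ (-α)) f := by
  have hA0 : 0 ≤ A := (abs_nonneg _).trans (hA 0)
  have hrα : 1 ≤ r ^ (-α) := Real.one_le_rpow_of_pos_of_le_one_of_nonpos hr hr1 (by linarith)
  refine ⟨fun x => ?_, fun x y => ?_⟩
  · have := hA x
    nlinarith [mul_nonneg hA0 (sub_nonneg.2 hrα)]
  · have hL := hf.lipschitz_of_D hB x y
    have e1 : 3 * A * r ^ (-α) * ‖x - y‖ ^ α = 3 * A * (‖x - y‖ / r) ^ α := by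
      rw [Real.div_rpow (norm_nonneg _) hr.le, Real.rpow_neg hr.le]
      ring
    rw [e1]
    have hq : 0 ≤ ‖x - y‖ / r := by positivity
    rcases le_total (‖x - y‖ / r) 1 with h | h
    · have h2 : ‖x - y‖ / r ≤ (‖x - y‖ / r) ^ α := by
        rcases hq.eq_or_lt with h0 | h0
        · rw [← h0]; positivity
        · have := Real.rpow_le_rpow_of_exponent_ge h0 h hα1
          rwa [Real.rpow_one] at this
      calc _ ≤ 3 * (A / r) * ‖x - y‖ := hL
        _ = 3 * A * (‖x - y‖ / r) := by ring
        _ ≤ _ := by gcongr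
    · have h2 : 1 ≤ (‖x - y‖ / r) ^ α := Real.one_le_rpow h hα0
      have h3 := abs_sub (f x) (f y)
      nlinarith [hA x, hA y, mul_nonneg hA0 (sub_nonneg.2 h2)]

/-! ### Schauder estimate for the Laplacian -/

/-- Each further derivative costs a factor `s^{-1/2}`: half of the time is used for the smoothing. -/
theorem abs_heat_D_le_of_heat {g : E3 → ℝ} (hg : SP g) {A m : ℝ} (hm : m + 1 / 2 ≤ 2)
    (hA : ∀ s, 0 < s → ∀ x, |heat s g x| ≤ A * s ^ (-m)) (l : Fin 3) {s : ℝ} (hs : 0 < s) (x : E3) :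
    |heat s (D l g) x| ≤ (8 * gaussMom * A) * s ^ (-(m + 1 / 2)) := by
  have hs2 : 0 < s / 2 := by linarith
  have hA0 : 0 ≤ A := by
    have := (abs_nonneg _).trans (hA 1 one_pos 0)
    simpa using this
  have e1 : heat s (D l g) x = heat (s / 2) (D l (heat (s / 2) g)) x := by
    rw [D_heat hg, heat_heat (hg.D l) hs2.le hs2.le, add_halves]
  have h1 := abs_heat_D_le (hg.heat (s / 2)) hs2 (α := 0) (K := 2 * (A * (s / 2) ^ (-m))) le_rfl
    zero_le_one (by positivity) (fun x y => by
      rw [Real.rpow_zero, mul_one]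
      have := abs_sub (heat (s / 2) g x) (heat (s / 2) g y)
      linarith [hA _ hs2 x, hA _ hs2 y]) l x
  rw [e1]
  refine h1.trans ?_
  have e2 : (s / 2) ^ (-m) * (s / 2) ^ (-(1 / 2) + 0 / 2 : ℝ)
      = s ^ (-(m + 1 / 2)) * 2 ^ (m + 1 / 2) := by
    rw [← Real.rpow_add hs2, show -m + (-(1 / 2) + 0 / 2) = -(m + 1 / 2) by ring,
      Real.div_rpow hs.le zero_le_two, Real.rpow_neg zero_le_two, div_inv_eq_mul]
  have e3 : (2 : ℝ) ^ (m + 1 / 2) ≤ 4 := by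
    have := Real.rpow_le_rpow_of_exponent_le one_le_two hm
    refine this.trans ?_
    norm_num
  have := gaussMom_pos
  calc gaussMom * (2 * (A * (s / 2) ^ (-m))) * (s / 2) ^ (-(1 / 2) + 0 / 2 : ℝ)
      = 2 * gaussMom * A * ((s / 2) ^ (-m) * (s / 2) ^ (-(1 / 2) + 0 / 2 : ℝ)) := by ring
    _ = 2 * gaussMom * A * s ^ (-(m + 1 / 2)) * 2 ^ (m + 1 / 2) := by rw [e2]; ring
    _ ≤ 2 * gaussMom * A * s ^ (-(m + 1 / 2)) * 4 := by gcongr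
    _ = _ := by ring

theorem abs_heat_D_D_le {f : E3 → ℝ} (hf : SP f) {α K : ℝ} (hα0 : 0 ≤ α) (hα1 : α ≤ 1)
    (hK : HB α K f) (i j : Fin 3) {s : ℝ} (hs : 0 < s) (x : E3) :
    |heat s (D j (D i f)) x| ≤ (8 * gaussMom ^ 2 * K) * s ^ (-1 + α / 2) := by
  have := abs_heat_D_le_of_heat (hf.D i) (A := gaussMom * K) (m := 1 / 2 - α / 2) (by linarith)
    (fun s hs x => by
      have := abs_heat_D_le hf hs hα0 hα1 hK.nonneg hK.hol i x
      rwa [show -(1 / 2 - α / 2) = -(1 / 2) + α / 2 by ring]) j hs x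
  rw [show -(1 / 2 - α / 2 + 1 / 2) = -1 + α / 2 by ring] at this
  calc _ ≤ _ := this
    _ = _ := by ring

theorem abs_heat_D_D_D_le {f : E3 → ℝ} (hf : SP f) {α K : ℝ} (hα0 : 0 ≤ α) (hα1 : α ≤ 1)
    (hK : HB α K f) (i j l : Fin 3) {s : ℝ} (hs : 0 < s) (x : E3) :
    |heat s (D l (D j (D i f))) x| ≤ (64 * gaussMom ^ 3 * K) * s ^ (-(3 / 2) + α / 2) := by
  have := abs_heat_D_le_of_heat ((hf.D i).D j) (A := 8 * gaussMom ^ 2 * K) (m := 1 - α / 2)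
    (by linarith)
    (fun s hs x => by
      have := abs_heat_D_D_le hf hα0 hα1 hK i j hs x
      rwa [show -(1 - α / 2) = -1 + α / 2 by ring]) l hs x
  rw [show -(1 - α / 2 + 1 / 2) = -(3 / 2) + α / 2 by ring] at this
  calc _ ≤ _ := this
    _ = _ := by ring

/-- The heat equation in integrated form. -/
theorem sub_heat_one_eq {h : E3 → ℝ} (hh : SP h) (x : E3) :
    h x - heat 1 h x = -∫ s in Ioc (0 : ℝ) 1, heat s (lap h) x := by
  let F : (Fin 3 → ℤ) → ℝ → ℂ := fun k s =>
    (fourierCoef h k * character k x) * ((mu k * Real.exp (-(s * mu k)) : ℝ) : ℂ)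
  have hcont : ∀ k, Continuous fun s => mu k * Real.exp (-(s * mu k)) := fun k => by fun_prop
  have hInt : ∀ k, ∫ s in Ioc (0 : ℝ) 1, mu k * Real.exp (-(s * mu k)) = 1 - Real.exp (-mu k) := by
    intro k
    rw [← intervalIntegral.integral_of_le zero_le_one]
    rw [intervalIntegral.integral_eq_sub_of_hasDerivAt (f := fun s => -Real.exp (-(s * mu k)))]
    · simp; ring
    · intro s _
      have : HasDerivAt (fun s : ℝ => -(s * mu k)) (-mu k) s := by
        exact ((hasDerivAt_id s).mul_const (mu k)).neg.congr_deriv (by simp)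
      refine this.exp.neg.congr_deriv (by ring)
    · exact (hcont k).intervalIntegrable _ _
  have hint : ∀ k, Integrable (F k) (volume.restrict (Ioc 0 1)) := fun k => by
    have : IntegrableOn (fun s => mu k * Real.exp (-(s * mu k))) (Ioc (0 : ℝ) 1) :=
      ((hcont k).integrableOn_Icc (a := 0) (b := 1)).mono_set Ioc_subset_Icc_self
    exact (this.ofReal (𝕜 := ℂ)).const_mul _
  have hnorm : ∀ k, ∫ s in Ioc (0 : ℝ) 1, ‖F k s‖ = ‖fourierCoef h k‖ * (1 - Real.exp (-mu k)) := by
    intro k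
    rw [← hInt, ← integral_const_mul]
    refine integral_congr_ae (Filter.Eventually.of_forall fun s => ?_)
    simp only [F, norm_mul, norm_character, mul_one, Complex.norm_real]
    rw [Real.norm_of_nonneg (mu_nonneg k), Real.norm_of_nonneg (Real.exp_pos _).le]
  have hsum : Summable fun k => ∫ s in Ioc (0 : ℝ) 1, ‖F k s‖ := by
    simp only [hnorm]
    refine Summable.of_nonneg_of_le (fun k => ?_) (fun k => ?_) hh.summable_norm_fourierCoef
    · have := Real.exp_le_one_iff.2 (neg_nonpos.2 (mu_nonneg k))
      exact mul_nonneg (norm_nonneg _) (by linarith)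
    · exact mul_le_of_le_one_right (norm_nonneg _) (by linarith [Real.exp_pos (-mu k)])
  have key := hasSum_integral_of_summable_integral_norm hint hsum
  have e1 : ∀ s ∈ Ioc (0 : ℝ) 1, ∑' k, F k s = ((-heat s (lap h) x : ℝ) : ℂ) := by
    intro s hs
    have h2 := (hh.lap.hasSum_heat hs.1.le x).neg
    push_cast
    rw [← h2.tsum_eq]
    refine tsum_congr fun k => ?_
    simp only [F]
    rw [fourierCoef_lap hh]
    push_cast
    ring
  have e2 : ∀ k, ∫ s in Ioc (0 : ℝ) 1, F k s
      = fourierCoef h k * character k x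
        - (fourierCoef h k * Real.exp (-(1 * mu k))) * character k x := by
    intro k
    simp only [F]
    rw [integral_const_mul, integral_complex_ofReal, hInt]
    push_cast
    ring_nf
  rw [setIntegral_congr_fun measurableSet_Ioc e1, integral_complex_ofReal] at key
  simp only [e2] at key
  have h3 := key.unique ((hh.hasSum_fourier x).sub (hh.hasSum_heat zero_le_one x))
  rw [← Complex.ofReal_sub] at h3
  have h4 := Complex.ofReal_injective h3
  rw [← h4, integral_neg]

/-- The constant in the estimate for the low frequency part `heat 1 h`, which needs only a bound for
the Fourier coefficients of `h`. -/
def lowConst : ℝ := ∑' k : Fin 3 → ℤ, 27 * ((1 + mu k) ^ 2)⁻¹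

theorem lowConst_nonneg : 0 ≤ lowConst :=
  tsum_nonneg fun k => by have := mu_nonneg k; positivity

theorem exp_neg_mu_le (k : Fin 3 → ℤ) :
    (1 + mu k) * Real.exp (-mu k) ≤ 27 * ((1 + mu k) ^ 2)⁻¹ := by
  have hm := mu_nonneg k
  have h1 : (1 + mu k) ^ 3 ≤ 27 * Real.exp (mu k) := by
    have h2 := Real.add_one_le_exp (mu k / 3)
    have h3 : Real.exp (mu k) = Real.exp (mu k / 3) ^ 3 := by
      rw [← Real.exp_nat_mul]; congr 1; push_cast; ring
    have h4 : (mu k / 3 + 1) ^ 3 ≤ Real.exp (mu k / 3) ^ 3 := pow_le_pow_left₀ (by positivity) h2 3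
    have h5 : (1 + mu k) ^ 3 ≤ (3 * (mu k / 3 + 1)) ^ 3 :=
      pow_le_pow_left₀ (by positivity) (by linarith) 3
    rw [h3]
    calc _ ≤ _ := h5
      _ = 27 * (mu k / 3 + 1) ^ 3 := by ring
      _ ≤ _ := by linarith
  rw [Real.exp_neg, ← div_eq_mul_inv, ← div_eq_mul_inv, div_le_div_iff₀ (Real.exp_pos _)
    (by positivity)]
  calc _ = (1 + mu k) ^ 3 := by ring
    _ ≤ _ := h1

theorem abs_heat_one_le {h : E3 → ℝ} (hh : SP h) {K : ℝ}
    (hK : ∀ k, ‖fourierCoef h k‖ ≤ K * (1 + mu k)) (x : E3) : |heat 1 h x| ≤ K * lowConst := by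
  have h1 := hh.hasSum_heat zero_le_one x
  have hs : Summable fun k : Fin 3 → ℤ => K * (27 * ((1 + mu k) ^ 2)⁻¹) :=
    (summable_one_add_mu.mul_left 27).mul_left K
  have hK0 : 0 ≤ K := by
    have := (norm_nonneg _).trans (hK 0)
    simpa [mu] using this
  have h2 := tsum_of_norm_bounded (f := fun k => (fourierCoef h k * Real.exp (-(1 * mu k))) *
    character k x) hs.hasSum fun k => by
      rw [norm_mul, norm_mul, norm_character, mul_one, Complex.norm_real,
        Real.norm_of_nonneg (Real.exp_pos _).le, one_mul]
      calc _ ≤ K * (1 + mu k) * Real.exp (-mu k) := by gcongr; exact hK k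
        _ = K * ((1 + mu k) * Real.exp (-mu k)) := by ring
        _ ≤ _ := mul_le_mul_of_nonneg_left (exp_neg_mu_le k) hK0
  rw [h1.tsum_eq, Complex.norm_real, tsum_mul_left] at h2
  exact h2

/-- The constant of the Schauder estimate. The first two terms come from `h - heat 1 h`, where small
and large times (compared with `‖x - y‖²`) give the singularities at `α = 0` and `α = 1`; the last
term comes from `heat 1 h`. -/
def czConst (α : ℝ) : ℝ :=
  (96 * gaussMom ^ 2 / α + 18 * (64 * gaussMom ^ 3) / (1 - α)) + 9 * lowConst

theorem czConst_pos {α : ℝ} (hα0 : 0 < α) (hα1 : α < 1) : 0 < czConst α := by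
  have := gaussMom_pos
  have := lowConst_nonneg
  have : 0 < 1 - α := by linarith
  unfold czConst
  positivity

theorem two_pi_mul_le (k : Fin 3 → ℤ) (i j : Fin 3) :
    |2 * Real.pi * k i| * |2 * Real.pi * k j| ≤ mu k := by
  have h1 : ∀ i, (2 * Real.pi * k i) ^ 2 ≤ mu k := fun i => by
    rw [mu, mul_pow]
    exact mul_le_mul_of_nonneg_left
      (Finset.single_le_sum (f := fun i => (k i : ℝ) ^ 2) (fun _ _ => sq_nonneg _)
        (Finset.mem_univ i)) (sq_nonneg _)
  have h2 := h1 i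
  have h3 := h1 j
  rw [← sq_abs] at h2 h3
  nlinarith [sq_nonneg (|2 * Real.pi * k i| - |2 * Real.pi * k j|)]

/-- Schauder estimate: `∇ Δ⁻¹ div` is bounded on the Hölder spaces of the torus. -/
theorem schauder {α K : ℝ} (hα0 : 0 < α) (hα1 : α < 1) {P : E3 → ℝ} {F : Fin 3 → E3 → ℝ}
    (hP : SP P) (hF : ∀ i, SP (F i)) (hK : ∀ i, HB α K (F i))
    (heq : lap P = fun x => ∑ i, D i (F i) x) (j : Fin 3) : HB α (czConst α * K) (D j P) := by
  have hK0 : 0 ≤ K := (hK 0).nonneg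
  have hg := gaussMom_pos
  have hlow := lowConst_nonneg
  have h1α : 0 < 1 - α := by linarith
  set h := D j P with hdef
  have hh : SP h := hP.D j
  -- the smooth part
  have hcoef : ∀ k, ‖fourierCoef h k‖ ≤ 3 * K := by
    intro k
    have e1 : mu k * ‖fourierCoef P k‖ ≤ ∑ i, |2 * Real.pi * k i| * K := by
      have e2 : -(mu k : ℂ) * fourierCoef P k
          = ∑ i, (2 * Real.pi * k i : ℝ) * Complex.I * fourierCoef (F i) k := by
        rw [← fourierCoef_lap hP, heq, fourierCoef_sum _ fun i _ => (hF i).D i]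
        exact Finset.sum_congr rfl fun i _ => fourierCoef_D (hF i) i k
      have e3 := congrArg norm e2
      rw [norm_mul, norm_neg, Complex.norm_real, Real.norm_of_nonneg (mu_nonneg k)] at e3
      rw [e3]
      refine (norm_sum_le _ _).trans (Finset.sum_le_sum fun i _ => ?_)
      rw [norm_mul, norm_mul, Complex.norm_I, mul_one, Complex.norm_real, Real.norm_eq_abs]
      exact mul_le_mul_of_nonneg_left (norm_fourierCoef_le (hK i).sup k) (abs_nonneg _)
    rw [hdef, fourierCoef_D hP, norm_mul, norm_mul, Complex.norm_I, mul_one, Complex.norm_real,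
      Real.norm_eq_abs]
    rcases (mu_nonneg k).eq_or_lt with hm | hm
    · have := two_pi_mul_le k j j
      rw [← hm] at this
      have h0 : |2 * Real.pi * (k j : ℝ)| = 0 := by nlinarith [abs_nonneg (2 * Real.pi * (k j : ℝ))]
      rw [h0, zero_mul]
      positivity
    · refine le_of_mul_le_mul_left ?_ hm
      calc mu k * (|2 * Real.pi * k j| * ‖fourierCoef P k‖)
          = |2 * Real.pi * k j| * (mu k * ‖fourierCoef P k‖) := by ring
        _ ≤ |2 * Real.pi * k j| * ∑ i, |2 * Real.pi * k i| * K := by gcongr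
        _ = ∑ i, (|2 * Real.pi * k j| * |2 * Real.pi * k i|) * K := by
          rw [Finset.mul_sum]; exact Finset.sum_congr rfl fun i _ => by ring
        _ ≤ ∑ i : Fin 3, mu k * K :=
          Finset.sum_le_sum fun i _ => mul_le_mul_of_nonneg_right (two_pi_mul_le k j i) hK0
        _ = _ := by simp; ring
  have hA : HB α (9 * lowConst * K) (heat 1 h) := by
    have b1 : ∀ x, |heat 1 h x| ≤ 3 * K * lowConst := abs_heat_one_le hh fun k => by
      nlinarith [hcoef k, mu_nonneg k]
    have b2 : ∀ l x, |D l (heat 1 h) x| ≤ 3 * K * lowConst / 1 := fun l x => by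
      rw [D_heat hh, div_one]
      refine abs_heat_one_le (hh.D l) (fun k => ?_) x
      rw [fourierCoef_D hh, norm_mul, norm_mul, Complex.norm_I, mul_one, Complex.norm_real,
        Real.norm_eq_abs]
      have h2 : |2 * Real.pi * k l| ≤ 1 + mu k := by
        nlinarith [two_pi_mul_le k l l, sq_nonneg (|2 * Real.pi * k l| - 1), mu_nonneg k]
      calc |2 * Real.pi * k l| * ‖fourierCoef h k‖ ≤ (1 + mu k) * (3 * K) :=
            mul_le_mul h2 (hcoef k) (norm_nonneg _) (by linarith [mu_nonneg k])
        _ = _ := by ring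
    have := (hh.heat 1).hb_of_D hα0.le hα1.le one_pos le_rfl b1 b2
    refine this.mono (le_of_eq ?_)
    rw [Real.one_rpow]
    ring
  -- the singular part
  have hlap : lap h = fun x => ∑ i, D j (D i (F i)) x := by
    have e1 : lap h = D j (lap P) := by
      have : lap P = fun x => ∑ i, D i (D i P) x := rfl
      rw [this, D_sum _ fun i _ => (hP.D i).D i]
      ext x
      refine Finset.sum_congr rfl fun i _ => ?_
      rw [hdef, D_comm hP i j, D_comm (hP.D i) i j]
    rw [e1, heq, D_sum _ fun i _ => (hF i).D i]
  have hheat : ∀ s x, heat s (lap h) x = ∑ i, heat s (D j (D i (F i))) x := fun s x => by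
    rw [hlap, heat, avg_sum _ (fun i _ => ((hF i).D i).D j) integrable_gauss]
    rfl
  set c2 : ℝ := 24 * gaussMom ^ 2 * K with hc2
  set c3 : ℝ := 9 * (64 * gaussMom ^ 3) * K with hc3
  have hc20 : 0 ≤ c2 := by positivity
  have hc30 : 0 ≤ c3 := by positivity
  have q1 : ∀ s, 0 < s → ∀ x, |heat s (lap h) x| ≤ c2 * s ^ (-1 + α / 2) := by
    intro s hs x
    rw [hheat]
    refine (Finset.abs_sum_le_sum_abs _ _).trans ?_
    refine (Finset.sum_le_sum fun i _ =>
      abs_heat_D_D_le (hF i) hα0.le hα1.le (hK i) i j hs x).trans_eq ?_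
    simp [hc2]
    ring
  have q2 : ∀ s, 0 < s → ∀ x y, |heat s (lap h) x - heat s (lap h) y|
      ≤ c3 * s ^ (-(3 / 2) + α / 2) * ‖x - y‖ := by
    intro s hs x y
    have := (hh.lap.heat s).lipschitz_of_D (B := 3 * (64 * gaussMom ^ 3 * K)
      * s ^ (-(3 / 2) + α / 2)) (fun l x => ?_) x y
    · refine this.trans_eq ?_
      rw [hc3]; ring
    · rw [D_heat hh.lap, hlap, D_sum _ fun i _ => ((hF i).D i).D j, heat,
        avg_sum _ (fun i _ => (((hF i).D i).D j).D l) integrable_gauss]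
      refine (Finset.abs_sum_le_sum_abs _ _).trans ?_
      refine (Finset.sum_le_sum fun i _ =>
        abs_heat_D_D_D_le (hF i) hα0.le hα1.le (hK i) i j l hs x).trans_eq ?_
      simp
      ring
  have hcont : ∀ x, Continuous fun s => heat s (lap h) x := fun x =>
    (continuous_heat hh.lap).comp (f := fun s : ℝ => (s, x)) (by fun_prop)
  have hii : ∀ x a b, IntervalIntegrable (fun s => heat s (lap h) x) volume a b := fun x a b =>
    (hcont x).intervalIntegrable _ _
  have hrp : ∀ a b : ℝ, IntervalIntegrable (fun s : ℝ => s ^ (-1 + α / 2)) volume a b := fun a b =>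
    intervalIntegral.intervalIntegrable_rpow' (by linarith)
  set J : E3 → ℝ := fun x => ∫ s in (0 : ℝ)..1, heat s (lap h) x with hJ
  have hpow1 : ∀ a : ℝ, ∫ s in (0 : ℝ)..a, s ^ (-1 + α / 2) = a ^ (α / 2) * (2 / α) := by
    intro a
    rw [integral_rpow (Or.inl (by linarith)), show -1 + α / 2 + 1 = α / 2 by ring,
      Real.zero_rpow (by linarith), sub_zero]
    field_simp
  have hJsup : ∀ x, |J x| ≤ c2 * (2 / α) := by
    intro x
    have := intervalIntegral.norm_integral_le_of_norm_le (a := 0) (b := 1) (μ := volume)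
      (f := fun s => heat s (lap h) x) (g := fun s : ℝ => c2 * s ^ (-1 + α / 2)) zero_le_one
      (Filter.Eventually.of_forall fun s hs => q1 s hs.1 x) ((hrp 0 1).const_mul c2)
    rw [intervalIntegral.integral_const_mul, hpow1, Real.one_rpow, one_mul] at this
    exact this
  have hJhol : ∀ x y, |J x - J y| ≤ (2 * c2 * (2 / α) + c3 * (2 / (1 - α))) * ‖x - y‖ ^ α := by
    intro x y
    set r := ‖x - y‖ with hr
    rcases le_or_gt 1 r with h1 | h1
    · have h2 : 1 ≤ r ^ α := Real.one_le_rpow h1 hα0.le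
      have h3 := abs_sub (J x) (J y)
      have h4 : 0 ≤ c2 * (2 / α) := by positivity
      have h5 : 0 ≤ c3 * (2 / (1 - α)) := by positivity
      nlinarith [hJsup x, hJsup y, mul_nonneg h4 (sub_nonneg.2 h2), mul_nonneg h5 (by linarith : 0 ≤ r ^ α)]
    · rcases (norm_nonneg (x - y)).eq_or_lt with h0 | h0
      · have hxy : x = y := sub_eq_zero.1 (norm_eq_zero.1 h0.symm)
        rw [hxy, sub_self, abs_zero]
        positivity
      rw [← hr] at h0
      have hr2 : 0 < r ^ 2 := by positivity
      have hr21 : r ^ 2 ≤ 1 := by nlinarith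
      have esplit : J x - J y = (∫ s in (0 : ℝ)..r ^ 2, (heat s (lap h) x - heat s (lap h) y))
          + ∫ s in (r ^ 2)..1, (heat s (lap h) x - heat s (lap h) y) := by
        rw [intervalIntegral.integral_add_adjacent_intervals
          ((hii x _ _).sub (hii y _ _)) ((hii x _ _).sub (hii y _ _)),
          intervalIntegral.integral_sub (hii x _ _) (hii y _ _)]
      have p1 := intervalIntegral.norm_integral_le_of_norm_le (a := 0) (b := r ^ 2) (μ := volume)
        (f := fun s => heat s (lap h) x - heat s (lap h) y)
        (g := fun s : ℝ => 2 * c2 * s ^ (-1 + α / 2)) hr2.le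
        (Filter.Eventually.of_forall fun s hs => by
          have h3 := abs_sub (heat s (lap h) x) (heat s (lap h) y)
          rw [Real.norm_eq_abs]
          linarith [q1 s hs.1 x, q1 s hs.1 y]) ((hrp 0 _).const_mul _)
      have p2 := intervalIntegral.norm_integral_le_of_norm_le (a := r ^ 2) (b := 1) (μ := volume)
        (f := fun s => heat s (lap h) x - heat s (lap h) y)
        (g := fun s : ℝ => c3 * r * s ^ (-(3 / 2) + α / 2)) hr21
        (Filter.Eventually.of_forall fun s hs => by
          rw [Real.norm_eq_abs]
          have := q2 s (hr2.trans hs.1) x y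
          calc _ ≤ _ := this
            _ = _ := by rw [hr]; ring)
        (by
          refine IntervalIntegrable.const_mul ?_ _
          refine intervalIntegral.intervalIntegrable_rpow (Or.inr ?_)
          rw [uIcc_of_le hr21]
          exact fun hmem => absurd hmem.1 (not_le.2 hr2))
      have hr2pow : (r ^ 2) ^ (α / 2) = r ^ α := by
        rw [← Real.rpow_natCast, ← Real.rpow_mul h0.le]
        congr 1; push_cast; ring
      rw [intervalIntegral.integral_const_mul, hpow1, hr2pow] at p1
      rw [intervalIntegral.integral_const_mul, integral_rpow (Or.inr ⟨by linarith, by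
          rw [uIcc_of_le hr21]
          exact fun hmem => absurd hmem.1 (not_le.2 hr2)⟩), Real.one_rpow] at p2
      have hr2pow' : r * (r ^ 2) ^ (-(3 / 2) + α / 2 + 1) = r ^ α := by
        rw [← Real.rpow_natCast, ← Real.rpow_mul h0.le]
        nth_rewrite 1 [← Real.rpow_one r]
        rw [← Real.rpow_add h0]
        congr 1; push_cast; ring
      have p3 : c3 * r * ((1 - (r ^ 2) ^ (-(3 / 2) + α / 2 + 1)) / (-(3 / 2) + α / 2 + 1))
          ≤ c3 * (2 / (1 - α)) * r ^ α := by
        rw [← hr2pow', show -(3 / 2) + α / 2 + 1 = -((1 - α) / 2) by ring]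
        have e5 : (1 - (r ^ 2) ^ (-((1 - α) / 2))) / (-((1 - α) / 2))
            = (2 / (1 - α)) * ((r ^ 2) ^ (-((1 - α) / 2)) - 1) := by
          field_simp
          ring
        rw [e5]
        have : 0 ≤ c3 * r * (2 / (1 - α)) := by positivity
        nlinarith
      rw [esplit]
      refine (abs_add_le _ _).trans ?_
      rw [Real.norm_eq_abs] at p1 p2
      calc _ ≤ 2 * c2 * (r ^ α * (2 / α)) + c3 * (2 / (1 - α)) * r ^ α :=
            add_le_add p1 (p2.trans p3)
        _ = _ := by ring
  have hJHB : HB α ((96 * gaussMom ^ 2 / α + 18 * (64 * gaussMom ^ 3) / (1 - α)) * K) J := by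
    have e6 : (96 * gaussMom ^ 2 / α + 18 * (64 * gaussMom ^ 3) / (1 - α)) * K
        = 2 * c2 * (2 / α) + c3 * (2 / (1 - α)) := by
      rw [hc2, hc3]; ring
    rw [e6]
    refine ⟨fun x => (hJsup x).trans ?_, hJhol⟩
    have h4 : 0 ≤ c2 * (2 / α) := by positivity
    have h5 : 0 ≤ c3 * (2 / (1 - α)) := by positivity
    linarith
  have hfin : h = fun x => -J x + heat 1 h x := by
    ext x
    have := sub_heat_one_eq hh x
    rw [← intervalIntegral.integral_of_le zero_le_one] at this
    simp only [hJ]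
    linarith
  rw [hfin]
  refine (hJHB.neg.add hA).mono (le_of_eq ?_)
  rw [czConst]
  ring

/-! ### The Leibniz rule -/

/-- The ways to distribute the letters of a word over two factors of a product. -/
def splits : List (Fin 3) → List (List (Fin 3) × List (Fin 3))
  | [] => [([], [])]
  | i :: θ => (splits θ).map (fun p => (i :: p.1, p.2)) ++ (splits θ).map (fun p => (p.1, i :: p.2))

/-- The splittings in `splits` which give at least one letter to the first factor. -/
def properSplits : List (Fin 3) → List (List (Fin 3) × List (Fin 3))
  | [] => []
  | i :: θ => (splits θ).map (fun p => (i :: p.1, p.2)) ++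
      (properSplits θ).map (fun p => (p.1, i :: p.2))

theorem length_of_mem_splits {θ : List (Fin 3)} {p : List (Fin 3) × List (Fin 3)}
    (hp : p ∈ splits θ) : p.1.length + p.2.length = θ.length := by
  induction θ generalizing p with
  | nil => simp_all [splits]
  | cons i θ ih =>
    simp only [splits, List.mem_append, List.mem_map] at hp
    rcases hp with ⟨q, hq, rfl⟩ | ⟨q, hq, rfl⟩ <;>
    · have := ih hq
      simp only [List.length_cons]
      omega

theorem length_of_mem_properSplits {θ : List (Fin 3)} {p : List (Fin 3) × List (Fin 3)}
    (hp : p ∈ properSplits θ) : p.1.length + p.2.length = θ.length ∧ 1 ≤ p.1.length := by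
  induction θ generalizing p with
  | nil => simp_all [properSplits]
  | cons i θ ih =>
    simp only [properSplits, List.mem_append, List.mem_map] at hp
    rcases hp with ⟨q, hq, rfl⟩ | ⟨q, hq, rfl⟩
    · have := length_of_mem_splits hq
      simp only [List.length_cons]
      omega
    · have := ih hq
      simp only [List.length_cons]
      omega

theorem length_splits (θ : List (Fin 3)) : (splits θ).length = 2 ^ θ.length := by
  induction θ with
  | nil => rfl
  | cons i θ ih => simp [splits, ih, pow_succ]; ring

theorem length_properSplits_le (θ : List (Fin 3)) :
    (properSplits θ).length ≤ 2 ^ θ.length := by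
  induction θ with
  | nil => simp [properSplits]
  | cons i θ ih => simp [properSplits, length_splits, pow_succ]; omega

theorem SP.listSum {ι : Type*} (l : List ι) {f : ι → E3 → ℝ} (hf : ∀ p, SP (f p)) :
    SP fun x => (l.map fun p => f p x).sum := by
  induction l with
  | nil => simpa using SP.const 0
  | cons p l ih => simpa using (hf p).add ih

theorem D_listSum {ι : Type*} (l : List ι) {f : ι → E3 → ℝ} (hf : ∀ p, SP (f p)) (i : Fin 3) :
    D i (fun x => (l.map fun p => f p x).sum) = fun x => (l.map fun p => D i (f p) x).sum := by
  induction l with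
  | nil => simpa using D_const 0 i
  | cons p l ih =>
    simp only [List.map_cons, List.sum_cons]
    rw [D_add (hf p) (SP.listSum l hf), ih]

theorem Dw_mul {f g : E3 → ℝ} (hf : SP f) (hg : SP g) (θ : List (Fin 3)) :
    Dw θ (fun x => f x * g x)
      = fun x => ((splits θ).map fun p => Dw p.1 f x * Dw p.2 g x).sum := by
  induction θ with
  | nil => simp [splits, Dw]
  | cons i θ ih =>
    rw [Dw, ih, D_listSum (splits θ) (f := fun p x => Dw p.1 f x * Dw p.2 g x)
      fun p => (hf.Dw p.1).mul (hg.Dw p.2)]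
    ext x
    simp only [splits, List.map_append, List.map_map, List.sum_append, Function.comp_def, Dw]
    rw [← List.sum_map_add]
    congr 1
    refine List.map_congr_left fun p _ => ?_
    rw [D_mul (hf.Dw p.1) (hg.Dw p.2)]

theorem sum_splits (F G : List (Fin 3) → ℝ) (θ : List (Fin 3)) :
    ((splits θ).map fun p => F p.1 * G p.2).sum
      = F [] * G θ + ((properSplits θ).map fun p => F p.1 * G p.2).sum := by
  induction θ generalizing F G with
  | nil => simp [splits, properSplits]
  | cons j θ ih =>
    simp only [splits, properSplits, List.map_append, List.map_map, List.sum_append,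
      Function.comp_def]
    rw [ih F (fun s => G (j :: s))]
    ring

theorem Dw_mul_eq_add {f g : E3 → ℝ} (hf : SP f) (hg : SP g) (θ : List (Fin 3)) :
    Dw θ (fun x => f x * g x) = fun x => f x * Dw θ g x
      + ((properSplits θ).map fun p => Dw p.1 f x * Dw p.2 g x).sum := by
  rw [Dw_mul hf hg]
  ext x
  exact sum_splits (fun s => Dw s f x) (fun s => Dw s g x) θ

theorem HB.listSum {α K : ℝ} {ι : Type*} (l : List ι) {f : ι → E3 → ℝ}
    (hf : ∀ p ∈ l, HB α K (f p)) :
    HB α (l.length * K) fun x => (l.map fun p => f p x).sum := by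
  induction l with
  | nil => simpa using HB.zero le_rfl
  | cons p l ih =>
    have := (hf p (by simp)).add (ih fun q hq => hf q (by simp [hq]))
    simp only [List.map_cons, List.sum_cons, List.length_cons]
    refine this.mono (le_of_eq ?_)
    push_cast
    ring

theorem abs_listSum_le {ι : Type*} (l : List ι) {f : ι → ℝ} {K : ℝ} (hf : ∀ p ∈ l, |f p| ≤ K) :
    |(l.map f).sum| ≤ l.length * K := by
  induction l with
  | nil => simp
  | cons p l ih =>
    have h1 := hf p (by simp)
    have h2 := ih fun q hq => hf q (by simp [hq])
    simp only [List.map_cons, List.sum_cons, List.length_cons]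
    push_cast
    linarith [abs_add_le (f p) (l.map f).sum]

/-! ### Mollification -/

theorem fderiv_eq_sum (f : E3 → ℝ) (x h : E3) : fderiv ℝ f x h = ∑ i, h i * D i f x := by
  have : h = ∑ i, h i • e i := by
    ext j
    fin_cases j <;> simp [e, Fin.sum_univ_three]
  conv_lhs => rw [this]
  simp [D, map_sum]

theorem mollify_eq_avg {F : Type*} [NormedAddCommGroup F] [NormedSpace ℝ F] (ψ : E3 → ℝ) {l : ℝ}
    (hl : 0 < l) (f : E3 → F) : mollify ψ l f = avg ψ (-l) f := by
  ext x
  have h := Measure.integral_comp_smul (volume : Measure E3)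
    (fun y => rescale ψ l y • f (x - y)) l
  have hfr : Module.finrank ℝ E3 = 3 := by simp
  rw [hfr, abs_of_pos (inv_pos.2 (pow_pos hl 3))] at h
  have e1 : mollify ψ l f x = ∫ y, rescale ψ l y • f (x - y) := rfl
  have e2 : avg ψ (-l) f x = ∫ y, (l ^ 3) • (rescale ψ l (l • y) • f (x - l • y)) := by
    refine integral_congr_ae (Filter.Eventually.of_forall fun y => ?_)
    simp only [rescale]
    rw [smul_smul l⁻¹ l y, inv_mul_cancel₀ hl.ne', one_smul, smul_smul, ← mul_assoc,
      mul_inv_cancel₀ (pow_ne_zero 3 hl.ne'), one_mul, neg_smul, sub_eq_add_neg]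
  rw [e1, e2, integral_smul, h, smul_smul, mul_inv_cancel₀ (pow_ne_zero 3 hl.ne'), one_smul]

/-- The iterated derivative of a kernel along a word; it differs from `Dw` in the order in which
the derivatives are taken. -/
def kerD : List (Fin 3) → (E3 → ℝ) → E3 → ℝ
  | [], k => k
  | i :: θ, k => kerD θ (D i k)

/-- The total mass of the derivatives of order `N` of a kernel. -/
def kerMass (ψ : E3 → ℝ) (N : ℕ) : ℝ := ∑ θ : Fin N → Fin 3, ∫ y, |kerD (List.ofFn θ) ψ y|

theorem kerMass_nonneg (ψ : E3 → ℝ) (N : ℕ) : 0 ≤ kerMass ψ N :=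
  Finset.sum_nonneg fun _ _ => integral_nonneg fun _ => abs_nonneg _

theorem integral_kerD_le (ψ : E3 → ℝ) {N : ℕ} {θ : List (Fin 3)} (hθ : θ.length = N) :
    ∫ y, |kerD θ ψ y| ≤ kerMass ψ N := by
  subst hθ
  have := Finset.single_le_sum (f := fun θ : Fin θ.length → Fin 3 => ∫ y, |kerD (List.ofFn θ) ψ y|)
    (fun _ _ => integral_nonneg fun _ => abs_nonneg _) (Finset.mem_univ θ.get)
  simp only [List.ofFn_get] at this
  exact this

section Kernel

variable {ψ : E3 → ℝ}

theorem contDiff_D (h : ContDiff ℝ ∞ ψ) (i : Fin 3) : ContDiff ℝ ∞ (D i ψ) :=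
  (h.fderiv_right (m := ∞) (by simp)).clm_apply contDiff_const

theorem tsupport_D_subset (i : Fin 3) : tsupport (D i ψ) ⊆ tsupport ψ := by
  refine (closure_mono fun x hx => ?_).trans (tsupport_fderiv_subset ℝ (f := ψ))
  simp only [Function.mem_support, D] at hx ⊢
  intro h0
  simp [h0] at hx

theorem hasCompactSupport_D (h : HasCompactSupport ψ) (i : Fin 3) : HasCompactSupport (D i ψ) :=
  h.of_isClosed_subset (isClosed_tsupport _) (tsupport_D_subset i)

theorem tsupport_kerD_subset (θ : List (Fin 3)) : tsupport (kerD θ ψ) ⊆ tsupport ψ := by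
  induction θ generalizing ψ with
  | nil => exact le_rfl
  | cons i θ ih => exact ih.trans (tsupport_D_subset i)

theorem integrable_kerD (h : ContDiff ℝ ∞ ψ) (hc : HasCompactSupport ψ) (θ : List (Fin 3)) :
    Integrable (kerD θ ψ) := by
  induction θ generalizing ψ with
  | nil => exact h.continuous.integrable_of_hasCompactSupport hc
  | cons i θ ih => exact ih (contDiff_D h i) (hasCompactSupport_D hc i)

/-- The derivatives of a mollified function fall on the kernel. -/
theorem Dw_avg_kerD (h : ContDiff ℝ ∞ ψ) (hc : HasCompactSupport ψ) {f : E3 → ℝ} (hf : SP f)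
    {l : ℝ} (hl : 0 < l) (θ : List (Fin 3)) (x : E3) :
    Dw θ (avg ψ (-l) f) x = (l⁻¹) ^ θ.length * avg (kerD θ ψ) (-l) f x := by
  induction θ generalizing ψ with
  | nil => simp [Dw, kerD]
  | cons i θ ih =>
    have hi : Integrable ψ := integrable_kerD h hc []
    have hDi : Integrable (D i ψ) := integrable_kerD h hc [i]
    have e1 : Dw (i :: θ) (avg ψ (-l) f) = fun x => l⁻¹ * Dw θ (avg (D i ψ) (-l) f) x := by
      rw [Dw, ← Dw_D (hf.avg hi _), D_avg hf hi]
      have : avg ψ (-l) (D i f) = fun x => l⁻¹ * avg (D i ψ) (-l) f x := by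
        ext x
        rw [avg_D hf hi (h.differentiable (by simp)) hDi (neg_ne_zero.2 hl.ne'), inv_neg, neg_neg]
      rw [this, Dw_const_mul _ (hf.avg hDi _)]
    simp only [e1]
    rw [ih (contDiff_D h i) (hasCompactSupport_D hc i), kerD, List.length_cons, pow_succ]
    ring

theorem abs_Dw_avg_le (h : ContDiff ℝ ∞ ψ) (hc : HasCompactSupport ψ) {f : E3 → ℝ} (hf : SP f)
    {l : ℝ} (hl : 0 < l) {N : ℕ} {θ : List (Fin 3)} (hθ : θ.length = N) {x : E3} {A : ℝ}
    (hA0 : 0 ≤ A) (hA : ∀ y ∈ tsupport ψ, |f (x + (-l) • y)| ≤ A) :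
    |Dw θ (avg ψ (-l) f) x| ≤ (l⁻¹) ^ N * (kerMass ψ N * A) := by
  rw [Dw_avg_kerD h hc hf hl, abs_mul, hθ, abs_of_nonneg (by positivity)]
  have h1 := abs_avg_le (f := f) (integrable_kerD h hc θ) (c := -l) (x := x) (A := A) fun y hy =>
    hA y (tsupport_kerD_subset θ (subset_tsupport _ hy))
  have h2 := mul_le_mul_of_nonneg_right (integral_kerD_le ψ hθ) hA0
  exact mul_le_mul_of_nonneg_left (h1.trans h2) (by positivity)

/-- The commutator of mollification and multiplication. -/
def commut (k : E3 → ℝ) (c : ℝ) (f g : E3 → ℝ) (x : E3) : ℝ :=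
  avg k c (fun y => f y * g y) x - avg k c f x * avg k c g x

theorem SP.commut {f g : E3 → ℝ} (hf : SP f) (hg : SP g) (hψ : Integrable ψ) (c : ℝ) :
    SP (commut ψ c f g) :=
  ((hf.mul hg).avg hψ c).sub ((hf.avg hψ c).mul (hg.avg hψ c))

theorem avg_sub_const {f : E3 → ℝ} (hf : SP f) (hψ : Integrable ψ) (h1 : ∫ y, ψ y = 1) (c a : ℝ) :
    avg ψ c (fun x => f x - a) = fun x => avg ψ c f x - a := by
  rw [avg_sub hf (SP.const a) hψ]
  ext x
  simp [avg, integral_mul_const, h1]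

/-- The commutator of mollification is unchanged when constants are subtracted. -/
theorem commut_sub_const {f g : E3 → ℝ} (hf : SP f) (hg : SP g) (hψ : Integrable ψ)
    (h1 : ∫ y, ψ y = 1) (c a b : ℝ) :
    commut ψ c (fun x => f x - a) (fun x => g x - b) = commut ψ c f g := by
  ext x
  have e1 : (fun y => (f y - a) * (g y - b)) = fun y => (f y * g y - b * f y) - a * (g y - b) := by
    ext y; ring
  simp only [commut]
  rw [e1, avg_sub ((hf.mul hg).sub (hf.const_mul b)) ((hg.sub (SP.const b)).const_mul a) hψ,
    avg_sub (hf.mul hg) (hf.const_mul b) hψ, avg_const_mul, avg_const_mul,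
    avg_sub_const hf hψ h1, avg_sub_const hg hψ h1]
  ring

/-- The constant of the commutator estimate, for a kernel supported in the ball of radius `r`. -/
def commutConst (ψ : E3 → ℝ) (r : ℝ) (N : ℕ) : ℝ :=
  (kerMass ψ N + 2 ^ N * (∑ m ∈ Finset.range (N + 1), kerMass ψ m) ^ 2) * r ^ 2

theorem kerMass_le_sum (ψ : E3 → ℝ) {m N : ℕ} (h : m ≤ N) :
    kerMass ψ m ≤ ∑ m ∈ Finset.range (N + 1), kerMass ψ m :=
  Finset.single_le_sum (f := kerMass ψ) (fun m _ => kerMass_nonneg ψ m)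
    (Finset.mem_range.2 (Nat.lt_succ_of_le h))

/-- The commutator estimate of Constantin, E and Titi. At the point `x` it is enough to consider
the functions `f - f x` and `g - g x`, which are of size `l` on the ball of radius `l` about `x`. -/
theorem abs_Dw_commut_le (h : ContDiff ℝ ∞ ψ) (hc : HasCompactSupport ψ) (h1 : ∫ y, ψ y = 1)
    {r : ℝ} (hr : 0 ≤ r) (hψr : ∀ y ∈ tsupport ψ, ‖y‖ ≤ r) {f g : E3 → ℝ} (hf : SP f) (hg : SP g)
    {F G : ℝ} (hF0 : 0 ≤ F) (hG0 : 0 ≤ G) (hF : ∀ x y, |f x - f y| ≤ F * ‖x - y‖)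
    (hG : ∀ x y, |g x - g y| ≤ G * ‖x - y‖) {l : ℝ} (hl : 0 < l) {N : ℕ} {θ : List (Fin 3)}
    (hθ : θ.length = N) (x : E3) :
    |Dw θ (commut ψ (-l) f g) x| ≤ commutConst ψ r N * (l⁻¹) ^ N * (l ^ 2 * (F * G)) := by
  have hψ : Integrable ψ := integrable_kerD h hc []
  set f' : E3 → ℝ := fun y => f y - f x with hf'
  set g' : E3 → ℝ := fun y => g y - g x with hg'
  have hf's : SP f' := hf.sub (SP.const _)
  have hg's : SP g' := hg.sub (SP.const _)
  have bf : ∀ y ∈ tsupport ψ, |f' (x + (-l) • y)| ≤ F * (l * r) := fun y hy => by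
    refine (hF _ _).trans (mul_le_mul_of_nonneg_left ?_ hF0)
    rw [add_sub_cancel_left, norm_smul, norm_neg, Real.norm_of_nonneg hl.le]
    exact mul_le_mul_of_nonneg_left (hψr y hy) hl.le
  have bg : ∀ y ∈ tsupport ψ, |g' (x + (-l) • y)| ≤ G * (l * r) := fun y hy => by
    refine (hG _ _).trans (mul_le_mul_of_nonneg_left ?_ hG0)
    rw [add_sub_cancel_left, norm_smul, norm_neg, Real.norm_of_nonneg hl.le]
    exact mul_le_mul_of_nonneg_left (hψr y hy) hl.le
  have bfg : ∀ y ∈ tsupport ψ, |f' (x + (-l) • y) * g' (x + (-l) • y)|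
      ≤ F * (l * r) * (G * (l * r)) := fun y hy => by
    rw [abs_mul]
    exact mul_le_mul (bf y hy) (bg y hy) (abs_nonneg _) (by positivity)
  rw [← commut_sub_const hf hg hψ h1 (-l) (f x) (g x)]
  have e1 : commut ψ (-l) f' g' = fun y => avg ψ (-l) (fun y => f' y * g' y) y
      - avg ψ (-l) f' y * avg ψ (-l) g' y := rfl
  rw [e1, Dw_sub ((hf's.mul hg's).avg hψ _) ((hf's.avg hψ _).mul (hg's.avg hψ _)),
    Dw_mul (hf's.avg hψ _) (hg's.avg hψ _)]
  have a1 := abs_Dw_avg_le h hc (hf's.mul hg's) hl hθ (by positivity) bfg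
  set S := ∑ m ∈ Finset.range (N + 1), kerMass ψ m with hS
  have hS0 : 0 ≤ S := Finset.sum_nonneg fun m _ => kerMass_nonneg ψ m
  have a2 := abs_listSum_le (splits θ) (f := fun p => Dw p.1 (avg ψ (-l) f') x *
    Dw p.2 (avg ψ (-l) g') x) (K := (l⁻¹) ^ N * (S * (F * (l * r)) * (S * (G * (l * r)))))
    fun p hp => by
      have hlen := length_of_mem_splits hp
      rw [hθ] at hlen
      have c1 := abs_Dw_avg_le h hc hf's hl (θ := p.1) rfl (by positivity) bf
      have c2 := abs_Dw_avg_le h hc hg's hl (θ := p.2) rfl (by positivity) bg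
      have d1 := kerMass_le_sum ψ (show p.1.length ≤ N by omega)
      have d2 := kerMass_le_sum ψ (show p.2.length ≤ N by omega)
      rw [abs_mul]
      have k1 := kerMass_nonneg ψ p.1.length
      have k2 := kerMass_nonneg ψ p.2.length
      calc _ ≤ (l⁻¹) ^ p.1.length * (kerMass ψ p.1.length * (F * (l * r)))
            * ((l⁻¹) ^ p.2.length * (kerMass ψ p.2.length * (G * (l * r)))) :=
            mul_le_mul c1 c2 (abs_nonneg _) (by positivity)
        _ ≤ (l⁻¹) ^ p.1.length * (S * (F * (l * r)))
            * ((l⁻¹) ^ p.2.length * (S * (G * (l * r)))) := by gcongr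
        _ = _ := by rw [← hlen, pow_add]; ring
  rw [length_splits, hθ] at a2
  push_cast at a2
  refine (abs_sub _ _).trans ((add_le_add a1 a2).trans (le_of_eq ?_))
  rw [commutConst]
  ring

end Kernel

/-! ### Transport equations with fractional dissipation -/

section Transport

variable {t₀ t₁ ν γ α : ℝ} {f : ℝ → E3 → ℝ} {b : Fin 3 → ℝ → E3 → ℝ} {g : ℝ → E3 → ℝ}

theorem norm_le_of_coord {x : E3} {K : ℝ} (h : ∀ i, |x i| ≤ K) : ‖x‖ ≤ 3 * K := by
  have : x = ∑ i, x i • e i := by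
    ext j
    fin_cases j <;> simp [e, Fin.sum_univ_three]
  rw [this]
  refine (norm_sum_le _ _).trans ?_
  have h2 : ∀ i ∈ Finset.univ, ‖x i • e i‖ ≤ K := fun i _ => by
    simpa [norm_smul, e] using h i
  refine (Finset.sum_le_sum h2).trans ?_
  simp

/-- Propagation of Hölder bounds by a transport equation with fractional dissipation. The estimate
does not depend on `ν` and `γ`. -/
theorem HB.of_transport (hα0 : 0 < α) (hα1 : α < 1) (h : t₀ < t₁) (h0 : 0 < γ) (h1 : γ < 1 / 2)
    (hν : 0 ≤ ν) (hf : STP t₀ t₁ f)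
    (heq : ∀ t ∈ Icc t₀ t₁, ∀ x, dt t₀ t₁ f t x + ∑ j, b j t x * D j (f t) x
      + ν * fracLapScalar γ (f t) x = g t x)
    {Λ κ G A : ℝ} (hb : ∀ t ∈ Icc t₀ t₁, ∀ j x y, |b j t x - b j t y| ≤ Λ * ‖x - y‖)
    (hg : ∀ t ∈ Icc t₀ t₁, HB α (G * Real.exp (κ * (t - t₀))) (g t))
    (hκ : 0 < κ) (hΛ0 : 0 ≤ Λ) (hΛ : 6 * Λ ≤ κ) (hA : HB α A (f t₀)) :
    ∀ t ∈ Icc t₀ t₁, HB α ((A + 2 * G / κ) * Real.exp (κ * (t - t₀))) (f t) := by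
  have hG : 0 ≤ G := by
    have := (hg t₀ ⟨le_rfl, h.le⟩).nonneg
    simpa using this
  let B : ℝ → E3 → E3 := fun t x => WithLp.toLp 2 fun j => b j t x
  have hB : ∀ t ∈ Icc t₀ t₁, ∀ x y, ‖B t x - B t y‖ ≤ 3 * Λ * ‖x - y‖ := fun t ht x y => by
    have := norm_le_of_coord (x := B t x - B t y) (K := Λ * ‖x - y‖) fun i => hb t ht i x y
    linarith
  have heq' : ∀ t ∈ Icc t₀ t₁, ∀ x, dt t₀ t₁ f t x + fderiv ℝ (f t) x (B t x)
      + ν * fracLapScalar γ (f t) x = g t x := fun t ht x => by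
    rw [fderiv_eq_sum]; exact heq t ht x
  have hneq : ∀ t ∈ Icc t₀ t₁, ∀ x, dt t₀ t₁ (fun t x => -f t x) t x
      + fderiv ℝ (fun x => -f t x) x (B t x)
      + ν * fracLapScalar γ (fun x => -f t x) x = -g t x := fun t ht x => by
    have e1 : dt t₀ t₁ (fun t x => -f t x) t x = -dt t₀ t₁ f t x :=
      (hf.hasDerivWithinAt_dt h ht x).neg.derivWithin (uniqueDiffOn_Icc h t ht)
    have e2 := fracLapScalar_const_mul h0 h1 (-1) (hf.slice ht) x
    have e3 : (fun x => -f t x) = fun x => -1 * f t x := by ext; ring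
    rw [e1, fderiv_fun_neg, ← heq' t ht x, e3, e2, neg_apply]
    ring
  have s1 := sup_bound_of_transport h h0 h1 hν hf heq' (fun t ht x =>
    (le_abs_self _).trans ((hg t ht).sup x)) hκ hG hA.nonneg fun x => (le_abs_self _).trans (hA.sup x)
  have s2 := sup_bound_of_transport h h0 h1 hν
    ((hf.const_mul (-1)).congr fun t _ x => by ring : STP t₀ t₁ fun t x => -f t x) hneq
    (fun t ht x => (neg_le_abs _).trans ((hg t ht).sup x)) hκ hG hA.nonneg
    fun x => (neg_le_abs _).trans (hA.sup x)
  have s3 := holder_bound_of_transport hα0 hα1 h h0 h1 hν hf heq' hB (fun t ht x y =>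
    (le_abs_self _).trans ((hg t ht).hol x y)) hκ (by positivity) (by linarith) hG hA.nonneg
    fun x y => (le_abs_self _).trans (hA.hol x y)
  intro t ht
  refine ⟨fun x => abs_le'.2 ⟨s1 t ht x, s2 t ht x⟩, fun x y => abs_le'.2 ⟨s3 t ht x y, ?_⟩⟩
  have := s3 t ht y x
  rw [norm_sub_rev] at this
  linarith

/-- The equation satisfied by a derivative of a solution of a transport equation. -/
theorem transport_Dw (h : t₀ < t₁) (h0 : 0 < γ) (h1 : γ < 1 / 2) (hf : STP t₀ t₁ f)
    (hb : ∀ j, STP t₀ t₁ (b j))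
    (heq : ∀ t ∈ Icc t₀ t₁, ∀ x, dt t₀ t₁ f t x + ∑ j, b j t x * D j (f t) x
      + ν * fracLapScalar γ (f t) x = g t x) (θ : List (Fin 3)) {t : ℝ} (ht : t ∈ Icc t₀ t₁) (x : E3) :
    dt t₀ t₁ (fun s => Dw θ (f s)) t x + ∑ j, b j t x * D j (Dw θ (f t)) x
      + ν * fracLapScalar γ (Dw θ (f t)) x = Dw θ (g t) x
        - ∑ j, ((properSplits θ).map fun p => Dw p.1 (b j t) x * Dw p.2 (D j (f t)) x).sum := by
  have hft := hf.slice ht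
  have hbt := fun j => (hb j).slice ht
  have hdt := (hf.dt h).slice ht
  have hprod : ∀ j ∈ Finset.univ, SP fun x => b j t x * D j (f t) x := fun j _ =>
    (hbt j).mul (hft.D j)
  have hL := hft.fracLapScalar h0 h1
  have e1 : g t = fun x => dt t₀ t₁ f t x + ∑ j, b j t x * D j (f t) x
      + ν * fracLapScalar γ (f t) x := funext fun x => (heq t ht x).symm
  rw [e1, Dw_add (hdt.add (SP.sum _ hprod)) (hL.const_mul ν), Dw_add hdt (SP.sum _ hprod),
    Dw_sum _ hprod, Dw_const_mul ν hL, Dw_fracLapScalar h0 h1 hft, hf.Dw_dt h θ ht]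
  have e2 : ∀ j, Dw θ (fun x => b j t x * D j (f t) x) x = b j t x * D j (Dw θ (f t)) x
      + ((properSplits θ).map fun p => Dw p.1 (b j t) x * Dw p.2 (D j (f t)) x).sum := fun j => by
    rw [Dw_mul_eq_add (hbt j) (hft.D j), Dw_D hft]
  simp only [e2, Finset.sum_add_distrib]
  ring

theorem fracLapScalar_zero (h0 : 0 < γ) (h1 : γ < 1 / 2) (x : E3) :
    fracLapScalar γ (fun _ => 0) x = 0 := by
  have := fracLapScalar_const_mul h0 h1 0 (SP.const 0) x
  simpa using this

/-- The divergence of the forces vanishes for a divergence free solution. -/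
theorem div_eq_zero_of_evolution (h : t₀ < t₁) (h0 : 0 < γ) (h1 : γ < 1 / 2)
    {f : Fin 3 → ℝ → E3 → ℝ} (hf : ∀ k, STP t₀ t₁ (f k))
    (hdiv : ∀ t ∈ Icc t₀ t₁, ∀ x, ∑ k, D k (f k t) x = 0) {t : ℝ} (ht : t ∈ Icc t₀ t₁)
    {A : Fin 3 → E3 → ℝ}
    (heq : ∀ k x, dt t₀ t₁ (f k) t x + ν * fracLapScalar γ (f k t) x + A k x = 0) (x : E3) :
    ∑ k, D k (A k) x = 0 := by
  have hft := fun k => (hf k).slice ht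
  have e1 : ∀ k, D k (A k) x
      = -(dt t₀ t₁ (fun s => D k (f k s)) t x + ν * fracLapScalar γ (D k (f k t)) x) := by
    intro k
    have hdt := ((hf k).dt h).slice ht
    have hL := ((hft k).fracLapScalar h0 h1).const_mul ν
    have e2 : A k = fun x => -(dt t₀ t₁ (f k) t x + ν * fracLapScalar γ (f k t) x) :=
      funext fun x => by linarith [heq k x]
    rw [e2, D_neg, D_add hdt hL, D_const_mul ν ((hft k).fracLapScalar h0 h1),
      D_fracLapScalar h0 h1 (hft k)]
    simp only [(hf k).D_dt h k ht]
  have e3 : ∑ k, dt t₀ t₁ (fun s => D k (f k s)) t x = 0 := by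
    rw [← STP.dt_sum h _ (fun k _ => (hf k).D h k) ht]
    have : dt t₀ t₁ (fun t x => ∑ k, D k (f k t) x) t x = dt t₀ t₁ (fun _ _ => 0) t x :=
      derivWithin_congr (fun s hs => hdiv s hs x) (hdiv t ht x)
    rw [this]
    simp [dt]
  have e4 : ∑ k, fracLapScalar γ (D k (f k t)) x = 0 := by
    rw [← fracLapScalar_sum h0 h1 _ (fun k _ => (hft k).D k),
      show (fun x => ∑ k, D k (f k t) x) = fun _ => 0 from funext (hdiv t ht)]
    exact fracLapScalar_zero h0 h1 x
  simp only [e1]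
  rw [Finset.sum_neg_distrib, Finset.sum_add_distrib, ← Finset.mul_sum, e3, e4]
  simp

/-- In the divergence of `b·∇f` no second derivatives survive if `f` is divergence free. -/
theorem div_convect {b f : Fin 3 → E3 → ℝ} (hb : ∀ j, SP (b j)) (hf : ∀ k, SP (f k))
    (hdiv : ∀ x, ∑ k, D k (f k) x = 0) (x : E3) :
    ∑ k, D k (fun x => ∑ j, b j x * D j (f k) x) x = ∑ k, ∑ j, D k (b j) x * D j (f k) x := by
  have e1 : ∀ k, D k (fun x => ∑ j, b j x * D j (f k) x) x
      = ∑ j, (D k (b j) x * D j (f k) x + b j x * D j (D k (f k)) x) := fun k => by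
    rw [D_sum _ fun j _ => (hb j).mul ((hf k).D j)]
    refine Finset.sum_congr rfl fun j _ => ?_
    rw [D_mul (hb j) ((hf k).D j), D_comm (hf k) k j]
  have e2 : ∀ j, ∑ k, b j x * D j (D k (f k)) x = 0 := fun j => by
    have e3 := congrFun (D_sum Finset.univ (fun k _ => (hf k).D k) j) x
    rw [show (fun x => ∑ k, D k (f k) x) = fun _ => 0 from funext hdiv, D_const] at e3
    rw [← Finset.mul_sum, ← e3, mul_zero]
  simp only [e1, Finset.sum_add_distrib]
  rw [Finset.sum_comm (f := fun k j => b j x * D j (D k (f k)) x)]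
  simp [e2]

theorem STP.hb_bounded (h : t₀ < t₁) (hf : STP t₀ t₁ f) (hα0 : 0 ≤ α) (hα1 : α ≤ 1) :
    ∃ K, 0 ≤ K ∧ ∀ t ∈ Icc t₀ t₁, HB α K (f t) := by
  obtain ⟨K, hK0, hK⟩ := SmoothPer.bounded hf
  choose K' hK'0 hK' using fun i => SmoothPer.bounded (hf.D h i)
  have hle : ∀ i, K' i ≤ ∑ i, K' i := fun i =>
    Finset.single_le_sum (fun j _ => hK'0 j) (Finset.mem_univ i)
  have hS : 0 ≤ ∑ i, K' i := Finset.sum_nonneg fun i _ => hK'0 i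
  refine ⟨3 * (K + ∑ i, K' i) * 1 ^ (-α), by positivity, fun t ht =>
    (hf.slice ht).hb_of_D hα0 hα1 one_pos le_rfl (fun x => ?_) (fun i x => ?_)⟩
  · have := hK (t, x) (mem_slab.2 ht)
    rw [Real.norm_eq_abs] at this
    simp only at this
    linarith
  · have := hK' i (t, x) (mem_slab.2 ht)
    rw [Real.norm_eq_abs] at this
    simp only at this
    rw [div_one]
    linarith [hle i]

theorem STP.hb_lipschitz (h : t₀ < t₁) (hf : STP t₀ t₁ f) (hα0 : 0 ≤ α) (hα1 : α ≤ 1) :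
    ∃ L, 0 ≤ L ∧ ∀ s ∈ Icc t₀ t₁, ∀ t ∈ Icc t₀ t₁, HB α (L * |t - s|) fun x => f t x - f s x := by
  obtain ⟨K, hK0, hK⟩ := SmoothPer.lipschitz h hf
  choose K' hK'0 hK' using fun i => SmoothPer.lipschitz h (hf.D h i)
  have hle : ∀ i, K' i ≤ ∑ i, K' i := fun i =>
    Finset.single_le_sum (fun j _ => hK'0 j) (Finset.mem_univ i)
  have hS : 0 ≤ ∑ i, K' i := Finset.sum_nonneg fun i _ => hK'0 i
  have hn : ∀ (s t : ℝ) (x : E3), ‖((t, x) : ℝ × E3) - (s, x)‖ = |t - s| := fun s t x => by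
    simp [Prod.norm_def]
  refine ⟨3 * (K + ∑ i, K' i), by positivity, fun s hs t ht => ?_⟩
  have := ((hf.slice ht).sub (hf.slice hs)).hb_of_D (A := (K + ∑ i, K' i) * |t - s|) hα0 hα1 one_pos
    le_rfl (fun x => ?_) (fun i x => ?_)
  · refine this.mono (le_of_eq ?_)
    rw [Real.one_rpow]; ring
  · have := hK (s, x) (mem_slab.2 hs) (t, x) (mem_slab.2 ht)
    rw [hn, Real.norm_eq_abs] at this
    refine this.trans ?_
    gcongr
    linarith
  · rw [D_sub (hf.slice ht) (hf.slice hs), div_one]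
    have := hK' i (s, x) (mem_slab.2 hs) (t, x) (mem_slab.2 ht)
    rw [hn, Real.norm_eq_abs] at this
    refine this.trans ?_
    gcongr
    linarith [hle i]

end Transport

/-! ### Short-time control of the gradient -/

/-- The smallness required of (length of the time interval) × (initial gradient). The number `5760`
makes the contribution of the forces in `hb_gradient` at most a tenth of the initial gradient. -/
def smallConst (α : ℝ) : ℝ := (5760 * (1 + czConst α))⁻¹

section GradientBound

variable {t₀ t₁ ν γ α : ℝ} {v : Fin 3 → ℝ → E3 → ℝ} {p : ℝ → E3 → ℝ}

/-- The equation of the pressure of a divergence free solution. -/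
theorem lap_pressure (h : t₀ < t₁) (h0 : 0 < γ) (h1 : γ < 1 / 2)
    (hv : ∀ k, STP t₀ t₁ (v k)) (hp : STP t₀ t₁ p)
    (heq : ∀ k, ∀ t ∈ Icc t₀ t₁, ∀ x, dt t₀ t₁ (v k) t x + ∑ j, v j t x * D j (v k t) x
      + D k (p t) x + ν * fracLapScalar γ (v k t) x = 0)
    (hdiv : ∀ t ∈ Icc t₀ t₁, ∀ x, ∑ k, D k (v k t) x = 0) {t : ℝ} (ht : t ∈ Icc t₀ t₁) (x : E3) :
    lap (p t) x = -∑ k, ∑ j, D k (v j t) x * D j (v k t) x := by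
  have hvt := fun k => (hv k).slice ht
  have hpt := hp.slice ht
  have hc : ∀ k, SP fun x => ∑ j, v j t x * D j (v k t) x := fun k =>
    SP.sum _ fun j _ => (hvt j).mul ((hvt k).D j)
  have := div_eq_zero_of_evolution h h0 h1 (ν := ν) hv hdiv ht
    (A := fun k x => (∑ j, v j t x * D j (v k t) x) + D k (p t) x)
    (fun k x => by linarith [heq k t ht x]) x
  have e1 : ∀ k, D k (fun x => (∑ j, v j t x * D j (v k t) x) + D k (p t) x) x
      = D k (fun x => ∑ j, v j t x * D j (v k t) x) x + D k (D k (p t)) x := fun k => by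
    rw [D_add (hc k) (hpt.D k)]
  simp only [e1, Finset.sum_add_distrib] at this
  rw [div_convect hvt hvt (hdiv t ht)] at this
  rw [lap]
  linarith

/-- A bound for the gradient of the velocity at one time implies a bound for the forces in the
equation of the gradient of the velocity at this time. -/
theorem hb_gradient_forcing (hα0 : 0 < α) (hα1 : α < 1) {v : Fin 3 → E3 → ℝ} {p : E3 → ℝ}
    (hv : ∀ k, SP (v k)) (hp : SP p)
    (hlap : ∀ x, lap p x = -∑ k, ∑ j, D k (v j) x * D j (v k) x) {K : ℝ}
    (hK : ∀ m k, HB α K (D m (v k))) (m k : Fin 3) :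
    HB α ((6 + 18 * czConst α) * K ^ 2)
      (fun x => -D m (D k p) x - ∑ j, D m (v j) x * D j (v k) x) := by
  set Q : E3 → ℝ := fun x => -∑ k, ∑ j, D k (v j) x * D j (v k) x with hQ
  have hQs : SP Q :=
    (SP.sum _ fun k _ => SP.sum _ fun j _ => ((hv j).D k).mul ((hv k).D j)).neg
  have hQb : HB α (18 * K ^ 2) Q := by
    have := (HB.sum3 fun k => HB.sum3 fun j => (hK k j).mul (hK j k)).neg
    exact this.mono (le_of_eq (by ring))
  have hcz := schauder hα0 hα1 (hp.D k) (F := fun i => if i = k then Q else fun _ => 0)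
    (K := 18 * K ^ 2) (fun i => by
      split_ifs
      · exact hQs
      · exact SP.const 0) (fun i => by
      split_ifs
      · exact hQb
      · exact HB.zero hQb.nonneg) (by
      have e1 : lap (D k p) = D k Q := by
        have : Q = lap p := (funext hlap).symm
        rw [this]
        have : lap p = fun x => ∑ i, D i (D i p) x := rfl
        rw [this, D_sum _ fun i _ => (hp.D i).D i]
        ext x
        refine Finset.sum_congr rfl fun i _ => ?_
        rw [D_comm hp i k, D_comm (hp.D i) i k]
      rw [e1]
      ext x
      rw [Finset.sum_eq_single k]
      · simp
      · intro i _ hi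
        simp [hi, D_const]
      · simp) m
  have h2 := hcz.neg.sub (HB.sum3 fun j => (hK m j).mul (hK j k))
  exact h2.mono (le_of_eq (by ring))

/-- Control of the gradient of a solution of the fractional Navier-Stokes equations for short
times. The bound `4 * K` improves to `3 * K` wherever it holds, and by continuity it extends from any
time over a further step of a fixed length. -/
theorem hb_gradient (hα0 : 0 < α) (hα1 : α < 1) (h : t₀ < t₁) (h0 : 0 < γ) (h1 : γ < 1 / 2)
    (hν : 0 ≤ ν) (hv : ∀ k, STP t₀ t₁ (v k)) (hp : STP t₀ t₁ p)
    (heq : ∀ k, ∀ t ∈ Icc t₀ t₁, ∀ x, dt t₀ t₁ (v k) t x + ∑ j, v j t x * D j (v k t) x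
      + D k (p t) x + ν * fracLapScalar γ (v k t) x = 0)
    (hdiv : ∀ t ∈ Icc t₀ t₁, ∀ x, ∑ k, D k (v k t) x = 0) {K : ℝ} (hK0 : 0 < K)
    (hK : ∀ m k, HB α K (D m (v k t₀))) (hsmall : (t₁ - t₀) * K ≤ smallConst α) :
    ∀ t ∈ Icc t₀ t₁, ∀ m k, HB α (4 * K) (D m (v k t)) := by
  have hcz := czConst_pos hα0 hα1
  set c := czConst α with hc
  set T := t₁ - t₀ with hT
  have hT0 : 0 < T := by linarith
  have hs : 5760 * (1 + c) * (T * K) ≤ 1 := by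
    rw [smallConst, ← one_div, le_div_iff₀ (by positivity)] at hsmall
    linarith
  have hTK : 0 < T * K := by positivity
  -- on an interval on which the bound holds, it holds with a better constant
  have improve : ∀ s ∈ Icc t₀ t₁, (∀ t ∈ Icc t₀ s, ∀ m k, HB α (4 * K) (D m (v k t))) →
      ∀ m k, HB α (3 * K) (D m (v k s)) := by
    intro s hs1 hbd m k
    rcases hs1.1.eq_or_lt with h' | h'
    · rw [← h']; exact (hK m k).mono (by linarith)
    have hsub : Icc t₀ s ⊆ Icc t₀ t₁ := Icc_subset_Icc le_rfl hs1.2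
    have hv' : ∀ k, STP t₀ s (v k) := fun k => (hv k).mono hsub
    have hp' : STP t₀ s p := hp.mono hsub
    have heqd := fun t (ht : t ∈ Icc t₀ s) x => transport_Dw (ν := ν) (γ := γ) h' h0 h1 (hv' k) hv'
      (g := fun t x => -D k (p t) x) (fun t ht x => by
        rw [(hv k).dt_mono h' hsub ht]; linarith [heq k t (hsub ht) x]) [m] ht x
    have hmax := HB.of_transport (α := α) hα0 hα1 h' h0 h1 hν ((hv' k).Dw h' [m]) heqd
      (Λ := 12 * K) (κ := 1 / T) (G := (6 + 18 * c) * (4 * K) ^ 2) (A := K)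
      (fun t ht j x y => by
        have := ((hv' j).slice ht).lipschitz_of_D (B := 4 * K) (fun i x => (hbd t ht i j).sup x) x y
        linarith)
      (fun t ht => by
        have hf := hb_gradient_forcing hα0 hα1 (fun k => (hv' k).slice ht) (hp'.slice ht)
          (lap_pressure h h0 h1 hv hp heq hdiv (hsub ht)) (hbd t ht) m k
        -- the only proper splitting of a first derivative puts it on the drift
        have e1 : (fun x => Dw [m] (fun x => -D k (p t) x) x - ∑ j, ((properSplits [m]).map fun q =>
            Dw q.1 (v j t) x * Dw q.2 (D j (v k t)) x).sum)
            = fun x => -D m (D k (p t)) x - ∑ j, D m (v j t) x * D j (v k t) x := by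
          ext x
          simp [properSplits, splits, Dw, D_neg]
        rw [e1]
        refine hf.mono (le_mul_of_one_le_right (by positivity) (Real.one_le_exp ?_))
        have := ht.1
        have : 0 ≤ t - t₀ := by linarith
        positivity)
      (by positivity) (by positivity) (by
        rw [le_div_iff₀ hT0]
        nlinarith) (hK m k) s ⟨h'.le, le_rfl⟩
    refine hmax.mono ?_
    have e2 : Real.exp (1 / T * (s - t₀)) ≤ 2.7182818286 := by
      refine le_trans (Real.exp_le_exp.2 ?_) Real.exp_one_lt_d9.le
      rw [one_div, inv_mul_le_iff₀ hT0]
      linarith [hs1.2]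
    have e3 : K + 2 * ((6 + 18 * c) * (4 * K) ^ 2) / (1 / T) ≤ 1.1 * K := by
      rw [div_div_eq_mul_div, div_one]
      have : K * (5760 * (1 + c) * (T * K)) ≤ K * 1 := mul_le_mul_of_nonneg_left hs hK0.le
      have h5 : 0 ≤ T * K ^ 2 := by positivity
      nlinarith
    have e4 : 0 ≤ K + 2 * ((6 + 18 * c) * (4 * K) ^ 2) / (1 / T) := by positivity
    calc _ ≤ 1.1 * K * 2.7182818286 := mul_le_mul e3 e2 (Real.exp_pos _).le (by positivity)
      _ ≤ _ := by nlinarith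
  -- continuity in time, with a uniform step
  choose L hL0 hL using fun q : Fin 3 × Fin 3 =>
    ((hv q.2).D h q.1).hb_lipschitz h hα0.le hα1.le
  set L' := ∑ q, L q + 1 with hL'
  have hL'0 : 0 < L' := by
    have := Finset.sum_nonneg fun q (_ : q ∈ Finset.univ) => hL0 q
    linarith
  have hLL : ∀ q, L q ≤ L' := fun q => by
    have := Finset.single_le_sum (fun q _ => hL0 q) (Finset.mem_univ q)
    linarith
  set ε := K / L' with hε
  have hε0 : 0 < ε := by positivity
  have key : ∀ n : ℕ, ∀ t ∈ Icc t₀ t₁, t ≤ t₀ + n * ε → ∀ m k, HB α (4 * K) (D m (v k t)) := by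
    intro n
    induction n with
    | zero =>
      intro t ht htn m k
      have : t = t₀ := le_antisymm (by simpa using htn) ht.1
      rw [this]
      exact (hK m k).mono (by linarith)
    | succ n ih =>
      intro t ht htn m k
      have hnε : 0 ≤ (n : ℝ) * ε := by positivity
      set s := min t (t₀ + n * ε) with hs'
      have hsI : s ∈ Icc t₀ t₁ := ⟨le_min ht.1 (by linarith), (min_le_left _ _).trans ht.2⟩
      have h3 := improve s hsI (fun t' ht' => ih t' ⟨ht'.1, ht'.2.trans hsI.2⟩
        (ht'.2.trans (min_le_right _ _))) m k
      have h4 := hL (m, k) s hsI t ht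
      have hst : |t - s| ≤ ε := by
        rw [abs_of_nonneg (sub_nonneg.2 (min_le_left _ _))]
        rcases min_choice t (t₀ + n * ε) with h5 | h5
        · rw [hs', h5]; linarith
        · rw [hs', h5]; push_cast at htn; linarith
      have h6 := h3.add h4
      have e5 : (fun x => D m (v k s) x + (D m (v k t) x - D m (v k s) x)) = D m (v k t) :=
        funext fun x => by ring
      rw [e5] at h6
      refine h6.mono ?_
      have : L (m, k) * |t - s| ≤ L' * ε := mul_le_mul (hLL _) hst (abs_nonneg _) hL'0.le
      rw [hε, mul_div_cancel₀ _ hL'0.ne'] at this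
      linarith
  obtain ⟨n, hn⟩ := exists_nat_ge ((t₁ - t₀) / ε)
  rw [div_le_iff₀ hε0] at hn
  exact fun t ht => key n t ht (by linarith [ht.2])

end GradientBound

/-! ### Stability estimates -/

theorem HB.of_forall_pow {α K K₀ : ℝ} {f : E3 → ℝ}
    (h : ∀ n : ℕ, HB α (K + K₀ * (1 / 2) ^ n) f) : HB α K f := by
  have hlim : Filter.Tendsto (fun n : ℕ => K + K₀ * (1 / 2 : ℝ) ^ n) Filter.atTop (nhds K) := by
    have := ((tendsto_pow_atTop_nhds_zero_of_lt_one (r := (1 / 2 : ℝ)) (by norm_num)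
      (by norm_num)).const_mul K₀).const_add K
    simpa using this
  exact ⟨fun x => ge_of_tendsto' hlim fun n => (h n).sup x,
    fun x y => ge_of_tendsto' (hlim.mul_const _) fun n => (h n).hol x y⟩

theorem Dw_D_eq_cons {f : E3 → ℝ} (hf : SP f) (θ : List (Fin 3)) (i : Fin 3) :
    Dw θ (D i f) = Dw (i :: θ) f := Dw_D hf θ i

theorem HB.Dw_mul {f g : E3 → ℝ} {B : ℝ} (hf : SP f) (hg : SP g) (θ : List (Fin 3))
    (h : ∀ s s' : List (Fin 3), s.length + s'.length = θ.length →
      HB α B (fun x => Dw s f x * Dw s' g x)) :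
    HB α (2 ^ θ.length * B) (Dw θ fun x => f x * g x) := by
  rw [FracNS.Dw_mul hf hg]
  have := HB.listSum (splits θ) (f := fun p x => Dw p.1 f x * Dw p.2 g x) fun p hp =>
    h p.1 p.2 (length_of_mem_splits hp)
  rw [length_splits] at this
  exact_mod_cast this

/-- An exact solution `v` of the fractional Navier-Stokes equations, a solution `u` of the equations
with the force `r`, and their difference `w`, which vanishes at the initial time. The pressure of
`v` is `p`, and `π` is the pressure of `u` minus the pressure of `v`. The numbers `τ`, `Λ`, `E` and
`ρ` are the length of the time interval, the size of `∇u`, the size of the force and the frequency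
at which `u` and `r` live; the numbers `c j` are the constants in the bounds for `u` and `r`. -/
structure Perturbation (α γ ν t₀ t₁ τ Λ E ρ : ℝ) (c : ℕ → ℝ) (u v w r : Fin 3 → ℝ → E3 → ℝ)
    (π p : ℝ → E3 → ℝ) : Prop where
  α_pos : 0 < α
  α_lt : α < 1
  γ_pos : 0 < γ
  γ_lt : γ < 1 / 2
  ν_nonneg : 0 ≤ ν
  lt : t₀ < t₁
  le : t₁ ≤ t₀ + 2 * τ
  τ_pos : 0 < τ
  Λ_pos : 0 < Λ
  E_nonneg : 0 ≤ E
  ρ_pos : 0 < ρ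
  force_small : τ * E * ρ ≤ Λ
  time_small : τ * Λ ≤ 1
  small : 2 * τ * (c 0 * Λ) ≤ smallConst α
  one_le_c : ∀ j, 1 ≤ c j
  stp_u : ∀ k, STP t₀ t₁ (u k)
  stp_v : ∀ k, STP t₀ t₁ (v k)
  stp_r : ∀ k, STP t₀ t₁ (r k)
  stp_π : STP t₀ t₁ π
  stp_p : STP t₀ t₁ p
  w_eq : ∀ k, w k = fun t x => v k t x - u k t x
  init : ∀ k, v k t₀ = u k t₀
  div_v : ∀ t ∈ Icc t₀ t₁, ∀ x, ∑ k, D k (v k t) x = 0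
  div_u : ∀ t ∈ Icc t₀ t₁, ∀ x, ∑ k, D k (u k t) x = 0
  eq_v : ∀ k, ∀ t ∈ Icc t₀ t₁, ∀ x, dt t₀ t₁ (v k) t x + ∑ j, v j t x * D j (v k t) x
      + D k (p t) x + ν * fracLapScalar γ (v k t) x = 0
  eq_w : ∀ k, ∀ t ∈ Icc t₀ t₁, ∀ x, dt t₀ t₁ (w k) t x + ∑ j, v j t x * D j (w k t) x
      + ν * fracLapScalar γ (w k t) x
      = D k (π t) x - r k t x - ∑ j, w j t x * D j (u k t) x
  hb_u : ∀ (j : ℕ) (θ : List (Fin 3)), θ.length = j + 1 → ∀ t ∈ Icc t₀ t₁, ∀ k,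
    HB α (c j * Λ * ρ ^ j) (Dw θ (u k t))
  hb_r : ∀ (N : ℕ) (θ : List (Fin 3)), θ.length = N → ∀ t ∈ Icc t₀ t₁, ∀ k,
    HB α (c N * E * ρ ^ N) (Dw θ (r k t))

namespace Perturbation

variable {α γ ν t₀ t₁ τ Λ E ρ : ℝ} {c : ℕ → ℝ} {u v w r : Fin 3 → ℝ → E3 → ℝ} {π p : ℝ → E3 → ℝ}

theorem stp_w (P : Perturbation α γ ν t₀ t₁ τ Λ E ρ c u v w r π p) (k : Fin 3) :
    STP t₀ t₁ (w k) := by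
  rw [P.w_eq]; exact (P.stp_v k).sub (P.stp_u k)

theorem hb_gradient_v (P : Perturbation α γ ν t₀ t₁ τ Λ E ρ c u v w r π p) :
    ∀ t ∈ Icc t₀ t₁, ∀ m k, HB α (4 * (c 0 * Λ)) (D m (v k t)) := by
  have hc := P.one_le_c 0
  have hΛ := P.Λ_pos
  refine hb_gradient P.α_pos P.α_lt P.lt P.γ_pos P.γ_lt P.ν_nonneg P.stp_v P.stp_p P.eq_v P.div_v
    (by positivity) (fun m k => ?_) ?_
  · rw [P.init k]
    have := P.hb_u 0 [m] rfl t₀ ⟨le_rfl, P.lt.le⟩ k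
    simpa [Dw] using this
  · refine le_trans ?_ P.small
    have : t₁ - t₀ ≤ 2 * τ := by linarith [P.le]
    gcongr

theorem hb_gradient_u (P : Perturbation α γ ν t₀ t₁ τ Λ E ρ c u v w r π p) {t : ℝ}
    (ht : t ∈ Icc t₀ t₁) (m k : Fin 3) : HB α (c 0 * Λ) (D m (u k t)) := by
  simpa [Dw] using P.hb_u 0 [m] rfl t ht k

theorem w_slice (P : Perturbation α γ ν t₀ t₁ τ Λ E ρ c u v w r π p) (k : Fin 3) (t : ℝ) :
    w k t = fun x => v k t x - u k t x := by rw [P.w_eq]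

theorem v_slice (P : Perturbation α γ ν t₀ t₁ τ Λ E ρ c u v w r π p) (k : Fin 3) (t : ℝ) :
    v k t = fun x => u k t x + w k t x := by rw [P.w_slice]; ext x; ring

theorem hb_gradient_w (P : Perturbation α γ ν t₀ t₁ τ Λ E ρ c u v w r π p) {t : ℝ}
    (ht : t ∈ Icc t₀ t₁) (m k : Fin 3) : HB α (5 * (c 0 * Λ)) (D m (w k t)) := by
  rw [P.w_slice, D_sub ((P.stp_v k).slice ht) ((P.stp_u k).slice ht)]
  exact ((P.hb_gradient_v t ht m k).sub (P.hb_gradient_u ht m k)).mono (le_of_eq (by ring))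

theorem div_w (P : Perturbation α γ ν t₀ t₁ τ Λ E ρ c u v w r π p) {t : ℝ}
    (ht : t ∈ Icc t₀ t₁) (x : E3) : ∑ k, D k (w k t) x = 0 := by
  have : ∀ k, D k (w k t) x = D k (v k t) x - D k (u k t) x := fun k => by
    rw [P.w_slice, D_sub ((P.stp_v k).slice ht) ((P.stp_u k).slice ht)]
  simp only [this, Finset.sum_sub_distrib, P.div_v t ht, P.div_u t ht, sub_zero]

/-- If the forces are controlled linearly by the solutions, then the solutions are controlled. This
is Gronwall's lemma: for a large rate `κ` the map from bounds for `φ` with the weight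
`exp (κ (t - t₀))` to bounds of the same kind given by the transport estimate is a contraction. -/
theorem closing (P : Perturbation α γ ν t₀ t₁ τ Λ E ρ c u v w r π p) {ι : Type*} [Fintype ι]
    {φ g : ι → ℝ → E3 → ℝ} (hφ : ∀ i, STP t₀ t₁ (φ i)) (hφ0 : ∀ i, φ i t₀ = fun _ => 0)
    (heq : ∀ i, ∀ t ∈ Icc t₀ t₁, ∀ x, dt t₀ t₁ (φ i) t x + ∑ j, v j t x * D j (φ i t) x
      + ν * fracLapScalar γ (φ i t) x = g i t x) {C X : ℝ} (hC : 1 ≤ C) (hX : 0 ≤ X)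
    (H : ∀ t ∈ Icc t₀ t₁, ∀ Z, 0 ≤ Z → (∀ i, HB α Z (φ i t)) → ∀ i, HB α (C * (Λ * Z + X)) (g i t)) :
    ∀ t ∈ Icc t₀ t₁, ∀ i, HB α (4 * C * Real.exp (8 * C + 144 * c 0 + 2) * (τ * X)) (φ i t) := by
  have hc := P.one_le_c 0
  have hΛ := P.Λ_pos
  have hτ := P.τ_pos
  -- `4 C Λ` makes the map a contraction with factor one half, `72 c₀ Λ` dominates the drift, and
  -- `1 / τ` makes the contribution of `X` of order `τ X`
  set κ := (4 * C + 72 * c 0) * Λ + 1 / τ with hκ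
  have hκ0 : 0 < κ := by positivity
  choose Y hY0 hY using fun i => (hφ i).hb_bounded P.lt P.α_pos.le P.α_lt.le
  set Y₀ := ∑ i, Y i with hY₀
  have hY₀0 : 0 ≤ Y₀ := Finset.sum_nonneg fun i _ => hY0 i
  have hexp : ∀ t ∈ Icc t₀ t₁, 1 ≤ Real.exp (κ * (t - t₀)) := fun t ht =>
    Real.one_le_exp (mul_nonneg hκ0.le (by linarith [ht.1]))
  have key : ∀ n : ℕ, ∀ t ∈ Icc t₀ t₁, ∀ i,
      HB α ((4 * C * (τ * X) + Y₀ * (1 / 2) ^ n) * Real.exp (κ * (t - t₀))) (φ i t) := by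
    intro n
    induction n with
    | zero =>
      intro t ht i
      refine (hY i t ht).mono ?_
      have h1 : Y i ≤ Y₀ := Finset.single_le_sum (fun i _ => hY0 i) (Finset.mem_univ i)
      have h2 : 0 ≤ 4 * C * (τ * X) := by positivity
      have := hexp t ht
      rw [pow_zero, mul_one]
      nlinarith
    | succ n ih =>
      intro t ht i
      set Yn := 4 * C * (τ * X) + Y₀ * (1 / 2) ^ n with hYn
      have hYn0 : 0 ≤ Yn := by positivity
      have := HB.of_transport P.α_pos P.α_lt P.lt P.γ_pos P.γ_lt P.ν_nonneg (hφ i) (heq i)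
        (Λ := 12 * (c 0 * Λ)) (κ := κ) (G := C * (Λ * Yn + X)) (A := 0)
        (fun t ht j x y => by
          have := ((P.stp_v j).slice ht).lipschitz_of_D
            (fun m x => (P.hb_gradient_v t ht m j).sup x) x y
          linarith)
        (fun t ht => by
          refine (H t ht _ (by positivity) (ih t ht) i).mono ?_
          have := hexp t ht
          have h3 : X ≤ X * Real.exp (κ * (t - t₀)) := le_mul_of_one_le_right hX this
          calc C * (Λ * (Yn * Real.exp (κ * (t - t₀))) + X)
              ≤ C * (Λ * (Yn * Real.exp (κ * (t - t₀))) + X * Real.exp (κ * (t - t₀))) := by gcongr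
            _ = _ := by ring)
        hκ0 (by positivity) (by
          have : 0 < 4 * C * Λ := by positivity
          have : 0 < 1 / τ := by positivity
          rw [hκ]
          linarith) (by rw [hφ0 i]; exact HB.zero le_rfl) t ht
      refine this.mono (mul_le_mul_of_nonneg_right ?_ (Real.exp_pos _).le)
      rw [zero_add, div_le_iff₀ hκ0]
      have h1 : 4 * C * Λ ≤ κ := by
        have : 0 < 1 / τ := by positivity
        have : 0 < 72 * c 0 * Λ := by positivity
        rw [hκ]
        linarith
      have h2 : 1 ≤ κ * τ := by
        rw [hκ, add_mul, one_div, inv_mul_cancel₀ hτ.ne']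
        have : 0 ≤ (4 * C + 72 * c 0) * Λ * τ := by positivity
        linarith
      have h3 : 2 * C * X ≤ 2 * C * X * (κ * τ) := le_mul_of_one_le_right (by positivity) h2
      have h4 : 4 * C * Λ * Yn ≤ κ * Yn := mul_le_mul_of_nonneg_right h1 hYn0
      have e5 : 4 * C * (τ * X) + Y₀ * (1 / 2) ^ (n + 1) = 2 * C * (τ * X) + Yn / 2 := by
        rw [hYn, pow_succ]; ring
      rw [e5]
      linarith
  intro t ht i
  have h1 : HB α ((4 * C * (τ * X)) * Real.exp (κ * (t - t₀))) (φ i t) :=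
    HB.of_forall_pow (K₀ := Y₀ * Real.exp (κ * (t - t₀))) fun n =>
      (key n t ht i).mono (le_of_eq (by ring))
  refine h1.mono ?_
  have h2 : κ * (t - t₀) ≤ 8 * C + 144 * c 0 + 2 := by
    have h3 : t - t₀ ≤ 2 * τ := by linarith [ht.2, P.le]
    have h4 : κ * (t - t₀) ≤ κ * (2 * τ) := mul_le_mul_of_nonneg_left h3 hκ0.le
    have h5 : κ * (2 * τ) = (8 * C + 144 * c 0) * (τ * Λ) + 2 := by
      rw [hκ, add_mul]; field_simp; ring
    have h6 : (8 * C + 144 * c 0) * (τ * Λ) ≤ (8 * C + 144 * c 0) * 1 :=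
      mul_le_mul_of_nonneg_left P.time_small (by positivity)
    linarith
  have h3 := Real.exp_le_exp.2 h2
  calc _ ≤ 4 * C * (τ * X) * Real.exp (8 * C + 144 * c 0 + 2) := by gcongr
    _ = _ := by ring

/-- The equation of the pressure difference. -/
theorem lap_π (P : Perturbation α γ ν t₀ t₁ τ Λ E ρ c u v w r π p) {t : ℝ}
    (ht : t ∈ Icc t₀ t₁) (x : E3) :
    lap (π t) x = (∑ k, ∑ j, D k (v j t) x * D j (w k t) x
      + ∑ k, ∑ j, D k (w j t) x * D j (u k t) x) + ∑ k, D k (r k t) x := by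
  have hvt := fun k => (P.stp_v k).slice ht
  have hwt := fun k => (P.stp_w k).slice ht
  have hut := fun k => (P.stp_u k).slice ht
  have hrt := fun k => (P.stp_r k).slice ht
  have hπt := P.stp_π.slice ht
  have c1 : ∀ k, SP fun x => ∑ j, v j t x * D j (w k t) x := fun k =>
    SP.sum _ fun j _ => (hvt j).mul ((hwt k).D j)
  have c2 : ∀ k, SP fun x => ∑ j, w j t x * D j (u k t) x := fun k =>
    SP.sum _ fun j _ => (hwt j).mul ((hut k).D j)
  have := div_eq_zero_of_evolution P.lt P.γ_pos P.γ_lt (ν := ν) P.stp_w (fun t ht => P.div_w ht) ht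
    (A := fun k x => ((∑ j, v j t x * D j (w k t) x + ∑ j, w j t x * D j (u k t) x) + r k t x)
      - D k (π t) x) (fun k x => by linarith [P.eq_w k t ht x]) x
  have e1 : ∀ k, D k (fun x => ((∑ j, v j t x * D j (w k t) x + ∑ j, w j t x * D j (u k t) x)
      + r k t x) - D k (π t) x) x = D k (fun x => ∑ j, v j t x * D j (w k t) x) x
        + D k (fun x => ∑ j, w j t x * D j (u k t) x) x + D k (r k t) x - D k (D k (π t)) x :=
    fun k => by
      rw [D_sub (((c1 k).add (c2 k)).add (hrt k)) (hπt.D k), D_add ((c1 k).add (c2 k)) (hrt k),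
        D_add (c1 k) (c2 k)]
  simp only [e1, Finset.sum_add_distrib, Finset.sum_sub_distrib] at this
  rw [div_convect hvt hwt (fun x => P.div_w ht x), div_convect hwt hut (P.div_u t ht)] at this
  rw [lap]
  linarith

section Zero

/-- The pressure gradient without derivatives: `Δπ = div (w·∇v + w·∇u + r)`, so that no derivative
of `w` is needed. -/
theorem hb_pressure_zero (P : Perturbation α γ ν t₀ t₁ τ Λ E ρ c u v w r π p) {t : ℝ}
    (ht : t ∈ Icc t₀ t₁) {Z : ℝ} (hZ : ∀ k, HB α Z (w k t)) (m : Fin 3) :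
    HB α (30 * czConst α * c 0 * (Λ * Z + E)) (D m (π t)) := by
  have hvt := fun k => (P.stp_v k).slice ht
  have hwt := fun k => (P.stp_w k).slice ht
  have hut := fun k => (P.stp_u k).slice ht
  have hrt := fun k => (P.stp_r k).slice ht
  have hcz := czConst_pos P.α_pos P.α_lt
  have hc := P.one_le_c 0
  have hE := P.E_nonneg
  have c1 : ∀ k, SP fun x => ∑ j, w j t x * D j (v k t) x := fun k =>
    SP.sum _ fun j _ => (hwt j).mul ((hvt k).D j)
  have c2 : ∀ k, SP fun x => ∑ j, w j t x * D j (u k t) x := fun k =>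
    SP.sum _ fun j _ => (hwt j).mul ((hut k).D j)
  have h1 := schauder P.α_pos P.α_lt (P.stp_π.slice ht) (F := fun k x =>
      (∑ j, w j t x * D j (v k t) x + ∑ j, w j t x * D j (u k t) x) + r k t x)
    (K := 30 * (c 0 * (Λ * Z + E)))
    (fun k => ((c1 k).add (c2 k)).add (hrt k)) (fun k => by
      have b1 := HB.sum3 fun j => (hZ j).mul (P.hb_gradient_v t ht j k)
      have b2 := HB.sum3 fun j => (hZ j).mul (P.hb_gradient_u ht j k)
      have b3 := P.hb_r 0 [] rfl t ht k
      refine ((b1.add b2).add b3).mono ?_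
      have : 0 ≤ c 0 * E := by positivity
      rw [pow_zero]
      linarith) (by
      ext x
      rw [P.lap_π ht]
      have e1 : ∀ k, D k (fun x => (∑ j, w j t x * D j (v k t) x + ∑ j, w j t x * D j (u k t) x)
          + r k t x) x = D k (fun x => ∑ j, w j t x * D j (v k t) x) x
          + D k (fun x => ∑ j, w j t x * D j (u k t) x) x + D k (r k t) x := fun k => by
        rw [D_add ((c1 k).add (c2 k)) (hrt k), D_add (c1 k) (c2 k)]
      simp only [e1, Finset.sum_add_distrib]
      rw [div_convect hwt hvt (P.div_v t ht), div_convect hwt hut (P.div_u t ht)]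
      congr 2
      rw [Finset.sum_comm]
      simp only [mul_comm]) m
  exact h1.mono (le_of_eq (by ring))

theorem hb_forcing_zero (P : Perturbation α γ ν t₀ t₁ τ Λ E ρ c u v w r π p) {t : ℝ}
    (ht : t ∈ Icc t₀ t₁) {Z : ℝ} (hZ : ∀ k, HB α Z (w k t)) (k : Fin 3) :
    HB α ((30 * czConst α + 7) * c 0 * (Λ * Z + E))
      (fun x => D k (π t) x - r k t x - ∑ j, w j t x * D j (u k t) x) := by
  have b1 := P.hb_pressure_zero ht hZ k
  have b2 := HB.sum3 fun j => (hZ j).mul (P.hb_gradient_u ht j k)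
  have b3 := P.hb_r 0 [] rfl t ht k
  refine ((b1.sub b3).sub b2).mono ?_
  have h1 : 0 ≤ c 0 * E := mul_nonneg (by linarith [P.one_le_c 0]) P.E_nonneg
  have h2 : 0 ≤ c 0 * (Λ * Z) := mul_nonneg (by linarith [P.one_le_c 0])
    (mul_nonneg P.Λ_pos.le (hZ k).nonneg)
  rw [pow_zero]
  linarith

end Zero

section Higher

/-- The derivatives of order `N` of `w` at the time `t` have size `Z`, the derivatives of lower
order obey the bounds of the theorem with the constant `K`. -/
structure Lower (α τ E ρ : ℝ) (c : ℕ → ℝ) (w : Fin 3 → ℝ → E3 → ℝ) (N : ℕ) (t K Z : ℝ) : Prop where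
  c_le : ∀ j ≤ N, c j ≤ K
  low : ∀ m < N, ∀ θ : List (Fin 3), θ.length = m → ∀ k, HB α (K * (τ * E) * ρ ^ m) (Dw θ (w k t))
  top : ∀ θ : List (Fin 3), θ.length = N → ∀ k, HB α Z (Dw θ (w k t))

variable {N : ℕ} {t K Z : ℝ}

/-- A derivative of `w` of order `N - n` gains the factor `ρ⁻ⁿ`, whether it is of top order or not. -/
theorem hb_w (P : Perturbation α γ ν t₀ t₁ τ Λ E ρ c u v w r π p)
    (L : Lower α τ E ρ c w N t K Z) {s : List (Fin 3)} {n : ℕ} (hs : s.length + n = N) (k : Fin 3) :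
    HB α (K * (Z + τ * E * ρ ^ N) / ρ ^ n) (Dw s (w k t)) := by
  have hρ := P.ρ_pos
  have hτ := P.τ_pos
  have hE := P.E_nonneg
  have hK : 1 ≤ K := (P.one_le_c 0).trans (L.c_le 0 (Nat.zero_le _))
  have hZ : 0 ≤ Z := (L.top (List.replicate N 0) (by simp) 0).nonneg
  rcases Nat.eq_zero_or_pos n with rfl | hn
  · refine (L.top s (by omega) k).mono ?_
    rw [pow_zero, div_one]
    have h1 : Z ≤ K * Z := le_mul_of_one_le_left hZ hK
    have h2 : 0 ≤ K * (τ * E * ρ ^ N) := by positivity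
    linarith
  · refine (L.low s.length (by omega) s rfl k).mono ?_
    rw [le_div_iff₀ (by positivity), ← hs, pow_add]
    have h2 : 0 ≤ K * Z := by positivity
    nlinarith

/-- Derivatives of `w` of intermediate order are as good as those of `u`. At order one this is the
gradient bound, which is also needed when one is the top order. -/
theorem hb_low (P : Perturbation α γ ν t₀ t₁ τ Λ E ρ c u v w r π p) (ht : t ∈ Icc t₀ t₁)
    (L : Lower α τ E ρ c w N t K Z) {s : List (Fin 3)} {n : ℕ} (hs : s.length = n + 1)
    (hn : n + 1 < N ∨ n = 0) (k : Fin 3) : HB α (5 * K * Λ * ρ ^ n) (Dw s (w k t)) := by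
  have hρ := P.ρ_pos
  have hΛ := P.Λ_pos
  have hK : c 0 ≤ K := L.c_le 0 (Nat.zero_le _)
  have hK1 : 1 ≤ K := (P.one_le_c 0).trans hK
  rcases hn with hn | rfl
  · refine (L.low (n + 1) hn s hs k).mono ?_
    calc K * (τ * E) * ρ ^ (n + 1) = K * ρ ^ n * (τ * E * ρ) := by ring
      _ ≤ K * ρ ^ n * Λ := by gcongr; exact P.force_small
      _ ≤ _ := by
        have : 0 ≤ K * ρ ^ n * Λ := by positivity
        linarith
  · obtain ⟨m, rfl⟩ := List.length_eq_one_iff.1 hs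
    refine (P.hb_gradient_w ht m k).mono ?_
    rw [pow_zero]
    nlinarith

/-- The products of total order `N + 1` of `w` and `u` in which `u` is differentiated: no
derivative of `w` above the order `N` occurs. -/
theorem hb_mul_u (P : Perturbation α γ ν t₀ t₁ τ Λ E ρ c u v w r π p) (ht : t ∈ Icc t₀ t₁)
    (L : Lower α τ E ρ c w N t K Z) {s s' : List (Fin 3)} (hs : s.length + s'.length = N + 1)
    (hs' : 1 ≤ s'.length) (i j : Fin 3) :
    HB α (10 * K ^ 2 * (Λ * Z + E * ρ ^ N)) (fun x => Dw s (w i t) x * Dw s' (u j t) x) := by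
  have hρ := P.ρ_pos
  have hΛ := P.Λ_pos
  have hτ := P.τ_pos
  have hE := P.E_nonneg
  have hZ : 0 ≤ Z := (L.top (List.replicate N 0) (by simp) 0).nonneg
  obtain ⟨n, hn⟩ : ∃ n, s'.length = n + 1 := ⟨s'.length - 1, by omega⟩
  have hK1 : 1 ≤ K := (P.one_le_c 0).trans (L.c_le 0 (Nat.zero_le _))
  have h1 := P.hb_w L (s := s) (n := n) (by omega) i
  have h2 := (P.hb_u n s' hn t ht j).mono (K' := K * Λ * ρ ^ n)
    (by gcongr; exact L.c_le n (by omega))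
  refine (h1.mul h2).mono ?_
  have hρn : 0 < ρ ^ n := by positivity
  have e1 : 2 * (K * (Z + τ * E * ρ ^ N) / ρ ^ n * (K * Λ * ρ ^ n))
      = 2 * K ^ 2 * (Λ * Z + τ * Λ * (E * ρ ^ N)) := by
    field_simp
  rw [e1]
  have h3 : τ * Λ * (E * ρ ^ N) ≤ E * ρ ^ N :=
    mul_le_of_le_one_left (by positivity) P.time_small
  have h4 : 0 ≤ K ^ 2 * (Λ * Z + E * ρ ^ N) := by positivity
  calc 2 * K ^ 2 * (Λ * Z + τ * Λ * (E * ρ ^ N)) ≤ 2 * K ^ 2 * (Λ * Z + E * ρ ^ N) := by gcongr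
    _ ≤ _ := by linarith

/-- The products of total order `N + 1` of two components of `w`, both differentiated. Not both
factors are of top order unless `N = 1`; one of them is bounded by `hb_low`. -/
theorem hb_mul_w (P : Perturbation α γ ν t₀ t₁ τ Λ E ρ c u v w r π p) (ht : t ∈ Icc t₀ t₁)
    (L : Lower α τ E ρ c w N t K Z) {s s' : List (Fin 3)} (hss : s.length + s'.length = N + 1)
    (hs : 1 ≤ s.length) (hs' : 1 ≤ s'.length) (i j : Fin 3) :
    HB α (10 * K ^ 2 * (Λ * Z + E * ρ ^ N)) (fun x => Dw s (w i t) x * Dw s' (w j t) x) := by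
  wlog hlow : s'.length < N ∨ s'.length = 1 generalizing s s' i j
  · have := this (s := s') (s' := s) (by omega) hs' hs j i (by omega)
    simpa only [mul_comm] using this
  have hρ := P.ρ_pos
  have hΛ := P.Λ_pos
  have hτ := P.τ_pos
  have hE := P.E_nonneg
  obtain ⟨n, hn⟩ : ∃ n, s'.length = n + 1 := ⟨s'.length - 1, by omega⟩
  have h1 := P.hb_w L (s := s) (n := n) (by omega) i
  have h2 := P.hb_low ht L hn (by omega) j
  refine (h1.mul h2).mono ?_
  have hρn : 0 < ρ ^ n := by positivity
  have e1 : 2 * (K * (Z + τ * E * ρ ^ N) / ρ ^ n * (5 * K * Λ * ρ ^ n))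
      = 10 * K ^ 2 * (Λ * Z + τ * Λ * (E * ρ ^ N)) := by
    field_simp
    ring
  rw [e1]
  have h3 : τ * Λ * (E * ρ ^ N) ≤ E * ρ ^ N :=
    mul_le_of_le_one_left (by positivity) P.time_small
  gcongr

/-- The pressure gradient at order `N ≥ 1`. One derivative of the word `θ` is used to write the
quadratic part `Q` of `Δπ` in divergence form, so that `N - 1` derivatives fall on the products of
first derivatives in `Q`. -/
theorem hb_pressure (P : Perturbation α γ ν t₀ t₁ τ Λ E ρ c u v w r π p) (ht : t ∈ Icc t₀ t₁)
    (L : Lower α τ E ρ c w N t K Z) {θ : List (Fin 3)} (hθ : θ.length = N) (hN : 1 ≤ N)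
    (k : Fin 3) :
    HB α (czConst α * ((27 * 2 ^ N + 1) * (10 * K ^ 2 * (Λ * Z + E * ρ ^ N))))
      (Dw θ (D k (π t))) := by
  obtain ⟨m, θ', rfl⟩ : ∃ m θ', θ = m :: θ' := by
    cases θ with
    | nil => simp at hθ; omega
    | cons m θ' => exact ⟨m, θ', rfl⟩
  have hvt := fun k => (P.stp_v k).slice ht
  have hwt := fun k => (P.stp_w k).slice ht
  have hut := fun k => (P.stp_u k).slice ht
  have hrt := fun k => (P.stp_r k).slice ht
  have hπt := P.stp_π.slice ht
  have hρ := P.ρ_pos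
  have hΛ := P.Λ_pos
  have hE := P.E_nonneg
  have hZ : 0 ≤ Z := (L.top (List.replicate N 0) (by simp) 0).nonneg
  have hK1 : 1 ≤ K := (P.one_le_c 0).trans (L.c_le 0 (Nat.zero_le _))
  set B := 10 * K ^ 2 * (Λ * Z + E * ρ ^ N) with hB
  have hB0 : 0 ≤ B := by positivity
  have hθ' : θ'.length + 1 = N := by simpa using hθ
  -- the quadratic part of the equation of the pressure
  let q : Fin 3 → Fin 3 → E3 → ℝ := fun k j x => (D k (w j t) x * D j (w k t) x
    + D j (w k t) x * D k (u j t) x) + D k (w j t) x * D j (u k t) x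
  have hq : ∀ k j, SP (q k j) := fun k j => ((((hwt j).D k).mul ((hwt k).D j)).add
    (((hwt k).D j).mul ((hut j).D k))).add (((hwt j).D k).mul ((hut k).D j))
  have hqb : ∀ k j, HB α (3 * 2 ^ N * B) (Dw θ' (q k j)) := by
    intro k j
    have b1 := HB.Dw_mul (α := α) (B := B) ((hwt j).D k) ((hwt k).D j) θ' fun s s' hs => by
      rw [Dw_D_eq_cons (hwt j), Dw_D_eq_cons (hwt k)]
      exact P.hb_mul_w ht L (by simp only [List.length_cons]; omega) (by simp) (by simp) j k
    have b2 := HB.Dw_mul (α := α) (B := B) ((hwt k).D j) ((hut j).D k) θ' fun s s' hs => by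
      rw [Dw_D_eq_cons (hwt k), Dw_D_eq_cons (hut j)]
      exact P.hb_mul_u ht L (by simp only [List.length_cons]; omega) (by simp) k j
    have b3 := HB.Dw_mul (α := α) (B := B) ((hwt j).D k) ((hut k).D j) θ' fun s s' hs => by
      rw [Dw_D_eq_cons (hwt j), Dw_D_eq_cons (hut k)]
      exact P.hb_mul_u ht L (by simp only [List.length_cons]; omega) (by simp) j k
    rw [Dw_add ((((hwt j).D k).mul ((hwt k).D j)).add (((hwt k).D j).mul ((hut j).D k)))
      (((hwt j).D k).mul ((hut k).D j)),
      Dw_add (((hwt j).D k).mul ((hwt k).D j)) (((hwt k).D j).mul ((hut j).D k))]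
    refine ((b1.add b2).add b3).mono ?_
    have : (2 : ℝ) ^ θ'.length ≤ 2 ^ N := pow_le_pow_right₀ one_le_two (by omega)
    nlinarith
  set Q : E3 → ℝ := fun x => ∑ k, ∑ j, q k j x with hQ
  have hQs : SP Q := SP.sum _ fun k _ => SP.sum _ fun j _ => hq k j
  have hQb : HB α (27 * 2 ^ N * B) (Dw θ' Q) := by
    rw [hQ, Dw_sum _ fun k _ => SP.sum _ fun j _ => hq k j]
    have : ∀ k, Dw θ' (fun x => ∑ j, q k j x) = fun x => ∑ j, Dw θ' (q k j) x := fun k =>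
      Dw_sum _ (fun j _ => hq k j) θ'
    simp only [this]
    exact (HB.sum3 fun k => HB.sum3 fun j => hqb k j).mono (le_of_eq (by ring))
  have hlap : lap (π t) = fun x => Q x + ∑ i, D i (r i t) x := by
    ext x
    rw [P.lap_π ht, ← Finset.sum_add_distrib]
    congr 1
    refine Finset.sum_congr rfl fun k _ => ?_
    rw [← Finset.sum_add_distrib]
    refine Finset.sum_congr rfl fun j _ => ?_
    have : D k (v j t) x = D k (u j t) x + D k (w j t) x := by
      rw [P.v_slice, D_add (hut j) (hwt j)]
    rw [this]
    simp only [q]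
    ring
  have hrb : ∀ i, HB α B (Dw (m :: θ') (r i t)) := fun i => by
    refine (P.hb_r N _ hθ t ht i).mono ?_
    have h1 : c N * E * ρ ^ N ≤ K * (E * ρ ^ N) := by
      rw [mul_assoc]
      exact mul_le_mul_of_nonneg_right (L.c_le N le_rfl) (by positivity)
    have h2 : K ≤ 10 * K ^ 2 := by nlinarith
    have h3 : K * (E * ρ ^ N) ≤ 10 * K ^ 2 * (E * ρ ^ N) :=
      mul_le_mul_of_nonneg_right h2 (by positivity)
    have h4 : 0 ≤ 10 * K ^ 2 * (Λ * Z) := by positivity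
    rw [hB]
    linarith
  rw [Dw_D hπt]
  refine schauder P.α_pos P.α_lt (hπt.Dw (m :: θ'))
    (F := fun i x => (if i = m then Dw θ' Q x else 0) + Dw (m :: θ') (r i t) x) (fun i => ?_)
    (fun i => ?_) ?_ k
  · refine SP.add ?_ ((hrt i).Dw _)
    split_ifs
    · exact hQs.Dw θ'
    · exact SP.const 0
  · have h1 : HB α (27 * 2 ^ N * B) (fun x => if i = m then Dw θ' Q x else 0) := by
      split_ifs
      · exact hQb
      · exact HB.zero hQb.nonneg
    exact (h1.add (hrb i)).mono (le_of_eq (by ring))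
  · have e1 : lap (Dw (m :: θ') (π t)) = Dw (m :: θ') (lap (π t)) := by
      have : lap (π t) = fun x => ∑ i, D i (D i (π t)) x := rfl
      rw [this, Dw_sum _ fun i _ => (hπt.D i).D i]
      ext x
      refine Finset.sum_congr rfl fun i _ => ?_
      rw [Dw_D (hπt.D i), Dw_D hπt]
    rw [e1, hlap, Dw_add hQs (SP.sum _ fun i _ => (hrt i).D i), Dw_sum _ fun i _ => (hrt i).D i]
    ext x
    have e2 : ∀ i, D i (fun x => (if i = m then Dw θ' Q x else 0) + Dw (m :: θ') (r i t) x) x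
        = (if i = m then D m (Dw θ' Q) x else 0) + Dw (m :: θ') (D i (r i t)) x := fun i => by
      rw [Dw_D (hrt i), D_add (by
        split_ifs
        · exact hQs.Dw θ'
        · exact SP.const 0) ((hrt i).Dw _)]
      split_ifs with h
      · rw [h]
      · simp [D_const]
    simp only [e2, Finset.sum_add_distrib, Finset.sum_ite_eq', Finset.mem_univ, if_true]
    rfl

/-- The right-hand side of the equation of a derivative of order `N ≥ 1` of `w`, including the
commutator with the drift `v = u + w`. -/
theorem hb_forcing (P : Perturbation α γ ν t₀ t₁ τ Λ E ρ c u v w r π p) (ht : t ∈ Icc t₀ t₁)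
    (L : Lower α τ E ρ c w N t K Z) {θ : List (Fin 3)} (hθ : θ.length = N) (hN : 1 ≤ N)
    (k : Fin 3) :
    HB α ((czConst α * (27 * 2 ^ N + 1) + 9 * 2 ^ N + 1) * (10 * K ^ 2 * (Λ * Z + E * ρ ^ N)))
      (fun x => Dw θ (fun x => D k (π t) x - r k t x - ∑ j, w j t x * D j (u k t) x) x
        - ∑ j, ((properSplits θ).map fun p => Dw p.1 (v j t) x * Dw p.2 (D j (w k t)) x).sum) := by
  have hwt := fun k => (P.stp_w k).slice ht
  have hut := fun k => (P.stp_u k).slice ht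
  have hrt := fun k => (P.stp_r k).slice ht
  have hπt := P.stp_π.slice ht
  have hρ := P.ρ_pos
  have hΛ := P.Λ_pos
  have hE := P.E_nonneg
  have hZ : 0 ≤ Z := (L.top (List.replicate N 0) (by simp) 0).nonneg
  have hK1 : 1 ≤ K := (P.one_le_c 0).trans (L.c_le 0 (Nat.zero_le _))
  have bp := P.hb_pressure ht L hθ hN k
  set B := 10 * K ^ 2 * (Λ * Z + E * ρ ^ N) with hB
  have hB0 : 0 ≤ B := by positivity
  have br : HB α B (Dw θ (r k t)) := by
    refine (P.hb_r N _ hθ t ht k).mono ?_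
    have h1 : c N * E * ρ ^ N ≤ K * (E * ρ ^ N) := by
      rw [mul_assoc]
      exact mul_le_mul_of_nonneg_right (L.c_le N le_rfl) (by positivity)
    have h2 : K ≤ 10 * K ^ 2 := by nlinarith
    have h3 : K * (E * ρ ^ N) ≤ 10 * K ^ 2 * (E * ρ ^ N) :=
      mul_le_mul_of_nonneg_right h2 (by positivity)
    have h4 : 0 ≤ 10 * K ^ 2 * (Λ * Z) := by positivity
    rw [hB]
    linarith
  have bs : ∀ j, HB α (2 ^ N * B) (Dw θ fun x => w j t x * D j (u k t) x) := fun j => by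
    rw [← hθ]
    refine HB.Dw_mul (hwt j) ((hut k).D j) θ fun s s' hs => ?_
    rw [Dw_D_eq_cons (hut k)]
    exact P.hb_mul_u ht L (by simp only [List.length_cons]; omega) (by simp) j k
  have bc : ∀ j, HB α (2 ^ N * (2 * B)) (fun x => ((properSplits θ).map fun p =>
      Dw p.1 (v j t) x * Dw p.2 (D j (w k t)) x).sum) := fun j => by
    refine (HB.listSum (properSplits θ) (K := 2 * B)
      (f := fun p x => Dw p.1 (v j t) x * Dw p.2 (D j (w k t)) x) fun q hq => ?_).mono ?_
    · obtain ⟨h1, h2⟩ := length_of_mem_properSplits hq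
      have e1 : (fun x => Dw q.1 (v j t) x * Dw q.2 (D j (w k t)) x)
          = fun x => Dw (j :: q.2) (w k t) x * Dw q.1 (u j t) x
            + Dw q.1 (w j t) x * Dw (j :: q.2) (w k t) x := by
        ext x
        rw [Dw_D_eq_cons (hwt k), P.v_slice, Dw_add (hut j) (hwt j)]
        ring
      rw [e1]
      exact ((P.hb_mul_u ht L (by simp only [List.length_cons]; omega) h2 k j).add
        (P.hb_mul_w ht L (by simp only [List.length_cons]; omega) h2 (by simp) j k)).mono
        (le_of_eq (by rw [hB]; ring))
    · have := length_properSplits_le θ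
      rw [hθ] at this
      have h3 : ((properSplits θ).length : ℝ) ≤ 2 ^ N := by exact_mod_cast this
      exact mul_le_mul_of_nonneg_right h3 (by positivity)
  have hsum : ∀ j ∈ Finset.univ, SP fun x => w j t x * D j (u k t) x := fun j _ =>
    (hwt j).mul ((hut k).D j)
  rw [Dw_sub ((hπt.D k).sub (hrt k)) (SP.sum _ hsum), Dw_sub (hπt.D k) (hrt k), Dw_sum _ hsum]
  exact (((bp.sub br).sub (HB.sum3 bs)).sub (HB.sum3 bc)).mono (le_of_eq (by ring))

end Higher

/-- The bounds for the difference of the two solutions and for the difference of the pressures. The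
constant depends only on `N`, `α` and the constants in the hypotheses. -/
theorem main_bound (α : ℝ) (c : ℕ → ℝ) (N : ℕ) :
    ∃ C : ℝ, 1 ≤ C ∧ ∀ {γ ν t₀ t₁ τ Λ E ρ : ℝ} {u v w r : Fin 3 → ℝ → E3 → ℝ} {π p : ℝ → E3 → ℝ},
      Perturbation α γ ν t₀ t₁ τ Λ E ρ c u v w r π p → ∀ t ∈ Icc t₀ t₁,
      ∀ θ : List (Fin 3), θ.length = N → ∀ k,
        HB α (C * (τ * E) * ρ ^ N) (Dw θ (w k t)) ∧ HB α (C * E * ρ ^ N) (Dw θ (D k (π t))) := by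
  induction N using Nat.strong_induction_on with
  | _ N ih =>
  by_cases hα : 0 < α ∧ α < 1 ∧ 1 ≤ c 0
  swap
  · exact ⟨1, le_rfl, fun P => absurd ⟨P.α_pos, P.α_lt, P.one_le_c 0⟩ hα⟩
  obtain ⟨hα0, hα1, hc0⟩ := hα
  have hcz := czConst_pos hα0 hα1
  choose! C hC1 hC using ih
  -- a bound for the forces implies the theorem
  have finish : ∀ G : ℝ, 1 ≤ G → (∀ {γ ν t₀ t₁ τ Λ E ρ : ℝ} {u v w r : Fin 3 → ℝ → E3 → ℝ}
      {π p : ℝ → E3 → ℝ}, Perturbation α γ ν t₀ t₁ τ Λ E ρ c u v w r π p → ∀ t ∈ Icc t₀ t₁,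
      ∀ Z, (∀ θ : List (Fin 3), θ.length = N → ∀ k, HB α Z (Dw θ (w k t))) →
      ∀ θ : List (Fin 3), θ.length = N → ∀ k,
        HB α (G * (Λ * Z + E * ρ ^ N)) (fun x =>
          Dw θ (fun x => D k (π t) x - r k t x - ∑ j, w j t x * D j (u k t) x) x
          - ∑ j, ((properSplits θ).map fun p => Dw p.1 (v j t) x * Dw p.2 (D j (w k t)) x).sum) ∧
        HB α (G * (Λ * Z + E * ρ ^ N)) (Dw θ (D k (π t)))) →
      ∃ C : ℝ, 1 ≤ C ∧ ∀ {γ ν t₀ t₁ τ Λ E ρ : ℝ} {u v w r : Fin 3 → ℝ → E3 → ℝ}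
      {π p : ℝ → E3 → ℝ}, Perturbation α γ ν t₀ t₁ τ Λ E ρ c u v w r π p → ∀ t ∈ Icc t₀ t₁,
      ∀ θ : List (Fin 3), θ.length = N → ∀ k,
        HB α (C * (τ * E) * ρ ^ N) (Dw θ (w k t)) ∧ HB α (C * E * ρ ^ N) (Dw θ (D k (π t))) := by
    intro G hG hF
    set M := 4 * G * Real.exp (8 * G + 144 * c 0 + 2) with hM
    have hM0 : 0 < M := by positivity
    refine ⟨G * (M + 1), by nlinarith, ?_⟩
    intro γ ν t₀ t₁ τ Λ E ρ u v w r π p P t ht θ hθ k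
    have hρ := P.ρ_pos
    have hΛ := P.Λ_pos
    have hE := P.E_nonneg
    have hτ := P.τ_pos
    have key := P.closing (ι := (Fin N → Fin 3) × Fin 3)
      (φ := fun i t => Dw (List.ofFn i.1) (w i.2 t))
      (g := fun i t x => Dw (List.ofFn i.1) (fun x => D i.2 (π t) x - r i.2 t x
        - ∑ j, w j t x * D j (u i.2 t) x) x - ∑ j, ((properSplits (List.ofFn i.1)).map fun p =>
          Dw p.1 (v j t) x * Dw p.2 (D j (w i.2 t)) x).sum)
      (fun i => (P.stp_w i.2).Dw P.lt _) (fun i => by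
        have : w i.2 t₀ = fun _ => 0 := by
          rw [P.w_slice, P.init]; ext x; ring
        simp only [this, Dw_zero])
      (fun i t ht x => transport_Dw P.lt P.γ_pos P.γ_lt (P.stp_w i.2) P.stp_v
        (g := fun t x => D i.2 (π t) x - r i.2 t x - ∑ j, w j t x * D j (u i.2 t) x)
        (fun t ht x => P.eq_w i.2 t ht x) _ ht x)
      hG (X := E * ρ ^ N) (by positivity) (fun t ht Z _ hZ i =>
        (hF P t ht Z (fun θ hθ k => by
          subst hθ
          have := hZ (θ.get, k)
          simpa only [List.ofFn_get] using this) (List.ofFn i.1) (by simp) i.2).1)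
    have hw : ∀ θ : List (Fin 3), θ.length = N → ∀ k, HB α (M * (τ * (E * ρ ^ N))) (Dw θ (w k t)) :=
      fun θ hθ k => by
        subst hθ
        have := key t ht (θ.get, k)
        simpa only [List.ofFn_get] using this
    refine ⟨(hw θ hθ k).mono ?_, ((hF P t ht _ hw θ hθ k).2).mono ?_⟩
    · have h1 : 0 ≤ τ * (E * ρ ^ N) := by positivity
      have h2 : M ≤ G * (M + 1) := by nlinarith
      calc _ ≤ G * (M + 1) * (τ * (E * ρ ^ N)) := mul_le_mul_of_nonneg_right h2 h1
        _ = _ := by ring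
    · have h3 : τ * Λ * (M * (E * ρ ^ N)) ≤ M * (E * ρ ^ N) :=
        mul_le_of_le_one_left (by positivity) P.time_small
      calc G * (Λ * (M * (τ * (E * ρ ^ N))) + E * ρ ^ N)
          = G * (τ * Λ * (M * (E * ρ ^ N)) + E * ρ ^ N) := by ring
        _ ≤ G * (M * (E * ρ ^ N) + E * ρ ^ N) := by gcongr
        _ = _ := by ring
  rcases Nat.eq_zero_or_pos N with rfl | hN
  · refine finish ((30 * czConst α + 7) * c 0) (by nlinarith) ?_
    intro γ ν t₀ t₁ τ Λ E ρ u v w r π p P t ht Z hZ θ hθ k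
    obtain rfl := List.length_eq_zero_iff.1 hθ
    have hZ' : ∀ k, HB α Z (w k t) := hZ [] rfl
    refine ⟨?_, ?_⟩
    · have := P.hb_forcing_zero ht hZ' k
      simpa [Dw, properSplits] using this
    · refine (P.hb_pressure_zero ht hZ' k).mono ?_
      have : 0 ≤ Λ * Z + E := add_nonneg (mul_nonneg P.Λ_pos.le (hZ' 0).nonneg) P.E_nonneg
      rw [pow_zero, mul_one]
      refine mul_le_mul_of_nonneg_right ?_ this
      nlinarith
  · set K := ∑ j ∈ Finset.range (N + 1), (|C j| + |c j|) with hK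
    have hle : ∀ j ≤ N, |C j| + |c j| ≤ K := fun j hj =>
      Finset.single_le_sum (f := fun j => |C j| + |c j|) (fun j _ => by positivity)
        (Finset.mem_range.2 (Nat.lt_succ_of_le hj))
    have hK1 : 1 ≤ K := by
      have := hle 0 (Nat.zero_le _)
      have := le_abs_self (c 0)
      have := abs_nonneg (C 0)
      linarith
    have h2N : (1 : ℝ) ≤ 2 ^ N := one_le_pow₀ one_le_two
    have hp : 0 ≤ czConst α * (27 * 2 ^ N + 1) := by positivity
    refine finish ((czConst α * (27 * 2 ^ N + 1) + 9 * 2 ^ N + 1) * (10 * K ^ 2)) (by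
      have : 1 ≤ 10 * K ^ 2 := by nlinarith
      nlinarith) ?_
    intro γ ν t₀ t₁ τ Λ E ρ u v w r π p P t ht Z hZ θ hθ k
    have hρ := P.ρ_pos
    have hE := P.E_nonneg
    have hτ := P.τ_pos
    have L : Lower α τ E ρ c w N t K Z := by
      refine ⟨fun j hj => ?_, fun m hm θ hθ k => ?_, hZ⟩
      · have := hle j hj
        have := le_abs_self (c j)
        have := abs_nonneg (C j)
        linarith
      · refine (hC m hm P t ht θ hθ k).1.mono ?_
        have : C m ≤ K := by
          have := hle m hm.le
          have := le_abs_self (C m)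
          have := abs_nonneg (c m)
          linarith
        gcongr
    have hZ0 : 0 ≤ Z := (hZ θ hθ 0).nonneg
    refine ⟨(P.hb_forcing ht L hθ hN k).mono (le_of_eq (by ring)),
      (P.hb_pressure ht L hθ hN k).mono ?_⟩
    have : 0 ≤ Λ * Z + E * ρ ^ N := by
      have := P.Λ_pos
      positivity
    calc _ = czConst α * (27 * 2 ^ N + 1) * (10 * K ^ 2) * (Λ * Z + E * ρ ^ N) := by ring
      _ ≤ _ := by
        gcongr
        linarith

end Perturbation

theorem D_translate (f : E3 → ℝ) (a : E3) (i : Fin 3) (x : E3) :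
    D i (fun z => f (z + a)) x = D i f (x + a) := by
  simp only [D]
  rw [fderiv_comp_add_right]

/-- The fractional Laplacian is bounded on Hölder spaces for functions which live at the length
scale `r`. -/
theorem HB.fracLapScalar {γ α K r : ℝ} {f : E3 → ℝ} (h0 : 0 < γ) (h1 : γ < 1 / 2) (hf : SP f)
    (hr : 0 < r) (hK : HB α K f) (hD : ∀ i, HB α (K / r) (D i f)) :
    HB α (3 * fracConst γ * (r ^ (-2 * γ) * K)) (FracNS.fracLapScalar γ f) := by
  have hK0 := hK.nonneg
  refine ⟨fun x => ?_, fun x y => ?_⟩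
  · have := abs_fracLapScalar_le h0 h1 hf hr (K := 3 * K) (fun x => (hK.sup x).trans (by linarith))
      (fun x y => by
        have := hf.lipschitz_of_D (fun i x => (hD i).sup x) x y
        rwa [← mul_div_assoc] at this) x
    exact this.trans (le_of_eq (by ring))
  · set a := x - y with ha
    have hg : SP fun z => f (z + a) - f z := (hf.translate a).sub hf
    have h2 := abs_fracLapScalar_le h0 h1 hg hr (K := 3 * (K * ‖a‖ ^ α)) (fun z => by
        have := hK.hol (z + a) z
        rw [add_sub_cancel_left] at this
        have : 0 ≤ K * ‖a‖ ^ α := by positivity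
        linarith)
      (fun z z' => by
        have := hg.lipschitz_of_D (B := K / r * ‖a‖ ^ α) (fun i z => by
          rw [D_sub (hf.translate a) hf]
          simp only [D_translate]
          have := (hD i).hol (z + a) z
          rwa [add_sub_cancel_left] at this) z z'
        refine this.trans (le_of_eq ?_)
        ring) y
    rw [fracLapScalar_sub h0 h1 (hf.translate a) hf, fracLapScalar_translate h0 h1 hf,
      show y + a = x by rw [ha]; abel] at h2
    exact h2.trans (le_of_eq (by ring))

namespace Perturbation

variable {α γ ν t₀ t₁ τ Λ E ρ : ℝ} {c : ℕ → ℝ} {u v w r : Fin 3 → ℝ → E3 → ℝ} {π p : ℝ → E3 → ℝ}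

/-- The forces in the equation of the difference along the flow of `u`. -/
theorem dissipative_bound (α : ℝ) (c : ℕ → ℝ) (N : ℕ) :
    ∃ C : ℝ, 1 ≤ C ∧ ∀ {γ ν t₀ t₁ τ Λ E ρ : ℝ} {u v w r : Fin 3 → ℝ → E3 → ℝ} {π p : ℝ → E3 → ℝ},
      Perturbation α γ ν t₀ t₁ τ Λ E ρ c u v w r π p → ∀ t ∈ Icc t₀ t₁,
      ∀ θ : List (Fin 3), θ.length = N → ∀ k,
        HB α (C * E * ρ ^ N) (Dw θ fun x => (D k (π t) x - r k t x
          - ∑ j, w j t x * D j (u k t) x) - ∑ j, w j t x * D j (w k t) x) := by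
  choose C hC1 hC using main_bound α c
  set K := ∑ j ∈ Finset.range (N + 2), (C j + |c j|) with hK
  have hle : ∀ j ≤ N + 1, C j + |c j| ≤ K := fun j hj =>
    Finset.single_le_sum (f := fun j => C j + |c j|)
      (fun j _ => add_nonneg (by linarith [hC1 j]) (abs_nonneg _))
      (Finset.mem_range.2 (Nat.lt_succ_of_le hj))
  have hCK : ∀ j ≤ N + 1, C j ≤ K := fun j hj => by linarith [hle j hj, abs_nonneg (c j)]
  have hcK : ∀ j ≤ N + 1, c j ≤ K := fun j hj => by
    linarith [hle j hj, le_abs_self (c j), hC1 j]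
  have hK1 : 1 ≤ K := (hC1 0).trans (hCK 0 (Nat.zero_le _))
  refine ⟨2 * K + 12 * 2 ^ N * K ^ 2, ?_, ?_⟩
  · have : 0 ≤ 12 * 2 ^ N * K ^ 2 := by positivity
    linarith
  intro γ ν t₀ t₁ τ Λ E ρ u v w r π p P t ht θ hθ k
  have hwt := fun k => (P.stp_w k).slice ht
  have hut := fun k => (P.stp_u k).slice ht
  have hrt := fun k => (P.stp_r k).slice ht
  have hπt := P.stp_π.slice ht
  have hρ := P.ρ_pos
  have hΛ := P.Λ_pos
  have hE := P.E_nonneg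
  have hτ := P.τ_pos
  have hwb : ∀ (m : ℕ) (s : List (Fin 3)), s.length = m → m ≤ N + 1 → ∀ k,
      HB α (K * (τ * E) * ρ ^ m) (Dw s (w k t)) := fun m s hs hm k => by
    refine (hC m P t ht s hs k).1.mono ?_
    have := hCK m hm
    gcongr
  have b1 := (hC N P t ht θ hθ k).2.mono (K' := K * E * ρ ^ N) (by
    have := hCK N (by omega)
    gcongr)
  have b2 := (P.hb_r N θ hθ t ht k).mono (K' := K * E * ρ ^ N) (by
    have := hcK N (by omega)
    gcongr)
  have b3 : ∀ j, HB α (2 ^ N * (2 * K ^ 2 * (E * ρ ^ N))) (Dw θ fun x => w j t x * D j (u k t) x) := by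
    intro j
    rw [← hθ]
    refine HB.Dw_mul (hwt j) ((hut k).D j) θ fun s s' hs => ?_
    rw [Dw_D_eq_cons (hut k)]
    have d1 := hwb s.length s rfl (by omega) j
    have d2 := (P.hb_u s'.length (j :: s') rfl t ht k).mono (K' := K * Λ * ρ ^ s'.length) (by
      have := hcK s'.length (by omega)
      gcongr)
    refine (d1.mul d2).mono ?_
    rw [← hs, pow_add]
    have := mul_le_mul_of_nonneg_right P.time_small
      (by positivity : 0 ≤ 2 * K ^ 2 * (E * (ρ ^ s.length * ρ ^ s'.length)))
    linarith
  have b4 : ∀ j, HB α (2 ^ N * (2 * K ^ 2 * (E * ρ ^ N))) (Dw θ fun x => w j t x * D j (w k t) x) := by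
    intro j
    rw [← hθ]
    refine HB.Dw_mul (hwt j) ((hwt k).D j) θ fun s s' hs => ?_
    rw [Dw_D_eq_cons (hwt k)]
    have d1 := hwb s.length s rfl (by omega) j
    have d2 := hwb (s'.length + 1) (j :: s') rfl (by omega) k
    refine (d1.mul d2).mono ?_
    rw [← hs, pow_add, pow_add, pow_one]
    have h1 : τ * (τ * E * ρ) ≤ 1 :=
      (mul_le_mul_of_nonneg_left P.force_small hτ.le).trans P.time_small
    have := mul_le_mul_of_nonneg_right h1
      (by positivity : 0 ≤ 2 * K ^ 2 * (E * (ρ ^ s.length * ρ ^ s'.length)))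
    linarith
  have s3 : ∀ j ∈ Finset.univ, SP fun x => w j t x * D j (u k t) x := fun j _ =>
    (hwt j).mul ((hut k).D j)
  have s4 : ∀ j ∈ Finset.univ, SP fun x => w j t x * D j (w k t) x := fun j _ =>
    (hwt j).mul ((hwt k).D j)
  rw [Dw_sub (((hπt.D k).sub (hrt k)).sub (SP.sum _ s3)) (SP.sum _ s4),
    Dw_sub ((hπt.D k).sub (hrt k)) (SP.sum _ s3), Dw_sub (hπt.D k) (hrt k), Dw_sum _ s3, Dw_sum _ s4]
  exact (((b1.sub b2).sub (HB.sum3 b3)).sub (HB.sum3 b4)).mono (le_of_eq (by ring))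

end Perturbation

/-! ### Hölder norms of vector fields -/

theorem partialD_eq_Dw {f : E3 → ℝ} (hf : ContDiff ℝ ∞ f) (m : ℕ) (θ : Fin m → Fin 3) :
    partialD m θ f = Dw (List.ofFn θ) f := by
  induction m with
  | zero =>
    ext x
    simp [partialD, Dw]
  | succ m ih =>
    ext x
    rw [List.ofFn_succ, Dw, ← ih, partialD, iteratedFDeriv_succ_apply_left, D]
    have hd : DifferentiableAt ℝ (iteratedFDeriv ℝ m f) x :=
      (hf.differentiable_iteratedFDeriv (m := m) (by exact_mod_cast WithTop.coe_lt_top _)) x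
    have h1 : HasFDerivAt (partialD m (fun i => θ i.succ) f)
        ((ContinuousMultilinearMap.apply ℝ (fun _ : Fin m => E3) ℝ
          (fun j => e (θ j.succ))).comp (fderiv ℝ (iteratedFDeriv ℝ m f) x)) x :=
      ((ContinuousMultilinearMap.apply ℝ (fun _ : Fin m => E3) ℝ
        (fun j => e (θ j.succ))).hasFDerivAt).comp x hd.hasFDerivAt
    rw [h1.fderiv]
    rfl

theorem partialD_comp {F : Type*} [NormedAddCommGroup F] [NormedSpace ℝ F] {f : E3 → F}
    (hf : ContDiff ℝ ∞ f) (L : F →L[ℝ] ℝ) (m : ℕ) (θ : Fin m → Fin 3) (x : E3) :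
    L (partialD m θ f x) = Dw (List.ofFn θ) (fun y => L (f y)) x := by
  rw [← partialD_eq_Dw (f := fun y => L (f y)) (L.contDiff.comp hf), partialD, partialD]
  have := L.iteratedFDeriv_comp_left (i := m) (hf.contDiffAt (x := x))
    (by exact_mod_cast le_top)
  change _ = iteratedFDeriv ℝ m (L ∘ f) x _
  rw [this]
  rfl

theorem partialD_coord {f : E3 → E3} (hf : ∀ k, ContDiff ℝ ∞ fun y => f y k) (m : ℕ)
    (θ : Fin m → Fin 3) (x : E3) (k : Fin 3) :
    partialD m θ f x k = Dw (List.ofFn θ) (fun y => f y k) x :=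
  partialD_comp (contDiff_euclidean.2 hf) (EuclideanSpace.proj k) m θ x

/-- Bounds for the components of a vector field bound its Hölder norm. -/
theorem holderNorm_le {α K : ℝ} {f : E3 → E3} (hf : ∀ k, ContDiff ℝ ∞ fun y => f y k) {N : ℕ}
    (hK : ∀ j ≤ N, ∀ θ : List (Fin 3), θ.length = j → ∀ k, HB α K (Dw θ fun y => f y k)) :
    holderNorm N α f ≤ ENNReal.ofReal (3 * (N + 2) * K) := by
  have hK0 : 0 ≤ K := (hK 0 (Nat.zero_le _) [] rfl 0).nonneg
  have h1 : ∀ j ≤ N, cSemi j f ≤ ENNReal.ofReal (3 * K) := fun j hj =>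
    iSup_le fun θ => iSup_le fun x => by
      rw [← ofReal_norm]
      refine ENNReal.ofReal_le_ofReal (norm_le_of_coord fun k => ?_)
      rw [partialD_coord hf]
      exact (hK j hj _ (by simp) k).sup x
  have h2 : holderSemi N α f ≤ ENNReal.ofReal (3 * K) := by
    refine iSup_le fun θ => iSup_le fun x => iSup_le fun y => iSup_le fun hxy => ?_
    have hpos : 0 < ‖x - y‖ := norm_pos_iff.2 (sub_ne_zero.2 hxy)
    rw [← ofReal_norm, ← ofReal_norm, ENNReal.ofReal_rpow_of_pos hpos,
      ← ENNReal.ofReal_div_of_pos (Real.rpow_pos_of_pos hpos _)]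
    refine ENNReal.ofReal_le_ofReal ?_
    rw [div_le_iff₀ (Real.rpow_pos_of_pos hpos _), mul_assoc]
    refine norm_le_of_coord fun k => ?_
    have e1 : (partialD N θ f x - partialD N θ f y) k
        = Dw (List.ofFn θ) (fun y => f y k) x - Dw (List.ofFn θ) (fun y => f y k) y := by
      rw [← partialD_coord hf, ← partialD_coord hf]
      rfl
    rw [e1]
    exact (hK N le_rfl _ (by simp) k).hol x y
  have h3 : cNorm N f ≤ ENNReal.ofReal ((N + 1) * (3 * K)) := by
    refine (Finset.sum_le_sum fun j hj => h1 j (Nat.lt_succ_iff.1 (Finset.mem_range.1 hj))).trans ?_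
    have : ((N : ℝ) + 1) = ((N + 1 : ℕ) : ℝ) := by push_cast; ring
    rw [Finset.sum_const, Finset.card_range, nsmul_eq_mul, this,
      ENNReal.ofReal_mul (Nat.cast_nonneg _), ENNReal.ofReal_natCast]
  calc holderNorm N α f ≤ ENNReal.ofReal ((N + 1) * (3 * K)) + ENNReal.ofReal (3 * K) :=
        add_le_add h3 h2
    _ = ENNReal.ofReal (3 * (N + 2) * K) := by
      rw [← ENNReal.ofReal_add (by positivity) (by positivity)]
      congr 1; ring

theorem abs_D_le_of_cNorm {f : E3 → E3} (hf : ContDiff ℝ ∞ f) {B : ℝ} (hB : 0 ≤ B)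
    (h : cNorm 1 f ≤ ENNReal.ofReal B) (i k : Fin 3) (x : E3) : |D i (fun y => f y k) x| ≤ B := by
  have h1 : ‖partialD 1 (fun _ => i) f x‖ₑ ≤ ENNReal.ofReal B := by
    refine le_trans ?_ h
    refine le_trans ?_ (Finset.single_le_sum (f := fun j => cSemi j f) (fun _ _ => zero_le)
      (Finset.mem_range.2 (by norm_num : 1 < 1 + 1)))
    exact (le_iSup (fun x => ‖partialD 1 (fun _ => i) f x‖ₑ) x).trans
      (le_iSup (fun θ : Fin 1 → Fin 3 => ⨆ x, ‖partialD 1 θ f x‖ₑ) fun _ => i)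
  rw [← ofReal_norm, ENNReal.ofReal_le_ofReal_iff hB] at h1
  have h2 := partialD_coord (fun k => contDiff_euclidean.1 hf k) 1 (fun _ => i) x k
  have h3 : Dw (List.ofFn fun _ : Fin 1 => i) (fun y => f y k) x = D i (fun y => f y k) x := by
    simp [Dw]
  rw [← h3, ← h2]
  exact (abs_coord_le _ k).trans h1

theorem abs_le_of_cNorm {f : E3 → Mat3} {B : ℝ} (hB : 0 ≤ B)
    (h : cNorm 0 f ≤ ENNReal.ofReal B) (i k : Fin 3) (x : E3) : |f x i k| ≤ B := by
  have h1 : ‖partialD 0 (fun _ => i) f x‖ₑ ≤ ENNReal.ofReal B := by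
    refine le_trans ?_ h
    refine le_trans ?_ (Finset.single_le_sum (f := fun j => cSemi j f) (fun _ _ => zero_le)
      (Finset.mem_range.2 (by norm_num : 0 < 0 + 1)))
    exact (le_iSup (fun x => ‖partialD 0 (fun _ => i) f x‖ₑ) x).trans
      (le_iSup (fun θ : Fin 0 → Fin 3 => ⨆ x, ‖partialD 0 θ f x‖ₑ) fun _ => i)
  rw [← ofReal_norm, ENNReal.ofReal_le_ofReal_iff hB] at h1
  have h2 : partialD 0 (fun _ => i) f x = f x := by simp [partialD]
  rw [h2] at h1
  calc |f x i k| = ‖f x i k‖ := rfl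
    _ ≤ ‖f x i‖ := norm_le_pi_norm _ k
    _ ≤ ‖f x‖ := norm_le_pi_norm _ i
    _ ≤ B := h1

/-! ### Coordinates -/

theorem gradient_coord (f : E3 → ℝ) (x : E3) (k : Fin 3) : gradient f x k = D k f x := by
  have h := congrArg (fun L : E3 →L[ℝ] ℝ => L (e k))
    ((InnerProductSpace.toDual ℝ E3).apply_symm_apply (fderiv ℝ f x))
  simp only [InnerProductSpace.toDual_apply_apply] at h
  rw [D, ← h]
  rw [e, EuclideanSpace.inner_single_right]
  simp [gradient]

theorem derivWithin_coord {W : ℝ → E3 → E3} {t₀ t₁ : ℝ} (h : t₀ < t₁)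
    (hW : ∀ k, STP t₀ t₁ fun t y => W t y k) {t : ℝ} (ht : t ∈ Icc t₀ t₁) (x : E3) (k : Fin 3) :
    derivWithin (fun s => W s x) (Icc t₀ t₁) t k = dt t₀ t₁ (fun t y => W t y k) t x := by
  have h1 : DifferentiableWithinAt ℝ (fun s => W s x) (Icc t₀ t₁) t :=
    differentiableWithinAt_euclidean.2 fun k =>
      ((hW k).hasDerivWithinAt_dt h ht x).differentiableWithinAt
  have h2 := ((EuclideanSpace.proj k : E3 →L[ℝ] ℝ).hasFDerivAt).comp_hasDerivWithinAt t
    h1.hasDerivWithinAt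
  exact (h2.derivWithin (uniqueDiffOn_Icc h t ht)).symm

theorem fderiv_coord {f : E3 → E3} (hf : ∀ k, Differentiable ℝ fun y => f y k) (x a : E3)
    (k : Fin 3) : fderiv ℝ f x a k = ∑ j, a j * D j (fun y => f y k) x := by
  have h1 : DifferentiableAt ℝ f x := differentiableAt_euclidean.2 fun k => hf k x
  have h2 := ((EuclideanSpace.proj k : E3 →L[ℝ] ℝ).hasFDerivAt).comp x h1.hasFDerivAt
  rw [← fderiv_eq_sum]
  have h3 : fderiv ℝ (fun y => f y k) x = _ := h2.fderiv
  rw [h3]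
  rfl

/-! ### Parameters -/

section Parameters

variable {β γ b α a : ℝ} {q : ℕ}

/-- The threshold for `α`. With `x = bβ - β + 1 + 3α/2`, so that `ℓ` is of order `λ_q ^ (-x)`, the second
entry says `x ≤ (3/2)(1 - β)`. This gives `ℓ ≥ λ_q ^ (-3/2) / 2`, and with `τ_q ≤ λ_q ^ (β - 1)` also
that `τ_q ℓ ^ (-2/3)` is bounded. -/
def alphaThreshold (β b : ℝ) : ℝ := min (1 / 10) ((1 - β - 2 * β * b) / 3)

theorem alphaThreshold_pos (h : Admissible β b) : 0 < alphaThreshold β b := by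
  obtain ⟨h1, -, -, h4⟩ := h
  have h5 := h4.trans_le (min_le_left _ _)
  rw [lt_div_iff₀ (by positivity)] at h5
  exact lt_min (by norm_num) (by linarith)

theorem le_lam (a b : ℝ) (q : ℕ) : a ^ (b ^ q) ≤ lam a b q := by
  have h1 : a ^ (b ^ q) ≤ (⌈a ^ (b ^ q)⌉₊ : ℝ) := Nat.le_ceil _
  have h2 := Real.pi_gt_three
  have h3 : (0 : ℝ) ≤ (⌈a ^ (b ^ q)⌉₊ : ℝ) := Nat.cast_nonneg _
  rw [lam]
  nlinarith

theorem base_le_lam (ha : 1 ≤ a) (hb : 1 ≤ b) : a ≤ lam a b q := by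
  refine le_trans ?_ (le_lam a b q)
  conv_lhs => rw [← Real.rpow_one a]
  exact Real.rpow_le_rpow_of_exponent_le ha (one_le_pow₀ hb)

theorem lam_le_succ (ha : 1 ≤ a) (hb : 1 ≤ b) : lam a b q ≤ lam a b (q + 1) := by
  have h1 : a ^ (b ^ q) ≤ a ^ (b ^ (q + 1)) :=
    Real.rpow_le_rpow_of_exponent_le ha (pow_le_pow_right₀ hb (Nat.le_succ q))
  have h2 : (⌈a ^ (b ^ q)⌉₊ : ℝ) ≤ (⌈a ^ (b ^ (q + 1))⌉₊ : ℝ) := by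
    exact_mod_cast Nat.ceil_mono h1
  have := Real.pi_pos
  unfold lam
  gcongr

/-- The rounding in the definition of `λ_{q+1}` costs a factor `2` at most. -/
theorem lam_succ_le (ha : 1 ≤ a) (hb : 1 ≤ b) : lam a b (q + 1) ≤ 2 * lam a b q ^ b := by
  set y := a ^ (b ^ q) with hy
  have hy1 : 1 ≤ y := Real.one_le_rpow ha (by positivity)
  have hpi := Real.pi_gt_three
  have e1 : a ^ (b ^ (q + 1)) = y ^ b := by
    rw [hy, ← Real.rpow_mul (by linarith), pow_succ]
  have h1 : (⌈y ^ b⌉₊ : ℝ) ≤ 2 * y ^ b := by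
    have h2 := (Nat.ceil_lt_add_one (by positivity : 0 ≤ y ^ b)).le
    have h3 : 1 ≤ y ^ b := Real.one_le_rpow hy1 (by linarith)
    linarith
  have h4 : 2 * Real.pi * y ^ b ≤ lam a b q ^ b := by
    have h5 : 2 * Real.pi * y ≤ lam a b q :=
      mul_le_mul_of_nonneg_left (Nat.le_ceil _) (by positivity)
    have h6 : (2 * Real.pi * y) ^ b ≤ lam a b q ^ b :=
      Real.rpow_le_rpow (by positivity) h5 (by linarith)
    rw [Real.mul_rpow (by positivity) (by positivity)] at h6
    refine le_trans ?_ h6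
    have h7 : 2 * Real.pi ≤ (2 * Real.pi) ^ b := by
      conv_lhs => rw [← Real.rpow_one (2 * Real.pi)]
      exact Real.rpow_le_rpow_of_exponent_le (by linarith) hb
    gcongr
  rw [lam, e1]
  have : 2 * Real.pi * (⌈y ^ b⌉₊ : ℝ) ≤ 2 * Real.pi * (2 * y ^ b) := by gcongr
  linarith

theorem sqrt_del (h : 0 < lam a b q) : Real.sqrt (del β a b q) = lam a b q ^ (-β) := by
  rw [del, Real.sqrt_eq_rpow, ← Real.rpow_mul h.le]
  congr 1; ring

/-- The relations between the parameters which are used in the proof: `tau_mul` says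
`τ_q Λ = ℓ^α` for `Λ = δ_q^{1/2} λ_q ℓ^{-α}`, `ell_sq` says that the commutator of the mollification
has the size of the stress, `lam_rpow_le` bounds the stress in terms of `ℓ`, `force_le` says that the
force changes the gradient by `Λ` at most, and `tau_ell_le` controls the dissipation. -/
structure Params (β α a b : ℝ) (q : ℕ) : Prop where
  one_le_lam : 1 ≤ lam a b q
  del_pos : 0 < del β a b (q + 1)
  sqrt_del_pos : 0 < Real.sqrt (del β a b q)
  ell_pos : 0 < ell β α a b q
  ell_le_one : ell β α a b q ≤ 1
  ell_le : ell β α a b q ≤ a⁻¹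
  tau_pos : 0 < tau β α a b q
  ell_sq : ell β α a b q ^ 2 * (Real.sqrt (del β a b q) * lam a b q) ^ 2
    = del β a b (q + 1) * lam a b q ^ (-3 * α)
  tau_mul : tau β α a b q * (Real.sqrt (del β a b q) * lam a b q * ell β α a b q ^ (-α))
    = ell β α a b q ^ α
  lam_rpow_le : lam a b q ^ (-3 * α) ≤ 2 * ell β α a b q ^ (2 * α)
  force_le : tau β α a b q * (del β a b (q + 1) * ell β α a b q ^ (-1 + α)) * (ell β α a b q)⁻¹
    ≤ Real.sqrt (del β a b q) * lam a b q * ell β α a b q ^ (-α)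
  tau_ell_le : ∀ γ : ℝ, γ < 1 / 3 → tau β α a b q * ell β α a b q ^ (-2 * γ) ≤ 2

theorem params (h : Admissible β b) (hα0 : 0 < α) (hα : α < alphaThreshold β b) (ha : 1 ≤ a)
    (q : ℕ) : Params β α a b q := by
  obtain ⟨hβ0, hβ1, hb1, hb2⟩ := h
  have hα1 : α < 1 / 10 := hα.trans_le (min_le_left _ _)
  have hα2 : 3 * α < 1 - β - 2 * β * b := by
    have := hα.trans_le (min_le_right _ _)
    linarith
  have hal : a ≤ lam a b q := base_le_lam ha hb1.le
  have hll : lam a b q ≤ lam a b (q + 1) := lam_le_succ ha hb1.le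
  have hlu : lam a b (q + 1) ≤ 2 * lam a b q ^ b := lam_succ_le ha hb1.le
  have hl1 : 1 ≤ lam a b q := ha.trans hal
  have hl0 : 0 < lam a b q := by linarith
  have hs := sqrt_del (β := β) hl0
  have hs' := sqrt_del (β := β) (hl0.trans_le hll)
  have hdel : 0 < del β a b (q + 1) := Real.rpow_pos_of_pos (hl0.trans_le hll) _
  have hdel0 : 0 < del β a b q := Real.rpow_pos_of_pos hl0 _
  have hs0 : 0 < Real.sqrt (del β a b q) := Real.sqrt_pos.2 hdel0
  have hs'0 : 0 < Real.sqrt (del β a b (q + 1)) := Real.sqrt_pos.2 hdel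
  have hsq : Real.sqrt (del β a b (q + 1)) ^ 2 = del β a b (q + 1) := Real.sq_sqrt hdel.le
  have hell0 : 0 < ell β α a b q := by
    unfold ell
    have := Real.rpow_pos_of_pos hl0 (1 + 3 * α / 2)
    positivity
  have htau : tau β α a b q = ell β α a b q ^ (2 * α) / (Real.sqrt (del β a b q) * lam a b q) := rfl
  have hell : ell β α a b q = Real.sqrt (del β a b (q + 1)) /
    (Real.sqrt (del β a b q) * lam a b q ^ (1 + 3 * α / 2)) := rfl
  -- upper bound for `ℓ`
  have hellu : ell β α a b q ≤ (lam a b q)⁻¹ := by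
    have h1 : Real.sqrt (del β a b (q + 1)) ≤ Real.sqrt (del β a b q) := by
      rw [hs, hs']
      exact Real.rpow_le_rpow_of_nonpos hl0 hll (by linarith)
    have h2 : lam a b q ≤ lam a b q ^ (1 + 3 * α / 2) := by
      conv_lhs => rw [← Real.rpow_one (lam a b q)]
      exact Real.rpow_le_rpow_of_exponent_le hl1 (by linarith)
    rw [hell, ← one_div, div_le_div_iff₀ (by positivity) hl0, one_mul]
    exact mul_le_mul h1 h2 hl0.le hs0.le
  have hell1 : ell β α a b q ≤ 1 := hellu.trans (inv_le_one_of_one_le₀ hl1)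
  -- lower bound for `ℓ`
  set x := b * β - β + 1 + 3 * α / 2 with hx
  have helll : lam a b q ^ (-x) / 2 ≤ ell β α a b q := by
    have h1 : lam a b q ^ (-(b * β)) / 2 ≤ Real.sqrt (del β a b (q + 1)) := by
      rw [hs']
      have h2 : (2 * lam a b q ^ b) ^ (-β) ≤ lam a b (q + 1) ^ (-β) :=
        Real.rpow_le_rpow_of_nonpos (hl0.trans_le hll) hlu (by linarith)
      refine le_trans ?_ h2
      rw [Real.mul_rpow zero_le_two (by positivity), ← Real.rpow_mul hl0.le, mul_neg]
      have h3 : (1 / 2 : ℝ) ≤ 2 ^ (-β) := by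
        have := Real.rpow_le_rpow_of_exponent_le (x := 2) one_le_two (show -1 ≤ -β by linarith)
        rw [Real.rpow_neg_one] at this
        linarith
      have h4 := Real.rpow_pos_of_pos hl0 (-(b * β))
      nlinarith
    rw [hell, hs, ← Real.rpow_add hl0, le_div_iff₀ (Real.rpow_pos_of_pos hl0 _)]
    refine le_trans (le_of_eq ?_) h1
    rw [div_mul_eq_mul_div, ← Real.rpow_add hl0]
    congr 2
    rw [hx]; ring
  set A := ell β α a b q ^ α with hA
  have hA0 : 0 < A := Real.rpow_pos_of_pos hell0 _
  have eA2 : ell β α a b q ^ (2 * α) = A ^ 2 := by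
    rw [hA, ← Real.rpow_natCast, ← Real.rpow_mul hell0.le]; congr 1; push_cast; ring
  have eAn : ell β α a b q ^ (-α) = A⁻¹ := by rw [hA, Real.rpow_neg hell0.le]
  have eA1 : ell β α a b q ^ (-1 + α) = (ell β α a b q)⁻¹ * A := by
    rw [Real.rpow_add hell0, Real.rpow_neg_one]
  have hell_sq : ell β α a b q ^ 2 * (Real.sqrt (del β a b q) * lam a b q) ^ 2
      = del β a b (q + 1) * lam a b q ^ (-3 * α) := by
    have e1 : (lam a b q ^ (1 + 3 * α / 2)) ^ 2 = lam a b q ^ 2 * lam a b q ^ (3 * α) := by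
      rw [← Real.rpow_natCast, ← Real.rpow_natCast, ← Real.rpow_mul hl0.le, ← Real.rpow_add hl0]
      congr 1; push_cast; ring
    have e2 : lam a b q ^ (-3 * α) = (lam a b q ^ (3 * α))⁻¹ := by
      rw [← Real.rpow_neg hl0.le]; congr 1; ring
    have h3 := Real.rpow_pos_of_pos hl0 (3 * α)
    rw [hell, div_pow, mul_pow, hsq, e1, e2]
    field_simp
  refine ⟨hl1, hdel, hs0, hell0, hell1, hellu.trans (inv_anti₀ (by linarith) hal), ?_, hell_sq,
    ?_, ?_, ?_, ?_⟩
  · rw [htau]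
    have := Real.rpow_pos_of_pos hell0 (2 * α)
    positivity
  · rw [htau, eA2, eAn, ← hA]
    field_simp
  · have h1 : (lam a b q ^ (-(3 / 2) : ℝ) / 2) ^ (2 * α) ≤ ell β α a b q ^ (2 * α) := by
      refine Real.rpow_le_rpow (by positivity) (le_trans ?_ helll) (by linarith)
      have : lam a b q ^ (-(3 / 2) : ℝ) ≤ lam a b q ^ (-x) :=
        Real.rpow_le_rpow_of_exponent_le hl1 (by rw [hx]; linarith [mul_comm b β])
      linarith
    rw [Real.div_rpow (by positivity) zero_le_two, ← Real.rpow_mul hl0.le,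
      show -(3 / 2) * (2 * α) = -3 * α by ring] at h1
    have h2 : (2 : ℝ) ^ (2 * α) ≤ 2 := by
      have := Real.rpow_le_rpow_of_exponent_le (x := 2) one_le_two (show 2 * α ≤ 1 by linarith)
      rwa [Real.rpow_one] at this
    rw [div_le_iff₀ (by positivity)] at h1
    have := Real.rpow_pos_of_pos hell0 (2 * α)
    nlinarith
  · have h1 : A * lam a b q ^ α ≤ 1 := by
      rw [hA, ← Real.mul_rpow hell0.le hl0.le]
      refine Real.rpow_le_one (by positivity) ?_ hα0.le
      have := mul_le_mul_of_nonneg_right hellu hl0.le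
      rwa [inv_mul_cancel₀ hl0.ne'] at this
    have hA1 : A ≤ 1 := Real.rpow_le_one hell0.le hell1 hα0.le
    set B := lam a b q ^ α with hB
    have hB0 : 0 < B := Real.rpow_pos_of_pos hl0 _
    have e2 : lam a b q ^ (-3 * α) = (B ^ 3)⁻¹ := by
      rw [hB, ← Real.rpow_natCast, ← Real.rpow_mul hl0.le, ← Real.rpow_neg hl0.le]
      congr 1; push_cast; ring
    have h2 : A ^ 4 * B ^ 3 ≤ 1 := by
      have : (A * B) ^ 3 ≤ 1 := pow_le_one₀ (by positivity) h1
      calc A ^ 4 * B ^ 3 = A * (A * B) ^ 3 := by ring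
        _ ≤ 1 * 1 := mul_le_mul hA1 this (by positivity) zero_le_one
        _ = 1 := one_mul 1
    have h3 : del β a b (q + 1)
        = ell β α a b q ^ 2 * (Real.sqrt (del β a b q) * lam a b q) ^ 2 * B ^ 3 := by
      rw [hell_sq, e2]; field_simp
    rw [htau, eA2, eAn, eA1, h3]
    have e4 : A ^ 2 / (Real.sqrt (del β a b q) * lam a b q)
        * (ell β α a b q ^ 2 * (Real.sqrt (del β a b q) * lam a b q) ^ 2 * B ^ 3
          * ((ell β α a b q)⁻¹ * A)) * (ell β α a b q)⁻¹
        = (Real.sqrt (del β a b q) * lam a b q * A⁻¹) * (A ^ 4 * B ^ 3) := by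
      field_simp
    rw [e4]
    exact mul_le_of_le_one_right (by positivity) h2
  · intro γ hγ
    have h1 : tau β α a b q ≤ lam a b q ^ (β - 1) := by
      have h2 : ell β α a b q ^ (2 * α) ≤ 1 := Real.rpow_le_one hell0.le hell1 (by linarith)
      rw [htau, hs, div_le_iff₀ (by positivity)]
      have e1 : lam a b q ^ (β - 1) * (lam a b q ^ (-β) * lam a b q) = 1 := by
        nth_rewrite 3 [← Real.rpow_one (lam a b q)]
        rw [← Real.rpow_add hl0, ← Real.rpow_add hl0,
          show β - 1 + (-β + 1) = 0 by ring, Real.rpow_zero]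
      rw [e1]
      exact h2
    have h2 : ell β α a b q ^ (-2 * γ) ≤ 2 * lam a b q ^ (2 / 3 * x) := by
      calc ell β α a b q ^ (-2 * γ) ≤ ell β α a b q ^ (-(2 / 3) : ℝ) :=
            Real.rpow_le_rpow_of_exponent_ge hell0 hell1 (by linarith)
        _ ≤ (lam a b q ^ (-x) / 2) ^ (-(2 / 3) : ℝ) :=
            Real.rpow_le_rpow_of_nonpos (by positivity) helll (by norm_num)
        _ = 2 ^ (2 / 3 : ℝ) * lam a b q ^ (2 / 3 * x) := by
            rw [Real.div_rpow (by positivity) zero_le_two, ← Real.rpow_mul hl0.le,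
              Real.rpow_neg zero_le_two, div_inv_eq_mul, mul_comm]
            congr 2; ring
        _ ≤ _ := by
            gcongr
            have := Real.rpow_le_rpow_of_exponent_le (x := 2) one_le_two
              (show (2 / 3 : ℝ) ≤ 1 by norm_num)
            rwa [Real.rpow_one] at this
    calc _ ≤ lam a b q ^ (β - 1) * (2 * lam a b q ^ (2 / 3 * x)) :=
          mul_le_mul h1 h2 (Real.rpow_nonneg hell0.le _) (by positivity)
      _ = 2 * lam a b q ^ (β - 1 + 2 / 3 * x) := by rw [Real.rpow_add hl0]; ring
      _ ≤ 2 * 1 := by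
        gcongr
        exact Real.rpow_le_one_of_one_le_of_nonpos hl1 (by rw [hx]; linarith [mul_comm b β])
      _ = 2 := mul_one 2

end Parameters

/-! ### The mollified system -/

namespace IsReynoldsSolution

variable {ν γ t₀ t₁ : ℝ} {v : ℝ → E3 → E3} {p : ℝ → E3 → ℝ} {R : ℝ → E3 → Mat3}

theorem stp_v (S : IsReynoldsSolution ν γ t₀ t₁ v p R) (k : Fin 3) :
    STP t₀ t₁ fun t y => v t y k :=
  ⟨contDiffOn_euclidean.1 S.smooth_v k, fun t ht x i => by simp only [S.periodic_v t ht x i]⟩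

theorem stp_p (S : IsReynoldsSolution ν γ t₀ t₁ v p R) : STP t₀ t₁ p := ⟨S.smooth_p, S.periodic_p⟩

theorem stp_R (S : IsReynoldsSolution ν γ t₀ t₁ v p R) (i j : Fin 3) :
    STP t₀ t₁ fun t y => R t y i j :=
  ⟨contDiffOn_pi.1 (contDiffOn_pi.1 S.smooth_R i) j, fun t ht x k => by
    simp only [S.periodic_R t ht x k]⟩

theorem momentum_coord (h : t₀ < t₁) (S : IsReynoldsSolution ν γ t₀ t₁ v p R) (k : Fin 3) {t : ℝ}
    (ht : t ∈ Icc t₀ t₁) (x : E3) :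
    dt t₀ t₁ (fun t y => v t y k) t x + ∑ j, D j (fun y => v t y k * v t y j) x + D k (p t) x
      + ν * fracLapScalar γ (fun y => v t y k) x = ∑ j, D j (fun y => R t y k j) x := by
  have h1 := congrArg (fun z : E3 => z k) (S.momentum t ht x)
  simp only [PiLp.add_apply, PiLp.smul_apply, smul_eq_mul] at h1
  rw [derivWithin_coord h S.stp_v ht, gradient_coord] at h1
  exact h1

end IsReynoldsSolution

section Mollified

variable {ψ : E3 → ℝ}

/-- The pressure of the mollified system. -/
def mollPressure (ψ : E3 → ℝ) (l : ℝ) (v : Fin 3 → ℝ → E3 → ℝ) (p : ℝ → E3 → ℝ) (t : ℝ) (x : E3) :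
    ℝ :=
  avg ψ (-l) (p t) x + (1 / 3) * ∑ j, commut ψ (-l) (v j t) (v j t) x

/-- The components of the force `div R_ℓ` of the mollified system. -/
def mollForce (ψ : E3 → ℝ) (l : ℝ) (v : Fin 3 → ℝ → E3 → ℝ) (R : Fin 3 → Fin 3 → ℝ → E3 → ℝ)
    (k : Fin 3) (t : ℝ) (x : E3) : ℝ :=
  ∑ j, D j (avg ψ (-l) (R k j t)) x - ∑ j, D j (commut ψ (-l) (v k t) (v j t)) x
    + (1 / 3) * ∑ j, D k (commut ψ (-l) (v j t) (v j t)) x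

theorem STP.commut {t₀ t₁ : ℝ} (h : t₀ < t₁) {f g : ℝ → E3 → ℝ} (hf : STP t₀ t₁ f)
    (hg : STP t₀ t₁ g) (hψ : Integrable ψ) (c : ℝ) :
    STP t₀ t₁ fun t => FracNS.commut ψ c (f t) (g t) :=
  (STP.avg h (hf.mul hg) hψ c).sub ((hf.avg h hψ c).mul (hg.avg h hψ c))

variable {t₀ t₁ ν γ l : ℝ} {v : Fin 3 → ℝ → E3 → ℝ} {p : ℝ → E3 → ℝ}
  {R : Fin 3 → Fin 3 → ℝ → E3 → ℝ}

theorem stp_mollPressure (h : t₀ < t₁) (hv : ∀ k, STP t₀ t₁ (v k)) (hp : STP t₀ t₁ p)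
    (hψ : Integrable ψ) : STP t₀ t₁ (mollPressure ψ l v p) :=
  (hp.avg h hψ _).add ((STP.sum _ fun j _ => (hv j).commut h (hv j) hψ _).const_mul _)

theorem stp_mollForce (h : t₀ < t₁) (hv : ∀ k, STP t₀ t₁ (v k)) (hR : ∀ k j, STP t₀ t₁ (R k j))
    (hψ : Integrable ψ) (k : Fin 3) : STP t₀ t₁ (mollForce ψ l v R k) :=
  ((STP.sum _ fun j _ => ((hR k j).avg h hψ _).D h j).sub
    (STP.sum _ fun j _ => ((hv k).commut h (hv j) hψ _).D h j)).add
    ((STP.sum _ fun j _ => ((hv j).commut h (hv j) hψ _).D h k).const_mul _)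

theorem div_mollified (hψ : Integrable ψ) {v : Fin 3 → E3 → ℝ} (hv : ∀ k, SP (v k))
    (hdiv : ∀ x, ∑ k, D k (v k) x = 0) (x : E3) : ∑ k, D k (avg ψ (-l) (v k)) x = 0 := by
  have e1 : ∀ k, D k (avg ψ (-l) (v k)) x = avg ψ (-l) (D k (v k)) x := fun k => by
    rw [D_avg (hv k) hψ]
  simp only [e1]
  have e2 := congrFun (avg_sum Finset.univ (fun k _ => (hv k).D k) hψ (-l)) x
  rw [← e2, show (fun x => ∑ k, D k (v k) x) = fun _ => 0 from funext hdiv]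
  simp [avg]

/-- Divergence form and transport form of the convective term agree for divergence free fields. -/
theorem sum_D_mul {u : Fin 3 → E3 → ℝ} (hu : ∀ k, SP (u k)) (hdiv : ∀ x, ∑ k, D k (u k) x = 0)
    (k : Fin 3) (x : E3) : ∑ j, D j (fun y => u k y * u j y) x = ∑ j, u j x * D j (u k) x := by
  have e1 : ∀ j, D j (fun y => u k y * u j y) x = u j x * D j (u k) x + u k x * D j (u j) x :=
    fun j => by rw [D_mul (hu k) (hu j)]; ring
  simp only [e1, Finset.sum_add_distrib]
  rw [← Finset.mul_sum, hdiv, mul_zero, add_zero]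

/-- The mollified velocity solves the fractional Navier-Stokes equations with the force
`mollForce`. -/
theorem mollified_momentum (h : t₀ < t₁) (h0 : 0 < γ) (h1 : γ < 1 / 2) (hψ : Integrable ψ)
    (hv : ∀ k, STP t₀ t₁ (v k)) (hp : STP t₀ t₁ p) (hR : ∀ k j, STP t₀ t₁ (R k j))
    (hdiv : ∀ t ∈ Icc t₀ t₁, ∀ x, ∑ k, D k (v k t) x = 0)
    (heq : ∀ k, ∀ t ∈ Icc t₀ t₁, ∀ x, dt t₀ t₁ (v k) t x + ∑ j, D j (fun y => v k t y * v j t y) x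
      + D k (p t) x + ν * fracLapScalar γ (v k t) x = ∑ j, D j (R k j t) x)
    (k : Fin 3) {t : ℝ} (ht : t ∈ Icc t₀ t₁) (x : E3) :
    dt t₀ t₁ (fun t => avg ψ (-l) (v k t)) t x
      + ∑ j, avg ψ (-l) (v j t) x * D j (avg ψ (-l) (v k t)) x
      + D k (mollPressure ψ l v p t) x + ν * fracLapScalar γ (avg ψ (-l) (v k t)) x
      = mollForce ψ l v R k t x := by
  have hvt := fun k => (hv k).slice ht
  have hpt := hp.slice ht
  have hRt := fun k j => (hR k j).slice ht
  have hdt := ((hv k).dt h).slice ht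
  have hL := (hvt k).fracLapScalar h0 h1
  have hu := fun k => (hvt k).avg hψ (-l)
  have hc := fun k j => (hvt k).commut (hvt j) hψ (-l)
  have hm := fun j => (hvt k).mul (hvt j)
  -- the average of the equation
  have e1 : dt t₀ t₁ (v k) t = fun x => ((∑ j, D j (R k j t) x
      - ∑ j, D j (fun y => v k t y * v j t y) x) - D k (p t) x) - ν * fracLapScalar γ (v k t) x :=
    funext fun x => by linarith [heq k t ht x]
  have e2 := congrArg (fun f => avg ψ (-l) f x) e1
  have s1 : SP fun x => ∑ j, D j (R k j t) x := SP.sum _ fun j _ => (hRt k j).D j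
  have s2 : SP fun x => ∑ j, D j (fun y => v k t y * v j t y) x := SP.sum _ fun j _ => (hm j).D j
  rw [avg_sub ((s1.sub s2).sub (hpt.D k)) (hL.const_mul ν) hψ, avg_sub (s1.sub s2) (hpt.D k) hψ,
    avg_sub s1 s2 hψ, avg_sum _ (fun j _ => (hRt k j).D j) hψ, avg_sum _ (fun j _ => (hm j).D j) hψ,
    avg_const_mul, ← (hv k).dt_avg h hψ _ ht] at e2
  simp only [← fracLapScalar_avg h0 h1 (hvt k) hψ, ← D_avg hpt hψ, ← D_avg (hRt k _) hψ,
    ← D_avg (hm _) hψ] at e2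
  have e3 := sum_D_mul hu (fun x => div_mollified (l := l) hψ hvt (hdiv t ht) x) k x
  have e4 : ∀ j, D j (commut ψ (-l) (v k t) (v j t)) x
      = D j (avg ψ (-l) fun y => v k t y * v j t y) x
        - D j (fun y => avg ψ (-l) (v k t) y * avg ψ (-l) (v j t) y) x := fun j => by
    have : commut ψ (-l) (v k t) (v j t) = fun x => avg ψ (-l) (fun y => v k t y * v j t y) x
      - avg ψ (-l) (v k t) x * avg ψ (-l) (v j t) x := rfl
    rw [this, D_sub ((hm j).avg hψ _) ((hu k).mul (hu j))]
  have e5 : D k (mollPressure ψ l v p t) x = D k (avg ψ (-l) (p t)) x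
      + (1 / 3) * ∑ j, D k (commut ψ (-l) (v j t) (v j t)) x := by
    have : mollPressure ψ l v p t = fun x => avg ψ (-l) (p t) x
      + (1 / 3) * ∑ j, commut ψ (-l) (v j t) (v j t) x := rfl
    rw [this, D_add (hpt.avg hψ _) ((SP.sum _ fun j _ => hc j j).const_mul _),
      D_const_mul _ (SP.sum _ fun j _ => hc j j), D_sum _ fun j _ => hc j j]
  rw [mollForce, e5, e2, ← e3]
  simp only [e4, Finset.sum_sub_distrib]
  ring

end Mollified

section Bounds

variable {ψ : E3 → ℝ} {α l : ℝ}

/-- Bounds for all derivatives at the length scale `l` give Hölder bounds at this scale. -/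
theorem hb_of_scale (hα0 : 0 ≤ α) (hα1 : α ≤ 1) (hl : 0 < l) (hl1 : l ≤ 1) {G : E3 → ℝ} (hG : SP G)
    {a : ℕ → ℝ} (ha : ∀ N, 0 ≤ a N) {X : ℝ} (hX : 0 ≤ X)
    (h : ∀ (N : ℕ) (θ : List (Fin 3)), θ.length = N → ∀ x, |Dw θ G x| ≤ a N * X * (l⁻¹) ^ N)
    {N : ℕ} {θ : List (Fin 3)} (hθ : θ.length = N) :
    HB α (3 * (a N + a (N + 1)) * (X * l ^ (-α)) * (l⁻¹) ^ N) (Dw θ G) := by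
  have h0 := ha N
  have h1 := ha (N + 1)
  have hX' : 0 ≤ X * (l⁻¹) ^ N := by positivity
  refine ((hG.Dw θ).hb_of_D hα0 hα1 hl hl1 (A := (a N + a (N + 1)) * (X * (l⁻¹) ^ N))
    (fun x => (h N θ hθ x).trans ?_) (fun i x => ?_)).mono (le_of_eq (by ring))
  · nlinarith
  · refine (h (N + 1) (i :: θ) (by simp [hθ]) x).trans ?_
    have : 0 ≤ a N * (X * (l⁻¹) ^ N) * l⁻¹ := by positivity
    rw [pow_succ, div_eq_mul_inv]
    linarith

theorem hb_mollified (hψ : ContDiff ℝ ∞ ψ) (hc : HasCompactSupport ψ) (hα0 : 0 ≤ α) (hα1 : α ≤ 1)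
    (hl : 0 < l) (hl1 : l ≤ 1) {f : E3 → ℝ} (hf : SP f) {B : ℝ} (hB : ∀ i x, |D i f x| ≤ B)
    {j : ℕ} {θ : List (Fin 3)} (hθ : θ.length = j + 1) :
    HB α (3 * (kerMass ψ j + kerMass ψ (j + 1)) * (B * l ^ (-α)) * (l⁻¹) ^ j)
      (Dw θ (avg ψ (-l) f)) := by
  have hi : Integrable ψ := integrable_kerD hψ hc []
  have hB0 : 0 ≤ B := (abs_nonneg _).trans (hB 0 0)
  cases θ with
  | nil => simp at hθ
  | cons i θ =>
    rw [← Dw_D_eq_cons (hf.avg hi _), D_avg hf hi]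
    refine hb_of_scale hα0 hα1 hl hl1 ((hf.D i).avg hi _) (kerMass_nonneg ψ) hB0
      (fun N s hs x => ?_) (by simpa using hθ)
    exact (abs_Dw_avg_le hψ hc (hf.D i) hl hs hB0 fun y _ => hB i _).trans (le_of_eq (by ring))

/-- The constants in the bounds for `mollForce`. -/
def forceConst (ψ : E3 → ℝ) (r M : ℝ) (N : ℕ) : ℝ :=
  3 * kerMass ψ (N + 1) + 36 * M ^ 2 * commutConst ψ r (N + 1)

theorem commutConst_nonneg (ψ : E3 → ℝ) (r : ℝ) (N : ℕ) : 0 ≤ commutConst ψ r N := by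
  have := kerMass_nonneg ψ N
  unfold commutConst
  positivity

theorem forceConst_nonneg (ψ : E3 → ℝ) (r M : ℝ) (N : ℕ) : 0 ≤ forceConst ψ r M N := by
  have := kerMass_nonneg ψ (N + 1)
  have := commutConst_nonneg ψ r (N + 1)
  unfold forceConst
  positivity

/-- The commutators are of size `l² ‖∇v‖²`, which by `hd` is the size `d` of the stress. -/
theorem abs_Dw_mollForce_le (hψ : ContDiff ℝ ∞ ψ) (hc : HasCompactSupport ψ) (h1 : ∫ y, ψ y = 1)
    {r : ℝ} (hr : 0 ≤ r) (hψr : ∀ y ∈ tsupport ψ, ‖y‖ ≤ r) (hl : 0 < l)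
    {v : Fin 3 → ℝ → E3 → ℝ} {R : Fin 3 → Fin 3 → ℝ → E3 → ℝ} {t : ℝ} (hv : ∀ k, SP (v k t))
    (hR : ∀ k j, SP (R k j t)) {M s d : ℝ} (hM : 0 ≤ M) (hs : 0 ≤ s)
    (hvb : ∀ i k x, |D i (v k t) x| ≤ M * s) (hRb : ∀ k j x, |R k j t x| ≤ d)
    (hd : l ^ 2 * s ^ 2 = d) (k : Fin 3) {N : ℕ} {θ : List (Fin 3)} (hθ : θ.length = N) (x : E3) :
    |Dw θ (mollForce ψ l v R k t) x| ≤ forceConst ψ r M N * (l⁻¹ * d) * (l⁻¹) ^ N := by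
  have hi : Integrable ψ := integrable_kerD hψ hc []
  have hd0 : 0 ≤ d := by rw [← hd]; positivity
  have hcs := fun k j => (hv k).commut (hv j) hi (-l)
  have bR : ∀ j, |Dw θ (D j (avg ψ (-l) (R k j t))) x| ≤ (l⁻¹) ^ (N + 1) * (kerMass ψ (N + 1) * d) :=
    fun j => by
      rw [Dw_D_eq_cons ((hR k j).avg hi _)]
      exact abs_Dw_avg_le hψ hc (hR k j) hl (by simp [hθ]) hd0 fun y _ => hRb k j _
  have bC : ∀ m i j, |Dw θ (D m (commut ψ (-l) (v i t) (v j t))) x|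
      ≤ (l⁻¹) ^ (N + 1) * (9 * M ^ 2 * commutConst ψ r (N + 1) * d) := fun m i j => by
    rw [Dw_D_eq_cons (hcs i j)]
    refine (abs_Dw_commut_le hψ hc h1 hr hψr (hv i) (hv j) (by positivity) (by positivity)
      (fun x y => (hv i).lipschitz_of_D (fun m x => hvb m i x) x y)
      (fun x y => (hv j).lipschitz_of_D (fun m x => hvb m j x) x y) hl
      (show (m :: θ).length = N + 1 by simp [hθ]) x).trans (le_of_eq ?_)
    rw [← hd]; ring
  have s1 : SP fun x => ∑ j, D j (avg ψ (-l) (R k j t)) x :=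
    SP.sum _ fun j _ => ((hR k j).avg hi _).D j
  have s2 : SP fun x => ∑ j, D j (commut ψ (-l) (v k t) (v j t)) x :=
    SP.sum _ fun j _ => (hcs k j).D j
  have s3 : SP fun x => ∑ j, D k (commut ψ (-l) (v j t) (v j t)) x :=
    SP.sum _ fun j _ => (hcs j j).D k
  have e1 : mollForce ψ l v R k t = fun x => (∑ j, D j (avg ψ (-l) (R k j t)) x
      - ∑ j, D j (commut ψ (-l) (v k t) (v j t)) x)
      + (1 / 3) * ∑ j, D k (commut ψ (-l) (v j t) (v j t)) x := rfl
  rw [e1, Dw_add (s1.sub s2) (s3.const_mul _), Dw_sub s1 s2, Dw_const_mul _ s3,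
    Dw_sum _ fun j _ => ((hR k j).avg hi _).D j, Dw_sum _ fun j _ => (hcs k j).D j,
    Dw_sum _ fun j _ => (hcs j j).D k]
  have sum3 : ∀ {F : Fin 3 → ℝ} {K : ℝ}, (∀ j, |F j| ≤ K) → |∑ j, F j| ≤ 3 * K := fun h => by
    refine (Finset.abs_sum_le_sum_abs _ _).trans ((Finset.sum_le_sum fun j _ => h j).trans_eq ?_)
    simp
  have b1 := sum3 bR
  have b2 := sum3 fun j => bC j k j
  have b3 := sum3 fun j => bC k j j
  simp only
  have b4 : |1 / 3 * ∑ j, Dw θ (D k (commut ψ (-l) (v j t) (v j t))) x|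
      ≤ (l⁻¹) ^ (N + 1) * (9 * M ^ 2 * commutConst ψ r (N + 1) * d) := by
    rw [abs_mul, abs_of_pos (by norm_num : (0 : ℝ) < 1 / 3)]
    linarith
  refine (abs_add_le _ _).trans ((add_le_add ((abs_sub _ _).trans (add_le_add b1 b2)) b4).trans
    (le_of_eq ?_))
  rw [forceConst, pow_succ]
  ring

end Bounds

theorem mollVel_coord {ψ : E3 → ℝ} (hψ : Integrable ψ) {l : ℝ} (hl : 0 < l) {v : ℝ → E3 → E3}
    {t : ℝ} (hv : ∀ k, SP fun y => v t y k) (x : E3) (k : Fin 3) :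
    mollVel ψ l v t x k = avg ψ (-l) (fun y => v t y k) x := by
  rw [mollVel, mollify_eq_avg ψ hl, avg]
  rw [eval_integral_piLp]
  · rfl
  · exact fun k => (hv k).integrable_avg hψ (-l) x

theorem mollPres_eq {ψ : E3 → ℝ} (hψ : Integrable ψ) {l : ℝ} (hl : 0 < l) {v : ℝ → E3 → E3}
    {p : ℝ → E3 → ℝ} {t : ℝ} (hv : ∀ k, SP fun y => v t y k) (x : E3) :
    mollPres ψ l v p t x = mollPressure ψ l (fun k t y => v t y k) p t x := by
  have e1 : (fun y => ‖v t y‖ ^ 2) = fun y => ∑ j, v t y j * v t y j := by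
    ext y
    rw [EuclideanSpace.norm_sq_eq]
    exact Finset.sum_congr rfl fun j _ => by rw [Real.norm_eq_abs, sq_abs, sq]
  rw [mollPres, mollPressure, mollify_eq_avg ψ hl, mollify_eq_avg ψ hl, e1,
    avg_sum _ (fun j _ => (hv j).mul (hv j)) hψ, EuclideanSpace.norm_sq_eq,
    ← Finset.sum_sub_distrib]
  congr 2
  refine Finset.sum_congr rfl fun j _ => ?_
  rw [mollVel_coord hψ hl hv, commut, Real.norm_eq_abs, sq_abs, sq]

/-! ### The approximate solution and the exact solutions -/

/-- The constants in the bounds for the mollified velocity and the mollified stress. -/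
def coefConst (ψ : E3 → ℝ) (r M : ℝ) (j : ℕ) : ℝ :=
  1 + 3 * (kerMass ψ j + kerMass ψ (j + 1)) * M
    + 6 * (forceConst ψ r M j + forceConst ψ r M (j + 1))

/-- The threshold for `a`. It makes `ℓ^α ≤ a^{-α}` so small that `hb_gradient` applies on a time
interval of length `2 τ_q`. -/
def baseThreshold (ψ : E3 → ℝ) (r M α : ℝ) : ℝ :=
  max 1 ((2 * coefConst ψ r M 0 / smallConst α) ^ (1 / α))

theorem one_le_coefConst (ψ : E3 → ℝ) (r : ℝ) {M : ℝ} (hM : 0 ≤ M) (j : ℕ) :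
    1 ≤ coefConst ψ r M j := by
  have h1 := kerMass_nonneg ψ j
  have h2 := kerMass_nonneg ψ (j + 1)
  have h3 := forceConst_nonneg ψ r M j
  have h4 := forceConst_nonneg ψ r M (j + 1)
  have h5 : 0 ≤ 3 * (kerMass ψ j + kerMass ψ (j + 1)) * M := by positivity
  rw [coefConst]
  linarith

theorem smallConst_pos {α : ℝ} (hα0 : 0 < α) (hα1 : α < 1) : 0 < smallConst α := by
  have := czConst_pos hα0 hα1
  unfold smallConst
  positivity

/-- The comparison of the mollified velocity with the exact solution is an instance of the abstract
stability problem. -/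
theorem perturbation_of_approx {ψ : E3 → ℝ} (hψ : IsMollifier ψ) {r M : ℝ} (hr : 0 ≤ r)
    (hψr : ∀ y ∈ tsupport ψ, ‖y‖ ≤ r) (hM : 0 < M) {β γ b α a : ℝ} (hadm : Admissible β b)
    (h0 : 0 < γ) (h1 : γ < 1 / 3) (hα0 : 0 < α) (hα : α < alphaThreshold β b)
    (ha : baseThreshold ψ r M α ≤ a) {q : ℕ} {ν T : ℝ} (hν : 0 < ν)
    {v : ℝ → E3 → E3} {p : ℝ → E3 → ℝ} {R : ℝ → E3 → Mat3}
    (happ : IsApproxSolution M β γ α a b ν T q v p R) {tᵢ S : ℝ} (hti : 0 ≤ tᵢ) (hS : tᵢ < S)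
    (hST : S ≤ T) (hSτ : S ≤ tᵢ + 2 * tau β α a b q) {vᵢ : ℝ → E3 → E3} {pᵢ : ℝ → E3 → ℝ}
    (hsol : IsSolution ν γ tᵢ S vᵢ pᵢ)
    (hinit : ∀ x, vᵢ tᵢ x = mollVel ψ (ell β α a b q) v tᵢ x) :
    Perturbation α γ ν tᵢ S (tau β α a b q)
      (Real.sqrt (del β a b q) * lam a b q * ell β α a b q ^ (-α))
      (del β a b (q + 1) * ell β α a b q ^ (-1 + α)) (ell β α a b q)⁻¹ (coefConst ψ r M)
      (fun k t => avg ψ (-ell β α a b q) fun y => v t y k) (fun k t y => vᵢ t y k)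
      (fun k t x => vᵢ t x k - avg ψ (-ell β α a b q) (fun y => v t y k) x)
      (mollForce ψ (ell β α a b q) (fun k t y => v t y k) fun k j t y => R t y k j)
      (fun t x => mollPressure ψ (ell β α a b q) (fun k t y => v t y k) p t x - pᵢ t x) pᵢ := by
  have hα1 : α < 1 := by
    have := hα.trans_le (min_le_left _ _)
    linarith
  have ha1 : 1 ≤ a := (le_max_left _ _).trans ha
  have P := params hadm hα0 hα ha1 q
  have h1' : γ < 1 / 2 := by linarith
  set l := ell β α a b q with hl
  set s := Real.sqrt (del β a b q) * lam a b q with hs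
  have hl0 : 0 < l := P.ell_pos
  have hl1 : l ≤ 1 := P.ell_le_one
  have hs0 : 0 < s := mul_pos P.sqrt_del_pos (by linarith [P.one_le_lam])
  have hT : 0 < T := by linarith
  have hi : Integrable ψ := integrable_kerD hψ.smooth hψ.compact []
  have hsub : Icc tᵢ S ⊆ Icc 0 T := Icc_subset_Icc hti hST
  have Sol := happ.solution
  have hv : ∀ k, STP tᵢ S fun t y => v t y k := fun k => (Sol.stp_v k).mono hsub
  have hp : STP tᵢ S p := Sol.stp_p.mono hsub
  have hR : ∀ k j, STP tᵢ S fun t y => R t y k j := fun k j => (Sol.stp_R k j).mono hsub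
  have hdiv : ∀ t ∈ Icc tᵢ S, ∀ x, ∑ k, D k (fun y => v t y k) x = 0 := fun t ht x =>
    Sol.incompressible t (hsub ht) x
  have hu : ∀ k, STP tᵢ S fun t => avg ψ (-l) fun y => v t y k := fun k => (hv k).avg hS hi _
  have hvi : ∀ k, STP tᵢ S fun t y => vᵢ t y k := hsol.stp_v
  have hequ := fun k t (ht : t ∈ Icc tᵢ S) x => mollified_momentum (ν := ν) (l := l) hS h0 h1' hi hv hp
    hR hdiv (fun k t ht x => by
      rw [(Sol.stp_v k).dt_mono hS hsub ht]
      exact Sol.momentum_coord hT k (hsub ht) x) k ht x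
  have heqv : ∀ k, ∀ t ∈ Icc tᵢ S, ∀ x, dt tᵢ S (fun t y => vᵢ t y k) t x
      + ∑ j, vᵢ t x j * D j (fun y => vᵢ t y k) x + D k (pᵢ t) x
      + ν * fracLapScalar γ (fun y => vᵢ t y k) x = 0 := fun k t ht x => by
    have e1 := hsol.momentum_coord hS k ht x
    rw [sum_D_mul (u := fun k y => vᵢ t y k) (fun k => (hvi k).slice ht)
      (hsol.incompressible t ht)] at e1
    rw [e1]
    simp [D]
  have hvb : ∀ t ∈ Icc tᵢ S, ∀ i k x, |D i (fun y => v t y k) x| ≤ M * s := fun t ht i k x => by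
    have hsm : ContDiff ℝ ∞ (v t) := contDiff_euclidean.2 fun k => ((hv k).slice ht).smooth
    have := abs_D_le_of_cNorm hsm (by rw [mul_assoc]; positivity) (happ.vel_bound_one t (hsub ht)) i k x
    rwa [mul_assoc] at this
  have hlam0 : 0 < lam a b q := by linarith [P.one_le_lam]
  set d := del β a b (q + 1) * lam a b q ^ (-3 * α) with hd
  have hd0 : 0 ≤ d := mul_nonneg P.del_pos.le (Real.rpow_nonneg hlam0.le _)
  have hRb : ∀ t ∈ Icc tᵢ S, ∀ k j x, |R t x k j| ≤ d := fun t ht k j x =>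
    abs_le_of_cNorm hd0 (happ.stress_bound t (hsub ht)) k j x
  have hlα : 0 < l ^ (-α) := Real.rpow_pos_of_pos hl0 _
  have hc1 := one_le_coefConst ψ r hM.le
  refine {
    α_pos := hα0, α_lt := hα1, γ_pos := h0, γ_lt := h1', ν_nonneg := hν.le, lt := hS, le := hSτ,
    τ_pos := P.tau_pos, Λ_pos := by positivity, E_nonneg := ?_, ρ_pos := inv_pos.2 hl0,
    force_small := P.force_le, time_small := ?_, small := ?_, one_le_c := hc1, stp_u := hu,
    stp_v := hvi,
    stp_r := stp_mollForce hS hv hR hi, stp_π := (stp_mollPressure hS hv hp hi).sub hsol.stp_p,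
    stp_p := hsol.stp_p, w_eq := fun k => rfl, init := fun k => ?_, div_v := hsol.incompressible,
    div_u := fun t ht x => div_mollified hi (fun k => (hv k).slice ht) (hdiv t ht) x, eq_v := heqv,
    eq_w := ?_, hb_u := ?_, hb_r := ?_ }
  · exact mul_nonneg P.del_pos.le (Real.rpow_nonneg hl0.le _)
  · rw [P.tau_mul]
    exact Real.rpow_le_one hl0.le hl1 hα0.le
  · have e1 : 2 * tau β α a b q * (coefConst ψ r M 0 * (s * l ^ (-α)))
        = 2 * coefConst ψ r M 0 * l ^ α := by
      rw [← P.tau_mul]; ring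
    rw [e1]
    have hsc := smallConst_pos hα0 hα1
    have hc := hc1 0
    have h2 : 2 * coefConst ψ r M 0 / smallConst α ≤ a ^ α := by
      have h3 := Real.rpow_le_rpow (by positivity) ((le_max_right _ _).trans ha) hα0.le
      rwa [← Real.rpow_mul (by positivity), one_div_mul_cancel hα0.ne', Real.rpow_one] at h3
    have h4 : l ^ α ≤ (a ^ α)⁻¹ := by
      rw [← Real.inv_rpow (by linarith)]
      exact Real.rpow_le_rpow hl0.le P.ell_le hα0.le
    have haα : 0 < a ^ α := Real.rpow_pos_of_pos (by linarith) _
    rw [div_le_iff₀ hsc] at h2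
    calc 2 * coefConst ψ r M 0 * l ^ α ≤ a ^ α * smallConst α * (a ^ α)⁻¹ := by gcongr
      _ = smallConst α := by field_simp
  · ext x
    have := congrArg (fun z : E3 => z k) (hinit x)
    simp only at this
    rw [this, mollVel_coord hi hl0 fun k => (hv k).slice ⟨le_rfl, hS.le⟩]
  · intro k t ht x
    have hut := fun k => (hu k).slice ht
    have hvt := fun k => (hvi k).slice ht
    rw [STP.dt_sub hS (hvi k) (hu k) ht, fracLapScalar_sub h0 h1' (hvt k) (hut k),
      D_sub ((stp_mollPressure hS hv hp hi).slice ht) (hsol.stp_p.slice ht)]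
    have e1 : ∀ j, D j (fun x => vᵢ t x k - avg ψ (-l) (fun y => v t y k) x) x
        = D j (fun y => vᵢ t y k) x - D j (avg ψ (-l) fun y => v t y k) x := fun j => by
      rw [D_sub (hvt k) (hut k)]
    simp only [e1, mul_sub, sub_mul, Finset.sum_sub_distrib]
    linarith [heqv k t ht x, hequ k t ht x]
  · intro j θ hθ t ht k
    refine (hb_mollified hψ.smooth hψ.compact hα0.le hα1.le hl0 hl1 ((hv k).slice ht)
      (fun i x => hvb t ht i k x) hθ).mono (mul_le_mul_of_nonneg_right ?_ (by positivity))
    have e1 : 3 * (kerMass ψ j + kerMass ψ (j + 1)) * (M * s * l ^ (-α))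
        = 3 * (kerMass ψ j + kerMass ψ (j + 1)) * M * (s * l ^ (-α)) := by ring
    rw [e1]
    refine mul_le_mul_of_nonneg_right ?_ (by positivity)
    rw [coefConst]
    linarith [forceConst_nonneg ψ r M j, forceConst_nonneg ψ r M (j + 1)]
  · intro N θ hθ t ht k
    have hld : 0 ≤ l⁻¹ * d := by positivity
    refine (hb_of_scale hα0.le hα1.le hl0 hl1
      ((stp_mollForce hS hv hR hi k).slice ht) (forceConst_nonneg ψ r M) hld
      (fun N θ hθ x => abs_Dw_mollForce_le hψ.smooth hψ.compact hψ.integral_eq_one hr hψr hl0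
        (fun k => (hv k).slice ht) (fun k j => (hR k j).slice ht) hM.le hs0.le
        (fun i k x => hvb t ht i k x) (hRb t ht) P.ell_sq k hθ x) hθ).mono
      (mul_le_mul_of_nonneg_right ?_ (by positivity))
    have hf1 := forceConst_nonneg ψ r M N
    have hf2 := forceConst_nonneg ψ r M (N + 1)
    have h2 : l⁻¹ * d * l ^ (-α) ≤ 2 * (del β a b (q + 1) * l ^ (-1 + α)) := by
      have e1 : l ^ (-1 + α) = l⁻¹ * l ^ (2 * α) * l ^ (-α) := by
        rw [← Real.rpow_neg_one, ← Real.rpow_add hl0, ← Real.rpow_add hl0]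
        congr 1; ring
      have h3 := P.lam_rpow_le
      have h4 : 0 ≤ l⁻¹ * del β a b (q + 1) * l ^ (-α) := by
        have := P.del_pos
        positivity
      calc l⁻¹ * d * l ^ (-α) = l⁻¹ * del β a b (q + 1) * l ^ (-α) * lam a b q ^ (-3 * α) := by
            rw [hd]; ring
        _ ≤ l⁻¹ * del β a b (q + 1) * l ^ (-α) * (2 * l ^ (2 * α)) := by gcongr
        _ = _ := by rw [e1]; ring
    have hE : 0 ≤ del β a b (q + 1) * l ^ (-1 + α) :=
      mul_nonneg P.del_pos.le (Real.rpow_nonneg hl0.le _)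
    calc 3 * (forceConst ψ r M N + forceConst ψ r M (N + 1)) * (l⁻¹ * d * l ^ (-α))
        ≤ 3 * (forceConst ψ r M N + forceConst ψ r M (N + 1))
          * (2 * (del β a b (q + 1) * l ^ (-1 + α))) := by gcongr
      _ = 6 * (forceConst ψ r M N + forceConst ψ r M (N + 1))
          * (del β a b (q + 1) * l ^ (-1 + α)) := by ring
      _ ≤ _ := by
        refine mul_le_mul_of_nonneg_right ?_ hE
        have : 0 ≤ 3 * (kerMass ψ N + kerMass ψ (N + 1)) * M := by
          have h1 := kerMass_nonneg ψ N
          have h2 := kerMass_nonneg ψ (N + 1)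
          positivity
        rw [coefConst]
        linarith

namespace Perturbation

variable {α γ ν t₀ t₁ τ Λ E ρ : ℝ} {c : ℕ → ℝ} {u v w r : Fin 3 → ℝ → E3 → ℝ} {π p : ℝ → E3 → ℝ}

/-- The derivative of the difference along the flow of `u`, including the dissipation. -/
theorem dissipative_eq (P : Perturbation α γ ν t₀ t₁ τ Λ E ρ c u v w r π p) (k : Fin 3) {t : ℝ}
    (ht : t ∈ Icc t₀ t₁) (x : E3) :
    dt t₀ t₁ (w k) t x + ∑ j, u j t x * D j (w k t) x + ν * fracLapScalar γ (w k t) x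
      = (D k (π t) x - r k t x - ∑ j, w j t x * D j (u k t) x) - ∑ j, w j t x * D j (w k t) x := by
  rw [← P.eq_w k t ht x]
  have : ∀ j, v j t x = u j t x + w j t x := fun j => by rw [P.v_slice]
  simp only [this, add_mul, Finset.sum_add_distrib]
  ring

/-- The dissipation of the difference. The factor `τ` in the bound for `w` compensates the cost
`ρ^{2γ}` of the fractional Laplacian. -/
theorem hb_dissipation (P : Perturbation α γ ν t₀ t₁ τ Λ E ρ c u v w r π p) {t : ℝ}
    (ht : t ∈ Icc t₀ t₁) {N : ℕ} {C : ℝ} (hν : ν ≤ 1) (hτρ : τ * (ρ⁻¹) ^ (-2 * γ) ≤ 2)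
    (hfc : 0 ≤ fracConst γ)
    (h1 : ∀ θ : List (Fin 3), θ.length = N → ∀ k, HB α (C * (τ * E) * ρ ^ N) (Dw θ (w k t)))
    (h2 : ∀ θ : List (Fin 3), θ.length = N + 1 → ∀ k,
      HB α (C * (τ * E) * ρ ^ (N + 1)) (Dw θ (w k t)))
    {θ : List (Fin 3)} (hθ : θ.length = N) (k : Fin 3) :
    HB α (6 * fracConst γ * C * E * ρ ^ N)
      (Dw θ fun x => ν * fracLapScalar γ (w k t) x) := by
  have hw := (P.stp_w k).slice ht
  have hρ := P.ρ_pos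
  have hE := P.E_nonneg
  have hL := hw.fracLapScalar P.γ_pos P.γ_lt
  have hC : 0 ≤ C * (τ * E) * ρ ^ N := (h1 θ hθ k).nonneg
  rw [Dw_const_mul _ hL, Dw_fracLapScalar P.γ_pos P.γ_lt hw]
  have := HB.fracLapScalar P.γ_pos P.γ_lt (hw.Dw θ) (inv_pos.2 hρ) (h1 θ hθ k) fun i => by
    refine (h2 (i :: θ) (by simp [hθ]) k).mono (le_of_eq ?_)
    rw [pow_succ, div_inv_eq_mul]; ring
  refine (this.const_mul ν).mono ?_
  rw [abs_of_nonneg P.ν_nonneg]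
  rcases hE.eq_or_lt with h0 | h0
  · rw [← h0]; simp
  have hCn : 0 ≤ C := by
    by_contra hneg
    have h3 : 0 < τ * E * ρ ^ N := by
      have := P.τ_pos
      positivity
    have : C * (τ * E * ρ ^ N) < 0 := mul_neg_of_neg_of_pos (not_le.1 hneg) h3
    linarith
  have hpw : 0 ≤ (ρ⁻¹) ^ (-2 * γ) := by positivity
  calc ν * (3 * fracConst γ * ((ρ⁻¹) ^ (-2 * γ) * (C * (τ * E) * ρ ^ N)))
      ≤ 1 * (3 * fracConst γ * ((ρ⁻¹) ^ (-2 * γ) * (C * (τ * E) * ρ ^ N))) := by gcongr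
    _ = 3 * fracConst γ * C * E * ρ ^ N * (τ * (ρ⁻¹) ^ (-2 * γ)) := by ring
    _ ≤ 3 * fracConst γ * C * E * ρ ^ N * 2 := by gcongr
    _ = _ := by ring

end Perturbation

end FracNS

end

theorem proposition4p4 :
    ∃ α₀ : ℝ → ℝ → ℝ, (∀ β b : ℝ, Admissible β b → 0 < α₀ β b) ∧
    ∀ ψ : E3 → ℝ, IsMollifier ψ → ∀ M : ℝ, 0 < M →
    -- the threshold `a₀ β b α`, and the implicit constant `C β γ α N`
    ∃ (a₀ : ℝ → ℝ → ℝ → ℝ) (C : ℝ → ℝ → ℝ → ℕ → ℝ),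
    ∀ β γ b α a : ℝ, Admissible β b → 0 < γ → γ < 1 / 3 → 0 < α → α < α₀ β b → a₀ β b α ≤ a →
    ∀ (q : ℕ) (ν T : ℝ), 0 < ν → ν < 1 → 0 < T →
    ∀ (v : ℝ → E3 → E3) (p : ℝ → E3 → ℝ) (R : ℝ → E3 → Mat3),
      IsApproxSolution M β γ α a b ν T q v p R →
    -- an exact solution on `[tᵢ, S]`, where `tᵢ = i τ_q`, which starts from `v_ℓ (tᵢ)`
    ∀ (i : ℕ) (tᵢ S : ℝ), tᵢ = i * tau β α a b q → tᵢ < S → S ≤ T →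
      S ≤ tᵢ + 2 * tau β α a b q →
    ∀ (vᵢ : ℝ → E3 → E3) (pᵢ : ℝ → E3 → ℝ), IsSolution ν γ tᵢ S vᵢ pᵢ →
      (∀ x, vᵢ tᵢ x = mollVel ψ (ell β α a b q) v tᵢ x) →
    ∀ (N : ℕ), ∀ t ∈ Set.Icc tᵢ S,
      holderNorm N α (fun x => vᵢ t x - mollVel ψ (ell β α a b q) v t x)
        ≤ ENNReal.ofReal (C β γ α N *
            (tau β α a b q * del β a b (q + 1) * ell β α a b q ^ (-(N : ℝ) - 1 + α))) ∧
      holderNorm N α (gradient fun x =>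
          mollPres ψ (ell β α a b q) v p t x - pᵢ t x)
        ≤ ENNReal.ofReal (C β γ α N *
            (del β a b (q + 1) * ell β α a b q ^ (-(N : ℝ) - 1 + α))) ∧
      holderNorm N α (dissipativeD ν γ tᵢ S (mollVel ψ (ell β α a b q) v)
          (fun s x => vᵢ s x - mollVel ψ (ell β α a b q) v s x) t)
        ≤ ENNReal.ofReal (C β γ α N *
            (del β a b (q + 1) * ell β α a b q ^ (-(N : ℝ) - 1 + α))) ∧
      holderNorm N α (materialD tᵢ S (mollVel ψ (ell β α a b q) v)
          (fun s x => vᵢ s x - mollVel ψ (ell β α a b q) v s x) t)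
        ≤ ENNReal.ofReal (C β γ α N *
            (del β a b (q + 1) * ell β α a b q ^ (-(N : ℝ) - 1 + α))) := by
  refine ⟨alphaThreshold, fun β b h => alphaThreshold_pos h, fun ψ hψ M hM => ?_⟩
  obtain ⟨r, hr0, hψr⟩ : ∃ r : ℝ, 0 ≤ r ∧ ∀ y ∈ tsupport ψ, ‖y‖ ≤ r := by
    obtain ⟨r, hr⟩ := IsCompact.isBounded hψ.compact |>.exists_norm_le
    exact ⟨max r 0, le_max_right _ _, fun y hy => (hr y hy).trans (le_max_left _ _)⟩
  choose C₁ hC₁1 hC₁ using fun α N => Perturbation.main_bound α (coefConst ψ r M) N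
  choose C₂ hC₂1 hC₂ using fun α N => Perturbation.dissipative_bound α (coefConst ψ r M) N
  let K : ℝ → ℝ → ℕ → ℝ := fun γ α N => ∑ j ∈ Finset.range (N + 1),
    (C₁ α j + C₂ α j + 6 * |fracConst γ| * (C₁ α j + C₁ α (j + 1)))
  refine ⟨fun _ _ α => baseThreshold ψ r M α, fun _ γ α N => 3 * (N + 2) * K γ α N, ?_⟩
  intro β γ b α a hadm h0 h1 hα0 hα ha q ν T hν hν1 _ v p R happ i tᵢ S hti hS hST hSτ vᵢ pᵢ hsol
    hinit N t ht
  have ha1 : 1 ≤ a := (le_max_left _ _).trans ha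
  have hpar := params hadm hα0 hα ha1 q
  have hti0 : 0 ≤ tᵢ := by
    rw [hti]; exact mul_nonneg (Nat.cast_nonneg i) hpar.tau_pos.le
  have P := perturbation_of_approx hψ hr0 hψr hM hadm h0 h1 hα0 hα ha hν happ hti0 hS hST hSτ hsol
    hinit
  set l := ell β α a b q with hl
  set τ := tau β α a b q with hτ
  have hl0 : 0 < l := hpar.ell_pos
  have hρ1 : 1 ≤ l⁻¹ := (one_le_inv₀ hl0).2 hpar.ell_le_one
  have hτ0 : 0 < τ := hpar.tau_pos
  set E := del β a b (q + 1) * l ^ (-1 + α) with hE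
  have hE0 : 0 ≤ E := P.E_nonneg
  have hpow : del β a b (q + 1) * l ^ (-(N : ℝ) - 1 + α) = E * (l⁻¹) ^ N := by
    rw [hE, mul_assoc, inv_pow, ← Real.rpow_natCast, ← Real.rpow_neg hl0.le, ← Real.rpow_add hl0]
    congr 2; ring
  have hK : ∀ j ≤ N, C₁ α j + C₂ α j + 6 * |fracConst γ| * (C₁ α j + C₁ α (j + 1)) ≤ K γ α N :=
    fun j hj => Finset.single_le_sum
      (f := fun j => C₁ α j + C₂ α j + 6 * |fracConst γ| * (C₁ α j + C₁ α (j + 1)))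
      (fun j _ => by
        have h1 := hC₁1 α j
        have h2 := hC₂1 α j
        have h3 := hC₁1 α (j + 1)
        positivity) (Finset.mem_range.2 (Nat.lt_succ_of_le hj))
  have hfc : 0 < fracConst γ := fracConst_pos h0 (by linarith)
  have hterm : ∀ j, 0 ≤ 6 * |fracConst γ| * (C₁ α j + C₁ α (j + 1)) := fun j => by
    have h1 := hC₁1 α j
    have h3 := hC₁1 α (j + 1)
    positivity
  have hscale : ∀ (c : ℝ) (j : ℕ), j ≤ N → c ≤ K γ α N → 0 ≤ c →
      c * E * (l⁻¹) ^ j ≤ K γ α N * (E * (l⁻¹) ^ N) := fun c j hj hc hc0 => by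
    have h2 : (l⁻¹) ^ j ≤ (l⁻¹) ^ N := pow_le_pow_right₀ hρ1 hj
    have hKE : 0 ≤ K γ α N * E := mul_nonneg (hc0.trans hc) hE0
    calc c * E * (l⁻¹) ^ j ≤ K γ α N * E * (l⁻¹) ^ N :=
          mul_le_mul (mul_le_mul_of_nonneg_right hc hE0) h2 (by positivity) hKE
      _ = _ := by ring
  have hvs : ∀ s ∈ Icc tᵢ S, ∀ k, SP fun y => v s y k := fun s hs k =>
    (happ.solution.stp_v k).slice ⟨hti0.trans hs.1, hs.2.trans hST⟩
  have hi : MeasureTheory.Integrable ψ := integrable_kerD hψ.smooth hψ.compact []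
  have hcoord : ∀ s ∈ Icc tᵢ S, ∀ x k, (vᵢ s x - mollVel ψ l v s x) k
      = vᵢ s x k - avg ψ (-l) (fun y => v s y k) x := fun s hs x k => by
    rw [PiLp.sub_apply, mollVel_coord hi hl0 (hvs s hs)]
  have hcoordt : ∀ k, (fun y => (vᵢ t y - mollVel ψ l v t y) k)
      = fun x => vᵢ t x k - avg ψ (-l) (fun y => v t y k) x := fun k =>
    funext fun x => hcoord t ht x k
  have hWstp : ∀ k, STP tᵢ S fun s y => (vᵢ s y - mollVel ψ l v s y) k := fun k =>
    (P.stp_w k).congr fun s hs x => hcoord s hs x k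
  have hwt := fun k => (P.stp_w k).slice ht
  -- the components of the two derivatives along the flow
  have hmat : ∀ x k, materialD tᵢ S (mollVel ψ l v) (fun s x => vᵢ s x - mollVel ψ l v s x) t x k
      = FracNS.dt tᵢ S (fun t x => vᵢ t x k - avg ψ (-l) (fun y => v t y k) x) t x
        + ∑ j, avg ψ (-l) (fun y => v t y j) x
          * D j (fun x => vᵢ t x k - avg ψ (-l) (fun y => v t y k) x) x := fun x k => by
    rw [materialD, PiLp.add_apply, derivWithin_coord hS hWstp ht,
      fderiv_coord (fun k => by rw [hcoordt]; exact (hwt k).differentiable)]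
    congr 1
    · exact derivWithin_congr (fun s hs => hcoord s hs x k) (hcoord t ht x k)
    · refine Finset.sum_congr rfl fun j _ => ?_
      rw [hcoordt, mollVel_coord hi hl0 (hvs t ht)]
  have hdis : ∀ x k, dissipativeD ν γ tᵢ S (mollVel ψ l v) (fun s x => vᵢ s x - mollVel ψ l v s x)
      t x k = FracNS.dt tᵢ S (fun t x => vᵢ t x k - avg ψ (-l) (fun y => v t y k) x) t x
        + ∑ j, avg ψ (-l) (fun y => v t y j) x
          * D j (fun x => vᵢ t x k - avg ψ (-l) (fun y => v t y k) x) x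
        + ν * fracLapScalar γ (fun x => vᵢ t x k - avg ψ (-l) (fun y => v t y k) x) x :=
    fun x k => by
      rw [dissipativeD, PiLp.add_apply, hmat, PiLp.smul_apply, smul_eq_mul, ← hcoordt]
      rfl
  have hsmooth : ∀ {f : E3 → E3} {F : Fin 3 → E3 → ℝ}, (∀ k, (fun y => f y k) = F k) →
      (∀ k, SP (F k)) → ∀ k, ContDiff ℝ ∞ fun y => f y k := fun h hF k => by
    rw [h k]; exact (hF k).smooth
  have bw := fun j θ (hθ : θ.length = j) k => (hC₁ α j P t ht θ hθ k).1
  have bπ := fun j θ (hθ : θ.length = j) k => (hC₁ α j P t ht θ hθ k).2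
  have bd := fun j θ (hθ : θ.length = j) k => hC₂ α j P t ht θ hθ k
  have hut := fun k => (P.stp_u k).slice ht
  have hrt := fun k => (P.stp_r k).slice ht
  have hπt := P.stp_π.slice ht
  have hforce : ∀ k, SP fun x => (D k ((fun t x => mollPressure ψ l (fun k t y => v t y k) p t x
      - pᵢ t x) t) x - mollForce ψ l (fun k t y => v t y k) (fun k j t y => R t y k j) k t x
      - ∑ j, (vᵢ t x j - avg ψ (-l) (fun y => v t y j) x) * D j (avg ψ (-l) fun y => v t y k) x)
      - ∑ j, (vᵢ t x j - avg ψ (-l) (fun y => v t y j) x)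
        * D j (fun x => vᵢ t x k - avg ψ (-l) (fun y => v t y k) x) x := fun k =>
    (((hπt.D k).sub (hrt k)).sub (SP.sum _ fun j _ => (hwt j).mul ((hut k).D j))).sub
      (SP.sum _ fun j _ => (hwt j).mul ((hwt k).D j))
  have hL := fun k => ((hwt k).fracLapScalar h0 (by linarith : γ < 1 / 2)).const_mul ν
  -- the components of the fields in the four estimates
  have hpres : ∀ k, (fun y => gradient (fun x => mollPres ψ l v p t x - pᵢ t x) y k)
      = D k ((fun t x => mollPressure ψ l (fun k t y => v t y k) p t x - pᵢ t x) t) := fun k => by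
    ext y
    rw [gradient_coord]
    congr 1
    ext x
    rw [mollPres_eq hi hl0 (hvs t ht)]
  have hdis' : ∀ k, (fun y => dissipativeD ν γ tᵢ S (mollVel ψ l v)
      (fun s x => vᵢ s x - mollVel ψ l v s x) t y k) = _ := fun k =>
    funext fun x => (hdis x k).trans (P.dissipative_eq k ht x)
  have hmat' : ∀ k, (fun y => materialD tᵢ S (mollVel ψ l v)
      (fun s x => vᵢ s x - mollVel ψ l v s x) t y k) = fun x => _ - _ := fun k =>
    funext fun x => (hmat x k).trans (eq_sub_of_add_eq (P.dissipative_eq k ht x))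
  have b1 := fun j => hC₁1 α j
  have b2 := fun j => hC₂1 α j
  refine ⟨?_, ?_, ?_, ?_⟩
  · refine (holderNorm_le (K := τ * (K γ α N * (E * (l⁻¹) ^ N))) (hsmooth hcoordt hwt)
      fun j hj θ hθ k => ?_).trans_eq ?_
    · rw [hcoordt]
      refine (bw j θ hθ k).mono ?_
      have := hscale (C₁ α j) j hj (by linarith [hK j hj, hterm j, b2 j]) (by linarith [b1 j])
      calc C₁ α j * (τ * E) * (l⁻¹) ^ j = τ * (C₁ α j * E * (l⁻¹) ^ j) := by ring
        _ ≤ _ := by gcongr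
    · rw [mul_assoc τ, hpow]; congr 1; ring
  · refine (holderNorm_le (K := K γ α N * (E * (l⁻¹) ^ N)) (hsmooth hpres fun k => hπt.D k)
      fun j hj θ hθ k => ?_).trans_eq ?_
    · rw [hpres]
      exact (bπ j θ hθ k).mono
        (hscale (C₁ α j) j hj (by linarith [hK j hj, hterm j, b2 j]) (by linarith [b1 j]))
    · rw [hpow]; congr 1; ring
  · refine (holderNorm_le (K := K γ α N * (E * (l⁻¹) ^ N)) (hsmooth hdis' hforce)
      fun j hj θ hθ k => ?_).trans_eq ?_
    · rw [hdis']
      exact (bd j θ hθ k).mono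
        (hscale (C₂ α j) j hj (by linarith [hK j hj, hterm j, b1 j]) (by linarith [b2 j]))
    · rw [hpow]; congr 1; ring
  · refine (holderNorm_le (K := K γ α N * (E * (l⁻¹) ^ N)) (hsmooth hmat' fun k =>
      (hforce k).sub (hL k)) fun j hj θ hθ k => ?_).trans_eq ?_
    · rw [hmat', Dw_sub (hforce k) (hL k)]
      have hdiss := P.hb_dissipation ht (C := C₁ α j + C₁ α (j + 1)) (N := j) hν1.le
        (by rw [inv_inv]; exact hpar.tau_ell_le γ h1) hfc.le
        (fun θ hθ k => (bw j θ hθ k).mono (by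
          have := b1 (j + 1)
          gcongr
          linarith))
        (fun θ hθ k => (bw (j + 1) θ hθ k).mono (by
          have := b1 j
          gcongr
          linarith)) hθ k
      refine ((bd j θ hθ k).sub hdiss).mono ?_
      have h3 := hK j hj
      rw [abs_of_pos hfc] at h3
      have h4 := hterm j
      rw [abs_of_pos hfc] at h4
      have := hscale (C₂ α j + 6 * fracConst γ * (C₁ α j + C₁ α (j + 1))) j hj
        (by linarith [b1 j]) (by linarith [b2 j])
      refine le_trans (le_of_eq ?_) this
      ring
    · rw [hpow]; congr 1; ring
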